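/- **Setting.** Identify $\mathbb Z^2$ with $\mathbb Z+i\mathbb Z\subset\mathbb C$ and put $w_0=\frac12-\frac i2$. Let $A\subset\mathbb Z^2$ be finite with $0\in A$ and such that $A$ and $\mathbb Z^2\setminus A$ are both connected subgraphs of the square lattice. Let $D_A$ be the interior of the union of the closed unit squares centred at the points of $A$, and assume $w_0\in D_A$. Let $f$ be the conformal map of $D_A$ onto the unit disc with $f(w_0)=0$, $f'(w_0)>0$, extended continuously to $\overline{D_A}$. Let $\partial_eA$ be the set of ordered pairs $a=[a_-,a_+]$ of nearest neighbours with $a_-\in A$, $a_+\notin A$ (identified with their midpoints, which lie on $\partial D_A$), and let $a\ne b$ be elements of $\partial_eA$. **Weights.** A walk $\omega=[\omega_0,\dots,\omega_\tau]$ is a nearest-neighbour path, $|\omega|=\tau$, $p(\omega)=4^{-|\omega|}$. For a curve in $\overline{D_A}\setminus\{w_0\}$ along which $\arg f$ has a continuous version going from $\Theta_0$ to $\Theta_1$, put $J=\lfloor\Theta_1/2\pi\rfloor-\lfloor\Theta_0/2\pi\rfloor$ and $Q=(-1)^J$. For a walk $\omega$, $Q(\omega)$ is the product of the signs $Q$ of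 its edges, where only the half lying in $\overline{D_A}$ is used for a boundary edge; $q(\omega)=p(\omega)Q(\omega)$. **Loops.** A rooted loop $\ell$ is a walk with equal first and last vertices; an unrooted loop is a class of rooted loops whose sequences of directed edges agree up to cyclic permutation. The rooted loop measures give $\ell$ mass $p(\ell)/|\ell|$, respectively $q(\ell)/|\ell|$ (and $0$ if $|\ell|=0$); $m$ and $m^q$ are the induced measures on unrooted loops. For a set or walk $B$, $F(B;A)=\exp\{m[\text{loops in }A\text{ that meet }B]\}$, and $F^q(B;A)$ is defined likewise from $m^q$. $\mathcal J_A$ is the set of unrooted loops in $A$ with odd winding number around $w_0$. **Self-avoiding walks.** $\mathcal W(A;a,b)$ is the set of walks $[a_+,a_-,\dots,b_-,b_+]$ whose vertices other than the first and last are in $A$; viewed as curves, they run from the midpoint of $a$ to the midpoint of $b$. Such a walk is a SAW if this curve is simple, i.e. its vertices other than the first and last are distinct. $L(\omega)$ is the chronological loop erasure of $\omega\in\mathcal W(A;a,b)$ (applied to the vertices other than the first and last), $\hat p(\eta)=\sum_{\omega\in\mathcal W(A;a,b):\,L(\omega)=\eta}p(\omega)$, and $H_{\partial A}(a,b)=\sum_{\omega\in\mathcal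 W(A;a,b)}p(\omega)$. Let $P(a,b;A)$ be the probability that loop-erased random walk from $a$ to $b$ in $A$ uses the unordered edge $[0,1]$, i.e. $H_{\partial A}(a,b)^{-1}$ times the total $p$-weight of the $\omega\in\mathcal W(A;a,b)$ such that $L(\omega)$ contains $[0,1]$ or $[1,0]$. **Theorem.** All the series over walks and loops involved converge absolutely, $H_{\partial A}(a,b)>0$, and a loop $\ell$ in $A$ satisfies $Q(\ell)=-1$ if and only if its winding number around $w_0$ is odd. Moreover: 1. Let $\lambda=[x_0,\dots,x_k]\subset A$ be a self-avoiding walk that contains the directed edge $[0,1]$, with $\operatorname{dist}(0,\partial D_A)\ge 2\operatorname{diam}\lambda$, and let $\lambda^R$ be its reversal. Let $\mathcal W^+$, respectively $\mathcal W^-$, be the set of SAWs in $\mathcal W(A;a,b)$ that contain $\lambda$, respectively $\lambda^R$, as a block of consecutive vertices. Let $K=A\setminus\lambda$. For a vertex $x$ and $c\in\{a,b\}$ let $H_{\partial K}(x,c)$ and $H^q_{\partial K}(x,c)$ be the sums of $p(\omega)$ and $q(\omega)$ over the walks $\omega$ that start at $x$, take their first step into $K$, stay in $K$, and then leave $K$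 through the edge $c$, and put $$\Delta_K=H_{\partial K}(x_0,a)H_{\partial K}(x_k,b)-H_{\partial K}(x_0,b)H_{\partial K}(x_k,a),\qquad \Delta^q_K=H^q_{\partial K}(x_0,a)H^q_{\partial K}(x_k,b)-H^q_{\partial K}(x_0,b)H^q_{\partial K}(x_k,a).$$ Then $$\sum_{\eta\in\mathcal W^+\cup\mathcal W^-}\hat p(\eta)=p(\lambda)\,e^{2m(\mathcal J_A)}\,F^q(\lambda;A)\,|\Delta^q_K|,$$ $$\sum_{\eta\in\mathcal W^{\pm}}\hat p(\eta)=\frac{p(\lambda)}2\Big[e^{2m(\mathcal J_A)}F^q(\lambda;A)\,|\Delta^q_K|\pm F(\lambda;A)\,\Delta_K\Big].$$ 2. For $B\subset A$ let $G^q_B(x,y)$ be the sum of $q(\omega)$ over the walks $\omega$ from $x$ to $y$ in $B$, and put $\bar q_A=\frac14\,G^q_A(0,0)\,G^q_{A\setminus\{0\}}(1,1)$. Let $S$ be simple random walk started at $z$, $\tau=\inf\{k\ge0:S_k\notin A\}$, and $$R_A(z,a)=\mathbf E^z\big[Q(S[0,\tau-\tfrac12])\,;\ S[1,\tau]\cap\{0,1\}=\emptyset,\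 S\text{ leaves }A\text{ through the edge }a\big],$$ $$\Phi_A(a,b)=\frac{|R_A(0,a)R_A(1,b)-R_A(0,b)R_A(1,a)|}{H_{\partial A}(a,b)}.$$ Then $$P(a,b;A)=\bar q_A\,\exp\{2m(\mathcal J_A)\}\,\Phi_A(a,b).$$ -/

import Mathlib

namespace LERW

noncomputable section

/-! ### The lattice, lattice domains and the associated planar domains -/

/-- Vertices of the square lattice; `(x, y)` stands for the complex number `x + i y`. -/
abbrev V := ℤ × ℤ

/-- The planar embedding of the lattice. -/
def toC (z : V) : ℂ := (z.1 : ℂ) + (z.2 : ℂ) * Complex.I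

/-- Nearest-neighbour relation on the lattice. -/
def Nbr (z w : V) : Prop := |z.1 - w.1| + |z.2 - w.2| = 1

/-- The square lattice as a graph. -/
def lattice : SimpleGraph V where
  Adj := Nbr
  symm := ⟨fun z w (h : |z.1 - w.1| + |z.2 - w.2| = 1) =>
    show |w.1 - z.1| + |w.2 - z.2| = 1 by rwa [abs_sub_comm w.1, abs_sub_comm w.2]⟩
  loopless := ⟨fun z (h : |z.1 - z.1| + |z.2 - z.2| = 1) => by simp at h⟩

/-- Finite, simply connected subsets of the lattice (the set and its complement are both connected
subgraphs) that contain the origin. -/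
structure IsLatticeDomain (A : Set V) : Prop where
  finite : A.Finite
  zero_mem : ((0, 0) : V) ∈ A
  connected : (lattice.induce A).Connected
  compl_connected : (lattice.induce Aᶜ).Connected

/-- The point `1/2 - i/2` of the dual lattice. -/
def w0 : ℂ := 1 / 2 - Complex.I / 2

/-- The closed unit square centred at `z`. -/
def square (z : V) : Set ℂ := {u | |u.re - z.1| ≤ 1 / 2 ∧ |u.im - z.2| ≤ 1 / 2}

/-- The planar domain `D_A`, the interior of the union of the closed squares centred in `A`. -/
def domainD (A : Set V) : Set ℂ := interior (⋃ z ∈ A, square z)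

/-- `f` is, on `D_A`, the (unique) conformal map of `D_A` onto the open unit disc with `f w0 = 0`
and `f' w0 > 0`. -/
structure IsNormalizedConformalMap (A : Set V) (f : ℂ → ℂ) : Prop where
  differentiableOn : DifferentiableOn ℂ f (domainD A)
  bijOn : Set.BijOn f (domainD A) (Metric.ball 0 1)
  map_w0 : f w0 = 0
  deriv_re_pos : 0 < (deriv f w0).re
  deriv_im_zero : (deriv f w0).im = 0

/-- The edge boundary of `A`: ordered pairs `(a₋, a₊)` with `a₋ ∈ A`, `a₊ ∉ A`, `|a₋ - a₊| = 1`. -/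
def edgeBoundary (A : Set V) : Set (V × V) := {a | a.1 ∈ A ∧ a.2 ∉ A ∧ Nbr a.1 a.2}

/-! ### Walks -/

/-- Nearest-neighbour walks `[ω₀, …, ω_τ]`, as the list of the vertices visited. -/
def IsWalk (ω : List V) : Prop := ω ≠ [] ∧ ω.IsChain Nbr

/-- Walks all of whose vertices lie in `B`. -/
def IsWalkIn (B : Set V) (ω : List V) : Prop := IsWalk ω ∧ ∀ z ∈ ω, z ∈ B

/-- The length `τ` (number of steps) of a walk `[ω₀, …, ω_τ]`. -/
def len (ω : List V) : ℕ := ω.length - 1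

/-- The sequence of directed edges `[ω_{j-1}, ω_j]` of a walk. -/
def steps (ω : List V) : List (V × V) := ω.zip ω.tail

/-- The random walk weight `p(ω) = 4^{-|ω|}`. -/
def p (ω : List V) : ℝ := (1 / 4) ^ len ω

/-! ### The sign `Q` and the signed weight `q` -/

/-- For a curve `g : [0,1] → ℂ ∖ {0}` with continuous argument `Θ`, the integer
`J = ⌊Θ(1) / 2π⌋ - ⌊Θ(0) / 2π⌋`, which does not depend on the choice of `Θ`. -/
def argFloorChange (g : ℝ → ℂ) : ℤ :=
  open Classical in
  if h : ∃ Θ : ℝ → ℝ, ContinuousOn Θ (Set.Icc 0 1) ∧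
      ∀ t ∈ Set.Icc (0 : ℝ) 1, g t = (‖g t‖ : ℂ) * Complex.exp ((Θ t : ℂ) * Complex.I)
  then ⌊h.choose 1 / (2 * Real.pi)⌋ - ⌊h.choose 0 / (2 * Real.pi)⌋
  else 0

/-- The midpoint of an edge. For `e = [a₋, a₊]` in the edge boundary of `A` it is the point of
`∂D_A` that is identified with `e`. -/
def midpt (e : V × V) : ℂ := (toC e.1 + toC e.2) / 2

/-- The part of the edge `e` inside the closure of `D_A`, parametrized by `[0,1]`: the whole
segment if both endpoints are in `A`, the half up to (or from) the midpoint for a boundary edge. -/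
def edgeCurve (A : Set V) (e : V × V) (t : ℝ) : ℂ :=
  open Classical in
  let u : ℂ := if e.1 ∈ A then toC e.1 else midpt e
  let v : ℂ := if e.2 ∈ A then toC e.2 else midpt e
  u + (t : ℂ) * (v - u)

/-- `Q(e) = (-1)^J` where `J` is computed along the image of the edge under the conformal map `f`,
extended by continuity from `D_A` to the boundary. -/
def edgeSign (A : Set V) (f : ℂ → ℂ) (e : V × V) : ℝ :=
  (-1) ^ argFloorChange (fun t => extendFrom (domainD A) f (edgeCurve A e t))

/-- `Q(ω) = ∏ Q(e_j)`, the product over the edges of `ω`. If the last edge of `ω` is in the edge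
boundary of `A`, only its half in the closure of `D_A` counts. -/
def Q (A : Set V) (f : ℂ → ℂ) (ω : List V) : ℝ := ((steps ω).map (edgeSign A f)).prod

/-- The signed weight `q(ω) = p(ω) Q(ω)`. -/
def q (A : Set V) (f : ℂ → ℂ) (ω : List V) : ℝ := p ω * Q A f ω

/-! ### Loops and loop measures. Everything is defined for a weight `w`, to be `p` or `q`. -/

/-- Rooted loops: walks that end where they start. -/
def IsLoop (ℓ : List V) : Prop := IsWalk ℓ ∧ ℓ.head? = ℓ.getLast?

/-- The unrooted loop of a rooted loop: its sequence of directed edges up to cyclic permutation. -/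
def unroot (ℓ : List V) : Cycle (V × V) := (steps ℓ : Cycle (V × V))

/-- The rooted loop measure `w(ℓ) / |ℓ|`, where loops of length `0` have measure `0`. -/
def rootedMass (w : List V → ℝ) (ℓ : List V) : ℝ := if len ℓ = 0 then 0 else w ℓ / len ℓ

/-- The measure of an unrooted loop: the sum of the rooted measures of its representatives. -/
def loopMass (w : List V → ℝ) (c : Cycle (V × V)) : ℝ :=
  ∑' ℓ : {ℓ : List V // IsLoop ℓ ∧ unroot ℓ = c}, rootedMass w ℓ

/-- The loop measure of a set of unrooted loops. -/
def loopMeasure (w : List V → ℝ) (S : Set (Cycle (V × V))) : ℝ := ∑' c : S, loopMass w c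

/-- Unrooted loops in `A` that meet `B`. -/
def loopsMeeting (B A : Set V) : Set (Cycle (V × V)) :=
  {c | ∃ ℓ, IsLoop ℓ ∧ IsWalkIn A ℓ ∧ (∃ z ∈ ℓ, z ∈ B) ∧ unroot ℓ = c}

/-- `F^w(B; A) = exp (m^w [loops in A that meet B])`. -/
def F (w : List V → ℝ) (B A : Set V) : ℝ := Real.exp (loopMeasure w (loopsMeeting B A))

/-- The total change of `arg (z - w0)` along a walk. A single edge turns by an angle smaller than
`π` around `w0`, so that the change along it is a principal argument. -/
def totalTurn (ω : List V) : ℝ :=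
  ((steps ω).map fun e => Complex.arg ((toC e.2 - w0) / (toC e.1 - w0))).sum

/-- The winding number of the loop `ℓ` around `w0` is odd. -/
def OddWinding (ℓ : List V) : Prop := ∃ k : ℤ, totalTurn ℓ = 2 * Real.pi * (2 * k + 1)

/-- The set of unrooted loops in `A` with odd winding number around `w0`. -/
def oddLoops (A : Set V) : Set (Cycle (V × V)) :=
  {c | ∃ ℓ, IsLoop ℓ ∧ IsWalkIn A ℓ ∧ OddWinding ℓ ∧ unroot ℓ = c}

/-! ### Boundary-to-boundary walks, loop erasure -/

/-- The walks `[a₊, a₋, …, b₋, b₊]` whose vertices other than the first and last are in `A`. -/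
def excursions (A : Set V) (a b : V × V) : Set (List V) :=
  {ω | IsWalk ω ∧ ∃ mid : List V, ω = a.2 :: (mid ++ [b.2]) ∧ (∀ z ∈ mid, z ∈ A) ∧
    mid.head? = some a.1 ∧ mid.getLast? = some b.1}

/-- Chronological loop erasure: after its starting vertex `x`, continue with what follows the last
visit to `x`. -/
def loopErase : List V → List V
  | [] => []
  | x :: xs => x :: loopErase (xs.rtakeWhile fun y => decide (y ≠ x))
termination_by l => l.length
decreasing_by
  have h := (List.rtakeWhile_suffix (fun y => decide (y ≠ x)) xs).length_le
  simp only [List.length_cons]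
  omega

/-- Loop erasure of a walk in `excursions A a b`. The walk runs from the midpoint of `a` to the
midpoint of `b`, so that loops are erased among the vertices other than the first and last one,
which may coincide with each other when `a₊ = b₊`. -/
def excursionErase : List V → List V
  | [] => []
  | x :: xs => x :: (loopErase xs.dropLast ++ xs.getLast?.toList)

/-- The self-avoiding walks from `a` to `b` in `A`: the curve from the midpoint of `a` to the
midpoint of `b` is simple. -/
def saws (A : Set V) (a b : V × V) : Set (List V) :=
  {η | η ∈ excursions A a b ∧ η.tail.dropLast.Nodup}

/-- Self-avoiding walks from `a` to `b` in `A` that contain the walk `lam`. -/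
def sawsThrough (A : Set V) (a b : V × V) (lam : List V) : Set (List V) :=
  {η | η ∈ saws A a b ∧ lam <:+: η}

/-- The loop-erased measure `p̂(η; A)` of a self-avoiding walk `η` from `a` to `b` in `A`. -/
def pHat (A : Set V) (a b : V × V) (η : List V) : ℝ :=
  ∑' ω : {ω : List V // ω ∈ excursions A a b ∧ excursionErase ω = η}, p ω

/-! ### Poisson kernels, Green's functions and determinants -/

/-- The boundary Poisson kernel `H_{∂A}(a, b)` between two boundary edges. -/
def edgeKernel (A : Set V) (a b : V × V) : ℝ := ∑' ω : excursions A a b, p ω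

/-- The walks that start at the vertex `x`, take the first step into `K`, stay in `K`, and then
leave it through the edge `a`. -/
def exitWalks (K : Set V) (x : V) (a : V × V) : Set (List V) :=
  {ω | IsWalk ω ∧ ∃ mid : List V, ω = x :: (mid ++ [a.2]) ∧ (∀ z ∈ mid, z ∈ K) ∧
    mid.getLast? = some a.1}

/-- The boundary Poisson kernel `H_{∂K}^w(x, a)` for the weight `w`. -/
def vertexKernel (w : List V → ℝ) (K : Set V) (x : V) (a : V × V) : ℝ :=
  ∑' ω : exitWalks K x a, w ω

/-- The determinant `Δ^w_K(x → a, y → b)`. -/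
def detKernel (w : List V → ℝ) (K : Set V) (x y : V) (a b : V × V) : ℝ :=
  vertexKernel w K x a * vertexKernel w K y b - vertexKernel w K x b * vertexKernel w K y a

/-- The Green's function `G^w_B(x, y)`. -/
def green (w : List V → ℝ) (B : Set V) (x y : V) : ℝ :=
  ∑' ω : {ω : List V // IsWalkIn B ω ∧ ω.head? = some x ∧ ω.getLast? = some y}, w ω

/-- `q̄_A = (1/4) G^q_A(0,0) G^q_{A ∖ {0}}(1,1)`. -/
def qBar (A : Set V) (f : ℂ → ℂ) : ℝ :=
  1 / 4 * green (q A f) A (0, 0) (0, 0) * green (q A f) (A \ {(0, 0)}) (1, 0) (1, 0)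

/-! ### Simple random walk and the observable -/

/-- The four unit steps. -/
def unitStep : Fin 4 → V := ![(1, 0), (-1, 0), (0, 1), (0, -1)]

/-- The law of a sequence of independent, uniformly distributed steps. -/
def stepsLaw : MeasureTheory.Measure (ℕ → Fin 4) :=
  MeasureTheory.Measure.infinitePi fun _ => (PMF.uniformOfFintype (Fin 4)).toMeasure

/-- Simple random walk started at `z`. -/
def srw (z : V) (ξ : ℕ → Fin 4) (n : ℕ) : V := z + ∑ j ∈ Finset.range n, unitStep (ξ j)

/-- The exit time `inf {k ≥ 0 : S_k ∉ A}`, which is finite almost surely when `A` is finite. -/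
def exitTime (A : Set V) (z : V) (ξ : ℕ → Fin 4) : ℕ := sInf {k | srw z ξ k ∉ A}

/-- The path `[S_0, …, S_τ]` of the walk up to the exit time. -/
def stoppedPath (A : Set V) (z : V) (ξ : ℕ → Fin 4) : List V :=
  (List.range (exitTime A z ξ + 1)).map (srw z ξ)

/-- The walk leaves `A` through the edge `a` and `S[1, τ]` does not meet `{0, 1}`. -/
def exitEvent (A : Set V) (z : V) (a : V × V) : Set (ℕ → Fin 4) :=
  {ξ | (∀ j ∈ Set.Icc 1 (exitTime A z ξ), srw z ξ j ≠ (0, 0) ∧ srw z ξ j ≠ (1, 0)) ∧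
    srw z ξ (exitTime A z ξ - 1) = a.1 ∧ srw z ξ (exitTime A z ξ) = a.2}

/-- `R_A(z, a) = E^z [Q(S[0, τ - 1/2]) ; S_τ = a, S[1, τ] ∩ {0, 1} = ∅]`. -/
def R (A : Set V) (f : ℂ → ℂ) (z : V) (a : V × V) : ℝ :=
  ∫ ξ, (exitEvent A z a).indicator (fun ξ => Q A f (stoppedPath A z ξ)) ξ ∂stepsLaw

/-- `Φ_A(a, b) = |R_A(0,a) R_A(1,b) - R_A(0,b) R_A(1,a)| / H_{∂A}(a,b)`. -/
def Phi (A : Set V) (f : ℂ → ℂ) (a b : V × V) : ℝ :=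
  |R A f (0, 0) a * R A f (1, 0) b - R A f (0, 0) b * R A f (1, 0) a| / edgeKernel A a b

/-- `H*_{∂A}(a, b)`: the total weight of the walks from `a` to `b` in `A` whose loop erasure
contains the edge `[0,1]` in one of its two directions. -/
def edgeKernelStar (A : Set V) (a b : V × V) : ℝ :=
  ∑' ω : {ω : List V // ω ∈ excursions A a b ∧
    ([(0, 0), (1, 0)] <:+: excursionErase ω ∨ [(1, 0), (0, 0)] <:+: excursionErase ω)}, p ω

/-- The probability that loop-erased random walk from `a` to `b` in `A` uses the unordered
edge `[0,1]`. -/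
def edgeProb (A : Set V) (a b : V × V) : ℝ := edgeKernelStar A a b / edgeKernel A a b

end

end LERW

namespace LERW

/-! ### Multiplicative weights of lists -/

/-! The loop-erased mass of a self-avoiding walk η is p(η) times the exponential of the loop measure
of the loops that meet η, and this exponential is a product of Green's functions
(`tsum_loopErase_eq`, `exp_loopSum_meets`). If η contains `lam`, cutting `lam` out leaves two
disjoint self-avoiding arms in K = A ∖ lam, and the loops meeting η split into those that meet `lam`
and those in K that meet an arm (`tsum_sawsThrough`). What remains is a sum over pairs of arms,
`pairSum`; reversing `lam` exchanges the ends from which the arms run to a and to b. Fomin's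
identity (`fomin_identity`, `pairSum_sub_pairSum`) evaluates the difference of the two pairings as a
2×2 determinant of exit kernels, for every symmetric signed edge weight dominated by simple random
walk. For the weight p this is S⁺ − S⁻, the mass through `lam` minus the mass through its reversal.

To get S⁺ + S⁻, the same identity is applied to a signed weight for which the two directions of the
edge [0,1] have opposite signs. Three facts make this work.

Gauge: on the simply connected D_A one has f(z) = (z − w₀) exp k(z), so on inner edges Q is the sign
of crossing the ray from w₀ to the left, up to a sign attached to each vertex
(`IsNormalizedConformalMap.exists_gauge`). Hence q agrees on loops with the multiplicative weight
`signWeight`, and in the determinants it differs from it only by a global sign.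

Topology: close a walk from a to b by a path outside A. The winding number is then constant along
the right-hand side of the walk, and the face w₀ is to the right of [0,1] but to the left of [1,0].
So all self-avoiding walks through [0,1] have one sign and all those through [1,0] the opposite one
(`wind_saw_sub_eq`).

Loops: a loop in A with nonzero winding around w₀ meets every walk that comes from outside A to 0.
Passing from p to the signed weight in the loop term of η therefore flips the sign of every odd
loop, and costs the factor exp(2 m(J_A)), the same for every η (`IsExcursion.greenProd_eq`).

Thus Fomin's difference for the signed weight is ±(S⁺ + S⁻) up to known factors, and half-sum and
half-difference give the first part (`tsum_pHat_add`, `tsum_pHat_sub`). The second part is the case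
lam = [0,1]: the loop term is the product of two Green's functions, and the quantities R are signed
exit kernels (`R_eq`). -/

/-- The product of `c` over the consecutive pairs of a list. -/
def W (c : V → V → ℝ) : List V → ℝ
  | [] => 1
  | [_] => 1
  | x :: y :: l => c x y * W c (y :: l)

@[simp] lemma W_nil (c : V → V → ℝ) : W c [] = 1 := rfl
@[simp] lemma W_singleton (c : V → V → ℝ) (x : V) : W c [x] = 1 := rfl
@[simp] lemma W_cons_cons (c : V → V → ℝ) (x y : V) (l : List V) :
    W c (x :: y :: l) = c x y * W c (y :: l) := rfl

lemma W_append_cons (c : V → V → ℝ) (l₁ : List V) (x : V) (l₂ : List V) :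
    W c (l₁ ++ x :: l₂) = W c (l₁ ++ [x]) * W c (x :: l₂) := by
  induction l₁ with
  | nil => simp
  | cons y l ih =>
    cases l with
    | nil => simp
    | cons z l => simp only [List.cons_append, W_cons_cons] at ih ⊢; rw [ih, mul_assoc]

lemma W_reverse {c : V → V → ℝ} (hc : ∀ u v, c u v = c v u) : ∀ l : List V,
    W c l.reverse = W c l
  | [] => rfl
  | [_] => rfl
  | x :: y :: l => by
    have ih := W_reverse hc (y :: l)
    rw [List.reverse_cons, List.reverse_cons, List.append_assoc, List.singleton_append,
      W_append_cons, ← List.reverse_cons, ih, W_cons_cons, W_cons_cons, W_singleton, hc y x]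
    ring

lemma steps_cons_cons (x y : V) (l : List V) : steps (x :: y :: l) = (x, y) :: steps (y :: l) := rfl

lemma steps_append_cons (l₁ : List V) (x : V) (l₂ : List V) :
    steps (l₁ ++ x :: l₂) = steps (l₁ ++ [x]) ++ steps (x :: l₂) := by
  induction l₁ with
  | nil => simp [steps]
  | cons y l ih =>
    cases l with
    | nil => simp [steps]
    | cons z l => simp only [List.cons_append, steps_cons_cons] at ih ⊢; rw [ih]

/-- Edge weights of the kind considered here: supported on nearest-neighbour pairs and bounded by
the transition probabilities of simple random walk. -/
structure IsWeight (c : V → V → ℝ) : Prop where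
  eq_zero : ∀ u v, ¬ Nbr u v → c u v = 0
  abs_le : ∀ u v, |c u v| ≤ 1 / 4
  symm : ∀ u v, c u v = c v u

lemma W_eq_zero_of_not_isChain {c : V → V → ℝ} (hc : IsWeight c) : ∀ l : List V,
    ¬ l.IsChain Nbr → W c l = 0
  | [], h => by simp at h
  | [_], h => by simp at h
  | x :: y :: l, h => by
    rw [List.isChain_cons_cons, not_and_or] at h
    rcases h with h | h
    · rw [W_cons_cons, hc.eq_zero _ _ h, zero_mul]
    · rw [W_cons_cons, W_eq_zero_of_not_isChain hc _ h, mul_zero]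

lemma nbr_iff {u v : V} : Nbr u v ↔ v = (u.1 + 1, u.2) ∨ v = (u.1 - 1, u.2) ∨
    v = (u.1, u.2 + 1) ∨ v = (u.1, u.2 - 1) := by
  obtain ⟨a, b⟩ := u
  obtain ⟨c, d⟩ := v
  simp only [Nbr, Prod.mk.injEq]
  grind

lemma Nbr.symm {u v : V} (h : Nbr u v) : Nbr v u := lattice.symm.symm u v h

lemma Nbr.ne {u v : V} (h : Nbr u v) : u ≠ v := by
  rintro rfl
  simp [Nbr] at h

/-! ### Summability -/

/-- A bounded strictly superharmonic function on a finite set. -/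
lemma exists_superharmonic {c : V → V → ℝ} (hc : IsWeight c) (B : Finset V) :
    ∃ u : V → ℝ, (∀ x ∈ B, 0 ≤ u x) ∧ ∀ x ∈ B, 1 + ∑ y ∈ B, |c x y| * u y ≤ u x := by
  -- The function will be 2(M − x²) in the first coordinate x. Averaging x² over the four neighbours
  -- adds 1/2, so the factor 2 makes the mean drop by exactly 1. The bound on `M` is (|x| + 1)² ≤ M,
  -- which keeps the function nonnegative on the neighbours of `B` as well.
  obtain ⟨M, hM⟩ : ∃ M : ℝ, ∀ x ∈ B, (x.1 : ℝ) ^ 2 + 2 * |(x.1 : ℝ)| + 1 ≤ M := by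
    obtain ⟨M, hM⟩ := (B.image fun x : V => (x.1 : ℝ) ^ 2 + 2 * |(x.1 : ℝ)| + 1).bddAbove
    exact ⟨M, fun x hx => hM (by simpa using ⟨x.1, ⟨x.2, hx⟩, rfl⟩)⟩
  have hu : ∀ x ∈ B, 0 ≤ 2 * (M - (x.1 : ℝ) ^ 2) := fun x hx => by
    have := hM x hx
    have := abs_nonneg (x.1 : ℝ)
    linarith
  refine ⟨fun x => 2 * (M - (x.1 : ℝ) ^ 2), hu, fun x hx => ?_⟩
  set N : Finset V := {(x.1 + 1, x.2), (x.1 - 1, x.2), (x.1, x.2 + 1), (x.1, x.2 - 1)} with hN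
  have hMx := hM x hx
  have habs := abs_nonneg (x.1 : ℝ)
  have hle := le_abs_self (x.1 : ℝ)
  have hge := neg_abs_le (x.1 : ℝ)
  have hu' : ∀ y ∈ N, 0 ≤ 2 * (M - (y.1 : ℝ) ^ 2) := by
    intro y hy
    simp only [hN, Finset.mem_insert, Finset.mem_singleton] at hy
    rcases hy with rfl | rfl | rfl | rfl <;> push_cast <;> nlinarith
  have h1 : ∑ y ∈ B, |c x y| * (2 * (M - (y.1 : ℝ) ^ 2)) ≤
      ∑ y ∈ N, 1 / 4 * (2 * (M - (y.1 : ℝ) ^ 2)) := by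
    calc ∑ y ∈ B, |c x y| * (2 * (M - (y.1 : ℝ) ^ 2))
        = ∑ y ∈ B with y ∈ N, |c x y| * (2 * (M - (y.1 : ℝ) ^ 2)) := by
          rw [Finset.sum_filter_of_ne]
          intro y _ hy
          by_contra hyN
          refine hy ?_
          rw [hc.eq_zero x y fun h => hyN ?_, abs_zero, zero_mul]
          simpa [hN] using nbr_iff.1 h
      _ ≤ ∑ y ∈ B with y ∈ N, 1 / 4 * (2 * (M - (y.1 : ℝ) ^ 2)) :=
          Finset.sum_le_sum fun y hy => mul_le_mul_of_nonneg_right (hc.abs_le x y)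
            (hu y (Finset.mem_filter.1 hy).1)
      _ ≤ _ := Finset.sum_le_sum_of_subset_of_nonneg
          (fun y hy => (Finset.mem_filter.1 hy).2)
          fun y hy _ => mul_nonneg (by norm_num) (hu' y hy)
  have h2 : ∑ y ∈ N, 1 / 4 * (2 * (M - (y.1 : ℝ) ^ 2)) = 2 * (M - (x.1 : ℝ) ^ 2) - 1 := by
    rw [hN, Finset.sum_insert, Finset.sum_insert, Finset.sum_insert, Finset.sum_singleton]
    · push_cast; ring
    all_goals simp [Prod.ext_iff]; try omega
  linarith

/-- The weights of the walks in a finite set are absolutely summable. -/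
lemma summable_W {c : V → V → ℝ} (hc : IsWeight c) (B : Finset V) :
    Summable fun l : List V => if ∀ v ∈ l, v ∈ B then W c l else 0 := by
  rw [← summable_abs_iff]
  set g : List V → ℝ := fun l => |if ∀ v ∈ l, v ∈ B then W c l else 0| with hg
  have g0 : ∀ l, 0 ≤ g l := fun l => abs_nonneg _
  have gcons : ∀ x y l, x ∈ B → g (x :: y :: l) = |c x y| * g (y :: l) := by
    intro x y l hx
    simp only [hg, List.forall_mem_cons, hx, true_and]
    split_ifs <;> simp [abs_mul]
  have gout : ∀ y l, y ∉ B → g (y :: l) = 0 := fun y l hy => by simp [hg, hy]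
  obtain ⟨u, hu0, hu⟩ := exists_superharmonic hc B
  -- Peeling off the first vertex of the lists in `s`, which are all prolonged by the map `x`: the
  -- empty list gives at most 1, the others are sorted by their first vertex, which must be in `B`.
  -- It is used with `x` a cons in the induction and with `x = id` at the end.
  have split : ∀ (n : ℕ) (s : Finset (List V)) (x : List V → List V) (C : ℝ),
      (∀ y l, y ∉ B → g (x (y :: l)) = 0) → g (x []) ≤ 1 → (∀ l ∈ s, l.length < n + 1) →
      (∀ t : Finset (List V), (∀ l ∈ t, l.length < n) →
        ∑ y ∈ B, ∑ l ∈ t, g (x (y :: l)) ≤ C) → ∑ l ∈ s, g (x l) ≤ 1 + C := by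
    intro n s x C hx hx1 hs ht
    set t := (s.filter (· ≠ [])).image List.tail with hdef
    have hinj : Set.InjOn (fun q : V × List V => q.1 :: q.2) (B ×ˢ t : Finset (V × List V)) := by
      rintro ⟨a, b⟩ _ ⟨c, d⟩ _ h
      simpa using h
    calc ∑ l ∈ s, g (x l) = ∑ l ∈ s with g (x l) ≠ 0, g (x l) :=
          (Finset.sum_filter_of_ne fun l _ h => h).symm
      _ ≤ ∑ l ∈ insert [] ((B ×ˢ t).image fun q => q.1 :: q.2), g (x l) := by
          refine Finset.sum_le_sum_of_subset_of_nonneg ?_ fun _ _ _ => g0 _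
          intro l hl
          rw [Finset.mem_filter] at hl
          rcases l with - | ⟨y, l⟩
          · simp
          · have hy : y ∈ B := by
              by_contra hy
              exact hl.2 (hx y l hy)
            refine Finset.mem_insert_of_mem (Finset.mem_image.2 ⟨(y, l), ?_, rfl⟩)
            rw [Finset.mem_product]
            exact ⟨hy, Finset.mem_image.2 ⟨y :: l, by simp [hl.1], rfl⟩⟩
      _ = g (x []) + ∑ y ∈ B, ∑ l ∈ t, g (x (y :: l)) := by
          rw [Finset.sum_insert (by simp), Finset.sum_image hinj, Finset.sum_product]
      _ ≤ 1 + C := by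
          refine add_le_add hx1 (ht t fun l hl => ?_)
          simp only [hdef, Finset.mem_image, Finset.mem_filter] at hl
          obtain ⟨l', ⟨hl', hne⟩, rfl⟩ := hl
          have := hs l' hl'
          have := List.length_pos_iff.2 hne
          simp only [List.length_tail]
          omega
  -- The superharmonic function dominates the total weight of the walks from `x` of bounded length;
  -- the inequality defining it is exactly the induction step.
  have key : ∀ n : ℕ, ∀ s : Finset (List V), (∀ l ∈ s, l.length < n) → ∀ x ∈ B,
      ∑ l ∈ s, g (x :: l) ≤ u x := by
    intro n
    induction n with
    | zero =>
      intro s hs x hx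
      rw [Finset.sum_eq_zero fun l hl => absurd (hs l hl) (by simp)]
      exact hu0 x hx
    | succ n ih =>
      intro s hs x hx
      refine (split n s (fun l => x :: l) (∑ y ∈ B, |c x y| * u y) ?_ ?_ hs ?_).trans (hu x hx)
      · intro y l hy; simp [hg, hy]
      · simp [hg, hx]
      · intro t ht
        refine Finset.sum_le_sum fun y hy => ?_
        simp only [gcons x y _ hx, ← Finset.mul_sum]
        exact mul_le_mul_of_nonneg_left (ih t ht y hy) (abs_nonneg _)
  refine summable_of_sum_le (c := 1 + ∑ y ∈ B, u y) g0 fun s => ?_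
  refine split (s.sup List.length) s id _ (fun y l hy => gout y l hy) (by simp [hg])
    (fun l hl => Nat.lt_succ_of_le (Finset.le_sup (f := List.length) hl)) fun t ht => ?_
  exact Finset.sum_le_sum fun y hy => key _ t ht y hy

/-- Comparison with the walks in a finite set. -/
lemma summable_of_abs_le_W {ι : Type*} {c : V → V → ℝ} (hc : IsWeight c) (B : Finset V) {i : ι → List V}
    (hi : Function.Injective i) {f : ι → ℝ}
    (hf : ∀ l, f l ≠ 0 → (∀ v ∈ i l, v ∈ B) ∧ |f l| ≤ |W c (i l)|) : Summable f := by
  refine Summable.of_norm_bounded (((summable_W hc B).abs).comp_injective hi) fun l => ?_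
  by_cases h : f l = 0
  · simp [h]
  · simp only [Function.comp_apply, if_pos (hf l h).1]
    exact (hf l h).2

/-! ### Sums over lists -/

lemma tsum_list_cons {f : List V → ℝ} (hf : Summable f) (K : Finset V)
    (hK : ∀ z ∉ K, ∀ l, f (z :: l) = 0) :
    ∑' l, f l = f [] + ∑ z ∈ K, ∑' l, f (z :: l) := by
  have hinj : Function.Injective fun q : V × List V => q.1 :: q.2 := by
    rintro ⟨a, b⟩ ⟨c, d⟩ h
    simpa using h
  rw [hf.tsum_eq_add_tsum_ite []]
  congr 1
  have h1 : ∑' l, (if l = [] then 0 else f l) = ∑' q : V × List V, f (q.1 :: q.2) := by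
    rw [← hinj.tsum_eq (f := fun l => if l = [] then 0 else f l)]
    · simp
    · intro l hl
      rcases l with - | ⟨z, l⟩
      · simp at hl
      · exact ⟨(z, l), rfl⟩
  have hs : Summable fun q : V × List V => f (q.1 :: q.2) := hf.comp_injective hinj
  rw [h1, hs.tsum_prod, tsum_eq_sum (s := K)]
  intro z hz
  simp [hK z hz]

lemma exists_eq_append_cons_of_mem {z : V} {l : List V} (h : z ∈ l) :
    ∃ s t, l = s ++ z :: t ∧ z ∉ t := by
  obtain ⟨s, t, he, hz⟩ := List.eq_append_cons_of_mem (List.mem_reverse.2 h)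
  refine ⟨t.reverse, s.reverse, ?_, by simpa using hz⟩
  rw [← List.reverse_reverse l, he]
  simp

/-- Uniqueness of the last occurrence of `z`; with the existence above, cutting a list there is a
bijection. -/
lemma append_cons_inj_of_not_mem {z : V} {s s' t t' : List V} (h : s ++ z :: t = s' ++ z :: t')
    (ht : z ∉ t) (ht' : z ∉ t') : s = s' ∧ t = t' := by
  rcases List.append_eq_append_iff.1 h with ⟨a, rfl, h2⟩ | ⟨a, rfl, h2⟩ <;>
  · rcases a with - | ⟨b, a⟩
    · simp_all
    · simp only [List.cons_append, List.cons.injEq] at h2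
      obtain ⟨rfl, rfl⟩ := h2
      simp at ht ht'

/-- Splitting a sum over lists at the last occurrence of `z`. -/
lemma tsum_split {f : List V → ℝ} (hf : Summable f) (z : V) :
    ∑' l, f l = ∑' l, (if z ∈ l then 0 else f l) +
      ∑' q : List V × List V, if z ∈ q.2 then 0 else f (q.1 ++ z :: q.2) := by
  have h1 : ∀ l, f l = (if z ∈ l then 0 else f l) + if z ∈ l then f l else 0 := by
    intro l; split_ifs <;> simp
  have s1 : Summable fun l => if z ∈ l then 0 else f l :=
    Summable.of_norm_bounded hf.norm fun l => by split_ifs <;> simp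
  have s2 : Summable fun l => if z ∈ l then f l else 0 :=
    Summable.of_norm_bounded hf.norm fun l => by split_ifs <;> simp
  rw [tsum_congr h1, s1.tsum_add s2]
  congr 1
  have hq : ∀ q : Function.support fun q : List V × List V =>
      if z ∈ q.2 then 0 else f (q.1 ++ z :: q.2), z ∉ q.1.2 := by
    rintro ⟨q, hq⟩ h
    simp [h] at hq
  refine tsum_eq_tsum_of_ne_zero_bij (fun q => q.1.1 ++ z :: q.1.2) ?_ ?_ ?_
  · intro q q' h
    obtain ⟨h1, h2⟩ := append_cons_inj_of_not_mem h (hq q) (hq q')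
    exact Subtype.ext (Prod.ext h1 h2)
  · intro l hl
    by_cases hz : z ∈ l
    · obtain ⟨s, t, rfl, ht⟩ := exists_eq_append_cons_of_mem hz
      refine ⟨⟨(s, t), ?_⟩, rfl⟩
      simpa [ht] using hl
    · simp [hz] at hl
  · intro q
    simp [hq q]

/-- The common form of all last-visit decompositions: a multiplicative weight factors at the last
visit to `z`, and only the second factor is constrained to avoid `z`. -/
lemma tsum_split_mul {f g h : List V → ℝ} (hf : Summable f) (hg : Summable g) (hh : Summable h)
    (z : V) (hfgh : ∀ s t, z ∉ t → f (s ++ z :: t) = g s * h t) :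
    ∑' l, f l = ∑' l, (if z ∈ l then 0 else f l) +
      (∑' l, g l) * ∑' l, if z ∈ l then 0 else h l := by
  have h' : Summable fun l => if z ∈ l then 0 else h l :=
    Summable.of_norm_bounded hh.norm fun l => by split_ifs <;> simp
  rw [tsum_split hf z, tsum_mul_tsum_of_summable_norm hg.norm h'.norm]
  congr 2
  ext ⟨s, t⟩
  by_cases ht : z ∈ t
  · simp [ht]
  · simp [ht, hfgh s t ht]

end LERW

namespace LERW

/-! ### Green's functions, exit kernels and loop erasure -/

noncomputable section Kernels

variable (c : V → V → ℝ)

/-- The Green's function on the diagonal, `G_B(x, x)`. -/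
def diagGreen (B : Finset V) (x : V) : ℝ :=
  ∑' s : List V, if (∀ v ∈ s ++ [x], v ∈ B) ∧ (s ++ [x]).head? = some x then W c (s ++ [x]) else 0

/-- The total weight of the walks that start at `x`, stay in `B` after the start and leave through
the edge `a`; the exit may happen in the first step. -/
def exitKernel (B : Finset V) (x : V) (a : V × V) : ℝ :=
  ∑' s : List V, if (∀ v ∈ s, v ∈ B) ∧ (x :: s).getLast? = some a.1
    then W c (x :: (s ++ [a.2])) else 0

/-- The total weight of the walks from `y` to `z` that are in `B` at all intermediate times. -/
def hitKernel (B : Finset V) (y z : V) : ℝ :=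
  ∑' s : List V, if ∀ v ∈ s, v ∈ B then W c (y :: (s ++ [z])) else 0

/-- The product `∏ G_{B_j}(x_j, x_j)`, `B_j = B ∖ {x_1, …, x_{j-1}}`. -/
def greenProd : Finset V → List V → ℝ
  | _, [] => 1
  | B, x :: l => diagGreen c B x * greenProd (B.erase x) l

/-- The sum over self-avoiding walks from `x` through `K` to the edge `a`, weighted with the loops
in `K` that meet the walk and with a function of the remaining set. -/
def pathSum (K : Finset V) (x : V) (a : V × V) (Φ : Finset V → ℝ) : ℝ :=
  ∑' l : List V, if l.Nodup ∧ (∀ v ∈ l, v ∈ K) ∧ (x :: l).getLast? = some a.1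
    then W c (x :: (l ++ [a.2])) * greenProd c K l * Φ (K \ l.toFinset) else 0

end Kernels

variable {c : V → V → ℝ}

lemma summable_diagGreen (hc : IsWeight c) (B : Finset V) (x : V) :
    Summable fun s : List V =>
      if (∀ v ∈ s ++ [x], v ∈ B) ∧ (s ++ [x]).head? = some x then W c (s ++ [x]) else 0 := by
  refine summable_of_abs_le_W hc B (i := fun s => s ++ [x]) (List.append_left_injective [x]) ?_
  intro s hs
  rw [ite_ne_right_iff] at hs
  exact ⟨hs.1.1, by rw [if_pos hs.1]⟩

lemma injective_cons_append (x y : V) : Function.Injective fun s : List V => x :: (s ++ [y]) :=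
  fun s t h => by simpa using h

lemma summable_exitKernel (hc : IsWeight c) (B : Finset V) (x : V) (a : V × V) :
    Summable fun s : List V => if (∀ v ∈ s, v ∈ B) ∧ (x :: s).getLast? = some a.1
      then W c (x :: (s ++ [a.2])) else 0 := by
  refine summable_of_abs_le_W hc (insert x (insert a.2 B)) (injective_cons_append x a.2) ?_
  intro s hs
  rw [ite_ne_right_iff] at hs
  refine ⟨?_, by rw [if_pos hs.1]⟩
  have := hs.1.1
  simp only [List.mem_cons, List.mem_append, List.not_mem_nil, or_false, Finset.mem_insert]
  grind

lemma summable_hitKernel (hc : IsWeight c) (B : Finset V) (y z : V) :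
    Summable fun s : List V => if ∀ v ∈ s, v ∈ B then W c (y :: (s ++ [z])) else 0 := by
  refine summable_of_abs_le_W hc (insert y (insert z B)) (injective_cons_append y z) ?_
  intro s hs
  rw [ite_ne_right_iff] at hs
  refine ⟨?_, by rw [if_pos hs.1]⟩
  have := hs.1
  simp only [List.mem_cons, List.mem_append, List.not_mem_nil, or_false, Finset.mem_insert]
  grind

lemma finite_nodup_lists (K : Finset V) : {l : List V | l.Nodup ∧ ∀ v ∈ l, v ∈ K}.Finite := by
  refine (K.powerset.finite_toSet.biUnion fun s _ =>
    List.finite_toSet s.toList.permutations).subset ?_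
  rintro l ⟨h1, h2⟩
  simp only [Finset.coe_powerset, Set.mem_preimage, Set.mem_powerset_iff, Set.mem_iUnion,
    Set.mem_ofPred_eq, List.mem_permutations, exists_prop]
  exact ⟨l.toFinset, fun v hv => h2 v (by simpa using hv), (List.toFinset_toList h1).symm⟩

lemma summable_pathSum (K : Finset V) (x : V) (a : V × V) (Φ : Finset V → ℝ) :
    Summable fun l : List V => if l.Nodup ∧ (∀ v ∈ l, v ∈ K) ∧ (x :: l).getLast? = some a.1
      then W c (x :: (l ++ [a.2])) * greenProd c K l * Φ (K \ l.toFinset) else 0 := by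
  refine summable_of_hasFiniteSupport ((finite_nodup_lists K).subset fun l hl => ?_)
  rw [Function.mem_support, ite_ne_right_iff] at hl
  exact ⟨hl.1.1, hl.1.2.1⟩

lemma ite_eq_ite_mul_ite {P Q R : Prop} [Decidable P] [Decidable Q] [Decidable R] {x y z : ℝ}
    (h : P ↔ Q ∧ R) (hx : P → x = y * z) :
    (if P then x else 0) = (if Q then y else 0) * if R then z else 0 := by
  by_cases hP : P
  · rw [if_pos hP, if_pos (h.1 hP).1, if_pos (h.1 hP).2, hx hP]
  · rw [if_neg hP]
    by_cases hQ : Q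
    · rw [if_neg fun hR => hP (h.2 ⟨hQ, hR⟩), mul_zero]
    · rw [if_neg hQ, zero_mul]

/-- A walk either avoids `z` or is cut at its last visit to `z`. The factor `hitKernel` does not
involve the exit edge, which is what lets it cancel in Fomin's identity. -/
lemma exitKernel_eq_add (hc : IsWeight c) {B : Finset V} {z : V} (hz : z ∈ B) (y : V)
    (a : V × V) : exitKernel c B y a =
      exitKernel c (B.erase z) y a + hitKernel c B y z * exitKernel c (B.erase z) z a := by
  unfold exitKernel hitKernel
  rw [tsum_split_mul (summable_exitKernel hc B y a) (summable_hitKernel hc B y z)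
    (summable_exitKernel hc (B.erase z) z a) z]
  · congr 2
    · ext s
      by_cases h : z ∈ s
      · rw [if_pos h, if_neg fun h' => by simpa using h'.1 z h]
      · simp only [h, if_false, Finset.mem_erase]
        congr 3
        grind
    · congr 1
      ext s
      by_cases h : z ∈ s
      · rw [if_pos h, if_neg fun h' => by simpa using h'.1 z h]
      · simp only [h, if_false]
  · intro s t ht
    have h1 : (y :: (s ++ z :: t)).getLast? = (z :: t).getLast? := by simp [List.getLast?_cons]
    have h2 : (∀ v ∈ s ++ z :: t, v ∈ B) ↔ (∀ v ∈ s, v ∈ B) ∧ ∀ v ∈ t, v ∈ B.erase z := by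
      simp only [List.mem_append, List.mem_cons, Finset.mem_erase]
      grind
    have h3 : W c (y :: (s ++ z :: t ++ [a.2])) =
        W c (y :: (s ++ [z])) * W c (z :: (t ++ [a.2])) := by
      have := W_append_cons c (y :: s) z (t ++ [a.2])
      simpa using this
    exact ite_eq_ite_mul_ite (by rw [h1, h2, and_assoc]) fun _ => h3

/-- A sum over walks in `B` started at `z`, factored at the last visit to `z`. -/
lemma tsum_eq_diagGreen_mul (hc : IsWeight c) {B : Finset V} {z : V} {f h : List V → ℝ}
    (hf : Summable f) (hh : Summable h) (hf0 : ∀ l, l.head? ≠ some z → f l = 0)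
    (hfh : ∀ s t, z ∉ t → f (s ++ z :: t) =
      (if (∀ v ∈ s ++ [z], v ∈ B) ∧ (s ++ [z]).head? = some z then W c (s ++ [z]) else 0) * h t) :
    ∑' l, f l = diagGreen c B z * ∑' t, if z ∈ t then 0 else h t := by
  rw [tsum_split_mul hf (summable_diagGreen hc B z) hh z hfh]
  have : ∀ l, (if z ∈ l then 0 else f l) = 0 := fun l => by
    split_ifs with hl
    · rfl
    · exact hf0 l fun h => hl (List.mem_of_mem_head? h)
  rw [tsum_congr this, tsum_zero, zero_add, diagGreen]

lemma head?_append_cons (s : List V) (z : V) (t : List V) :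
    (s ++ z :: t).head? = (s ++ [z]).head? := by cases s <;> simp

/-- Let `z` be the vertex after the first step and cut at the last visit to `z`: a step, then a loop
at `z`, then an exit that never returns to `z`. This is one step of chronological loop erasure,
written as a recursion in `B`. -/
lemma exitKernel_eq_sum (hc : IsWeight c) (B : Finset V) (x : V) (a : V × V) :
    exitKernel c B x a = (if x = a.1 then c x a.2 else 0) +
      ∑ z ∈ B, c x z * diagGreen c B z * exitKernel c (B.erase z) z a := by
  rw [exitKernel, tsum_list_cons (summable_exitKernel hc B x a) B fun z hz l => by simp [hz]]
  congr 1
  · simp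
  refine Finset.sum_congr rfl fun z hz => ?_
  have hs := summable_exitKernel hc B x a
  set f : List V → ℝ := fun s => if (∀ v ∈ s, v ∈ B) ∧ (x :: s).getLast? = some a.1
      then W c (x :: (s ++ [a.2])) else 0 with hf
  -- The first vertex is put back into the list, with an indicator that it is `z`, so that the
  -- factorization at the last visit applies to the whole walk.
  have hs' : Summable fun l => if l.head? = some z then f l else 0 :=
    Summable.of_norm_bounded hs.norm fun l => by split_ifs <;> simp
  have h1 : ∑' l, f (z :: l) = ∑' l, if l.head? = some z then f l else 0 := by
    rw [tsum_list_cons hs' {z} fun y hy l => by simp at hy; simp [hy]]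
    simp
  have hh := (summable_exitKernel hc (B.erase z) z a).mul_left (c x z)
  rw [h1, tsum_eq_diagGreen_mul (B := B) hc hs' hh (fun l hl => if_neg hl), exitKernel,
    mul_comm (c x z), mul_assoc, ← tsum_mul_left (a := c x z)]
  · refine congrArg (diagGreen c B z * ·) (tsum_congr fun t => ?_)
    by_cases h : z ∈ t
    · rw [if_pos h, if_neg fun h' => by simpa using h'.1 z h, mul_zero]
    · rw [if_neg h]
  · intro s t ht
    have h1 : (x :: (s ++ z :: t)).getLast? = (z :: t).getLast? := by simp [List.getLast?_cons]
    have h2 : (∀ v ∈ s ++ z :: t, v ∈ B) ↔ (∀ v ∈ s ++ [z], v ∈ B) ∧ ∀ v ∈ t, v ∈ B.erase z := by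
      simp only [List.mem_append, List.mem_cons, List.not_mem_nil, or_false, Finset.mem_erase]
      grind
    have h3 : (s ++ [z]).head? = some z → W c (x :: (s ++ z :: t ++ [a.2])) =
        W c (s ++ [z]) * (c x z * W c (z :: (t ++ [a.2]))) := by
      intro h
      have h4 := W_append_cons c (x :: s) z (t ++ [a.2])
      have h5 : W c (x :: (s ++ [z])) = c x z * W c (s ++ [z]) := by
        rcases s with - | ⟨y, s⟩
        · simp
        · simp only [List.cons_append, List.head?_cons, Option.some.injEq] at h
          simp [h]
      simp only [List.cons_append, List.append_assoc] at h4 ⊢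
      rw [h4, h5]
      ring
    rw [mul_ite_zero _ (c x z)]
    simp only [hf]
    rw [← ite_and]
    exact ite_eq_ite_mul_ite (by rw [h1, h2, head?_append_cons s z t]; tauto)
      fun h => h3 (by rw [← head?_append_cons s z t]; exact h.1)

/-- The first vertex of the path contributes its Green's function in `K`, and the rest is a path in
`K.erase z`. This is the recursion of `exitKernel_eq_sum`, with `Φ` carried to the end. -/
lemma pathSum_eq_sum (K : Finset V) (x : V) (a : V × V) (Φ : Finset V → ℝ) :
    pathSum c K x a Φ = (if x = a.1 then c x a.2 * Φ K else 0) +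
      ∑ z ∈ K, c x z * diagGreen c K z * pathSum c (K.erase z) z a Φ := by
  rw [pathSum, tsum_list_cons (summable_pathSum K x a Φ) K fun z hz l => by simp [hz]]
  congr 1
  · simp [greenProd]
  refine Finset.sum_congr rfl fun z hz => ?_
  rw [pathSum, ← tsum_mul_left]
  congr 1
  ext l
  have h1 : ((z :: l).Nodup ∧ (∀ v ∈ z :: l, v ∈ K) ∧ (x :: z :: l).getLast? = some a.1) ↔
      l.Nodup ∧ (∀ v ∈ l, v ∈ K.erase z) ∧ (z :: l).getLast? = some a.1 := by
    simp only [List.nodup_cons, List.mem_cons, Finset.mem_erase, List.getLast?_cons_cons]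
    grind
  have h2 : K \ (z :: l).toFinset = K.erase z \ l.toFinset := by
    ext v; simp; tauto
  rw [if_congr h1 rfl rfl, h2, mul_ite, mul_zero]
  congr 1
  simp only [List.cons_append, W_cons_cons, greenProd]
  ring

/-- Sorting walks by their loop erasure loses nothing: both sides satisfy the same recursion on the
cardinality of `K`. -/
lemma pathSum_one (hc : IsWeight c) (K : Finset V) (x : V) (a : V × V) :
    pathSum c K x a (fun _ => 1) = exitKernel c K x a := by
  induction h : K.card generalizing K x with
  | zero =>
    rw [Finset.card_eq_zero] at h
    subst h
    rw [pathSum_eq_sum, exitKernel_eq_sum hc]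
    simp
  | succ n ih =>
    rw [pathSum_eq_sum, exitKernel_eq_sum hc]
    simp only [mul_one]
    congr 1
    refine Finset.sum_congr rfl fun z hz => ?_
    rw [ih _ _ (by rw [Finset.card_erase_of_mem hz, h]; rfl)]

/-- **Fomin's identity** for two paths. -/
theorem fomin_identity (hc : IsWeight c) (K : Finset V) (x y : V) (a b : V × V) :
    pathSum c K x a (fun K' => exitKernel c K' y b) -
      pathSum c K x b (fun K' => exitKernel c K' y a) =
    exitKernel c K x a * exitKernel c K y b - exitKernel c K x b * exitKernel c K y a := by
  induction h : K.card using Nat.strong_induction_on generalizing K x with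
  | _ n ih =>
    -- By induction each summand is a determinant in `K.erase z`. Enlarging the domain of the walks
    -- from `y` back to `K` adds to the row of `y` a multiple, by `hitKernel`, of the row of `z`;
    -- the determinant does not change.
    have key : ∑ z ∈ K, c x z * diagGreen c K z *
        (pathSum c (K.erase z) z a (fun K' => exitKernel c K' y b) -
          pathSum c (K.erase z) z b (fun K' => exitKernel c K' y a)) =
        (∑ z ∈ K, c x z * diagGreen c K z * exitKernel c (K.erase z) z a) * exitKernel c K y b -
        (∑ z ∈ K, c x z * diagGreen c K z * exitKernel c (K.erase z) z b) *
          exitKernel c K y a := by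
      rw [Finset.sum_mul, Finset.sum_mul, ← Finset.sum_sub_distrib]
      refine Finset.sum_congr rfl fun z hz => ?_
      have hn : (K.erase z).card < n := h ▸ Finset.card_erase_lt_of_mem hz
      rw [ih _ hn (K.erase z) z rfl, exitKernel_eq_add hc hz y a, exitKernel_eq_add hc hz y b]
      ring
    rw [pathSum_eq_sum, pathSum_eq_sum, exitKernel_eq_sum hc K x a, exitKernel_eq_sum hc K x b]
    simp only [mul_sub, Finset.sum_sub_distrib] at key
    split_ifs <;> linear_combination key

/-! ### Loop erasure and last visits -/

lemma rtakeWhile_append_cons {z : V} (s : List V) {t : List V} (ht : z ∉ t) :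
    (s ++ z :: t).rtakeWhile (fun y => decide (y ≠ z)) = t := by
  have h : ∀ y ∈ t.reverse, decide (y ≠ z) = true := by
    intro y hy
    rw [List.mem_reverse] at hy
    simp only [decide_eq_true_eq]
    rintro rfl
    exact ht hy
  rw [List.rtakeWhile, List.reverse_append, List.reverse_cons, List.append_assoc,
    List.takeWhile_append_of_pos h]
  simp

/-- The hypothesis on `head?` says that the walk starts at `z` and covers the case of an empty `s`;
the remainder after the last visit to `z` is then all that loop erasure sees. -/
lemma loopErase_append_cons {z : V} {s t : List V} (ht : z ∉ t)
    (hs : (s ++ [z]).head? = some z) : loopErase (s ++ z :: t) = z :: loopErase t := by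
  rcases s with - | ⟨y, s⟩
  · rw [List.nil_append, loopErase, List.rtakeWhile_eq_self_iff.2]
    intro y hy
    simp only [decide_eq_true_eq]
    rintro rfl
    exact ht hy
  · simp only [List.cons_append, List.head?_cons, Option.some.injEq] at hs
    subst hs
    rw [List.cons_append, loopErase, rtakeWhile_append_cons s ht]

lemma head?_loopErase (l : List V) : (loopErase l).head? = l.head? := by
  cases l <;> simp [loopErase]

/-- The total weight of the walks in `B` with a given loop erasure. -/
lemma tsum_loopErase_eq (hc : IsWeight c) {l : List V} {B : Finset V} (hl : l.Nodup)
    (hB : ∀ v ∈ l, v ∈ B) :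
    ∑' ω : List V, (if (∀ v ∈ ω, v ∈ B) ∧ loopErase ω = l then W c ω else 0) =
      W c l * greenProd c B l := by
  have hsum : ∀ (B : Finset V) (l : List V), Summable fun ω : List V =>
      if (∀ v ∈ ω, v ∈ B) ∧ loopErase ω = l then W c ω else 0 := by
    intro B l
    refine summable_of_abs_le_W hc B Function.injective_id ?_
    intro ω hω
    rw [ite_ne_right_iff] at hω
    exact ⟨hω.1.1, by rw [if_pos hω.1, id]⟩
  induction l generalizing B with
  | nil =>
    rw [tsum_eq_single []]
    · simp [loopErase, greenProd]
    · intro ω hω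
      rw [if_neg]
      rintro ⟨-, h⟩
      have := head?_loopErase ω
      rw [h] at this
      exact hω (by simpa using this.symm)
  | cons z l ih =>
    rw [List.nodup_cons] at hl
    have ih' := ih hl.2 (B := B.erase z) fun v hv => Finset.mem_erase.2
      ⟨fun h => hl.1 (h ▸ hv), hB v (List.mem_cons_of_mem _ hv)⟩
    -- The weight of the step from `z` to the rest of the walk. Loop erasure preserves the first
    -- vertex, so this step is determined by `l`; it is replaced by 1 when `l` is empty.
    obtain ⟨k, hk⟩ : ∃ k : ℝ, ∀ t : List V, t.head? = l.head? → W c (z :: t) = k * W c t := by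
      rcases l with - | ⟨y, l⟩
      · exact ⟨1, fun t ht => by simp at ht; simp [ht]⟩
      · refine ⟨c z y, fun t ht => ?_⟩
        rcases t with - | ⟨y', t⟩
        · simp at ht
        · simp only [List.head?_cons, Option.some.injEq] at ht
          simp [ht]
    rw [tsum_eq_diagGreen_mul hc (hsum B (z :: l)) ((hsum (B.erase z) l).mul_left k), greenProd,
      hk l rfl]
    · have : ∀ t : List V, (if z ∈ t then 0 else
          k * (if (∀ v ∈ t, v ∈ B.erase z) ∧ loopErase t = l then W c t else 0)) =
          k * (if (∀ v ∈ t, v ∈ B.erase z) ∧ loopErase t = l then W c t else 0) := by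
        intro t
        by_cases h : z ∈ t
        · rw [if_pos h, if_neg fun h' => by simpa using h'.1 z h, mul_zero]
        · rw [if_neg h]
      rw [tsum_congr this, tsum_mul_left, ih']
      ring
    · intro ω hω
      rw [if_neg]
      rintro ⟨-, h⟩
      have := head?_loopErase ω
      rw [h] at this
      exact hω this.symm
    · intro s t ht
      have h2 : (∀ v ∈ s ++ z :: t, v ∈ B) ↔
          (∀ v ∈ s ++ [z], v ∈ B) ∧ ∀ v ∈ t, v ∈ B.erase z := by
        simp only [List.mem_append, List.mem_cons, List.not_mem_nil, or_false, Finset.mem_erase]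
        grind
      by_cases hs : (s ++ [z]).head? = some z
      · rw [mul_ite_zero _ k]
        refine ite_eq_ite_mul_ite ?_ fun h => ?_
        · rw [loopErase_append_cons ht hs, h2]
          simp only [List.cons.injEq, true_and, hs, and_true, and_assoc]
        · rw [loopErase_append_cons ht hs, List.cons.injEq] at h
          rw [W_append_cons, hk t (by rw [← h.2.2, head?_loopErase])]
      · rw [if_neg, if_neg (fun h => hs h.2), zero_mul]
        rintro ⟨-, h⟩
        have := head?_loopErase (s ++ z :: t)
        rw [h, head?_append_cons] at this
        exact hs this.symm

end LERW

namespace LERW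

/-! ### Sums over rooted loops -/

/-- The rooted loop that visits the vertices of a nonempty list and returns to the first one. -/
def closeUp (u : List V) : List V := u ++ u.head?.toList

@[simp] lemma closeUp_cons (x : V) (u : List V) : closeUp (x :: u) = x :: (u ++ [x]) := rfl

lemma closeUp_injective : Function.Injective closeUp := by
  intro u v h
  rcases u with - | ⟨x, u⟩ <;> rcases v with - | ⟨y, v⟩
  · rfl
  · simp [closeUp] at h
  · simp [closeUp] at h
  · simp only [closeUp_cons, List.cons.injEq] at h
    obtain ⟨rfl, h⟩ := h
    simpa using h

variable {c : V → V → ℝ}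

/-- Changing the root only permutes the edge factors cyclically. -/
lemma W_closeUp_rotate (c : V → V → ℝ) (u : List V) (i : ℕ) :
    W c (closeUp (u.rotate i)) = W c (closeUp u) := by
  have one : ∀ u : List V, W c (closeUp (u.rotate 1)) = W c (closeUp u) := by
    rintro (- | ⟨x, - | ⟨y, t⟩⟩)
    · simp
    · simp
    · simp only [List.rotate_cons_succ, List.rotate_zero, List.cons_append, closeUp_cons,
        W_cons_cons]
      have := W_append_cons c (y :: t) x [y]
      simp only [List.cons_append, W_cons_cons, W_singleton, mul_one] at this
      rw [List.append_assoc, List.singleton_append, this, mul_comm]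
  induction i with
  | zero => simp
  | succ i ih => rw [← List.rotate_rotate, one, ih]

/-- The sum `∑ W(ℓ) / |ℓ|` over the rooted loops in `A` whose list of vertices satisfies `P`. -/
noncomputable def loopSum (c : V → V → ℝ) (A : Finset V) (P : List V → Prop) : ℝ :=
  open Classical in
  ∑' u : List V, if (∀ v ∈ u, v ∈ A) ∧ P u then W c (closeUp u) / u.length else 0

lemma mem_closeUp {u : List V} {v : V} : v ∈ closeUp u ↔ v ∈ u := by
  rcases u with - | ⟨x, u⟩
  · simp [closeUp]
  · simp only [closeUp_cons, List.mem_cons, List.mem_append, List.not_mem_nil, or_false]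
    tauto

lemma abs_div_natCast_le (a : ℝ) (n : ℕ) : |a / n| ≤ |a| := by
  rw [abs_div, Nat.abs_cast]
  rcases Nat.eq_zero_or_pos n with rfl | hn
  · simp
  · exact div_le_self (abs_nonneg a) (by exact_mod_cast hn)

open Classical in
lemma summable_loopSum (hc : IsWeight c) (A : Finset V) (P : List V → Prop) :
    Summable fun u : List V =>
      if (∀ v ∈ u, v ∈ A) ∧ P u then W c (closeUp u) / u.length else 0 := by
  refine summable_of_abs_le_W hc A closeUp_injective ?_
  intro u hu
  rw [ite_ne_right_iff] at hu
  exact ⟨fun v hv => hu.1.1 v (mem_closeUp.1 hv), by rw [if_pos hu.1]; exact abs_div_natCast_le _ _⟩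

lemma rotate_bijective (i : ℕ) : Function.Bijective fun u : List V => u.rotate i := by
  refine ⟨List.rotate_injective i, fun u => ⟨u.rotate (u.length - i % u.length), ?_⟩⟩
  change (u.rotate _).rotate i = u
  rw [List.rotate_rotate]
  rcases Nat.eq_zero_or_pos u.length with h | h
  · simp [List.length_eq_zero_iff.1 h]
  · rw [← List.rotate_mod]
    have h1 := Nat.mod_lt i h
    have h2 : (u.length - i % u.length + i) % u.length = 0 := by
      have h3 := Nat.div_add_mod i u.length
      rw [show u.length - i % u.length + i = u.length + u.length * (i / u.length) by omega]
      simp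
    rw [h2, List.rotate_zero]

lemma count_eq_sum_range (u : List V) (x : V) :
    u.count x = ∑ i ∈ Finset.range u.length, if u[i]? = some x then 1 else 0 := by
  induction u with
  | nil => simp
  | cons y u ih =>
    rw [List.length_cons, Finset.sum_range_succ', List.count_cons, ih]
    simp

lemma tsum_lt_ite (n : ℕ) (a : ℕ → ℝ) :
    ∑' i, (if i < n then a i else 0) = ∑ i ∈ Finset.range n, a i := by
  rw [tsum_eq_sum (s := Finset.range n)]
  · exact Finset.sum_congr rfl fun i hi => if_pos (Finset.mem_range.1 hi)
  · intro i hi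
    exact if_neg fun h => hi (Finset.mem_range.2 h)

/-- Rerooting: summing over the visits to `x` of all loops, or over all times of the loops rooted
at `x`, gives the same result. -/
lemma tsum_count_mul_eq {g : List V → ℝ} (hg : ∀ u i, g (u.rotate i) = g u)
    (hs : Summable fun u : List V => u.length * |g u|) (x : V) :
    ∑' u : List V, u.count x * g u =
      ∑' u : List V, if u.head? = some x then u.length * g u else 0 := by
  -- Both sides are sums over pairs of a loop and a time below its length. Absolute summability over
  -- such pairs allows the time to be fixed first; rotating by that time then carries the visits to
  -- `x` at this time to loops rooted at `x`.
  have hbase : Summable fun q : List V × ℕ => if q.2 < q.1.length then |g q.1| else 0 := by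
    rw [summable_prod_of_nonneg fun q => by dsimp only; split_ifs <;> simp]
    refine ⟨fun u => summable_of_hasFiniteSupport ((Finset.range u.length).finite_toSet.subset ?_), ?_⟩
    · intro i hi
      simp only [Function.mem_support, ite_ne_right_iff] at hi
      simpa using hi.1
    · refine hs.congr fun u => ?_
      rw [tsum_lt_ite u.length fun _ => |g u|]
      simp
  have hprod : ∀ P : List V → ℕ → Prop, ∀ [∀ u i, Decidable (P u i)],
      Summable (Function.uncurry fun (u : List V) (i : ℕ) =>
        if i < u.length then if P u i then g u else 0 else 0) := by
    intro P _
    refine Summable.of_norm_bounded hbase ?_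
    rintro ⟨u, i⟩
    simp only [Function.uncurry]
    split_ifs <;> simp
  have h1 : ∀ u : List V, u.count x * g u =
      ∑' i : ℕ, if i < u.length then if u[i]? = some x then g u else 0 else 0 := by
    intro u
    rw [tsum_lt_ite u.length fun i => if u[i]? = some x then g u else 0, count_eq_sum_range]
    push_cast
    rw [Finset.sum_mul]
    refine Finset.sum_congr rfl fun i _ => ?_
    split_ifs <;> simp
  have h2 : ∀ u : List V, (if u.head? = some x then u.length * g u else 0) =
      ∑' i : ℕ, if i < u.length then if u.head? = some x then g u else 0 else 0 := by
    intro u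
    rw [tsum_lt_ite u.length fun i => if u.head? = some x then g u else 0]
    simp
  rw [tsum_congr h1, tsum_congr h2, ← (hprod fun u i => u[i]? = some x).tsum_comm,
    ← (hprod fun u _ => u.head? = some x).tsum_comm]
  refine tsum_congr fun i => ?_
  rw [← (Equiv.ofBijective _ (rotate_bijective i)).tsum_eq
    (fun u : List V => if i < u.length then if u.head? = some x then g u else 0 else 0)]
  refine tsum_congr fun u => ?_
  simp only [Equiv.ofBijective_apply, List.length_rotate, hg]
  by_cases hi : i < u.length
  · rw [List.head?_rotate hi]
  · simp [hi]

/-! ### Loops through a vertex and first returns -/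

/-- The generating function of the loops at `x` in `A` that return to `x` only at the end. -/
noncomputable def firstReturn (c : V → V → ℝ) (A : Finset V) (x : V) : ℝ :=
  ∑' t : List V, if x ∈ t then 0 else if ∀ v ∈ t, v ∈ A then W c (x :: (t ++ [x])) else 0

/-- A loop at `x` is a concatenation of first-return loops. As the final `x` is not part of `s`, the
count of `x` in `s` is exactly the number of these loops, and the induction peels off the last one.
-/
lemma tsum_count_eq_pow (hc : IsWeight c) {A : Finset V} {x : V} (hx : x ∈ A) (k : ℕ) :
    ∑' s : List V, (if s.count x = k then
      if (∀ v ∈ s ++ [x], v ∈ A) ∧ (s ++ [x]).head? = some x then W c (s ++ [x]) else 0 else 0) =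
      firstReturn c A x ^ k := by
  have hsum : ∀ k : ℕ, Summable fun s : List V => if s.count x = k then
      if (∀ v ∈ s ++ [x], v ∈ A) ∧ (s ++ [x]).head? = some x then W c (s ++ [x]) else 0 else 0 :=
    fun k => Summable.of_norm_bounded (summable_diagGreen hc A x).norm fun s => by
      split_ifs <;> simp_all
  induction k with
  | zero =>
    rw [tsum_eq_single []]
    · simp [hx]
    · intro s hs
      rcases s with - | ⟨y, s⟩
      · simp at hs
      · by_cases h : y = x
        · simp [h]
        · simp [h]
  | succ k ih =>
    rw [tsum_split_mul (hsum (k + 1)) (hsum k) (summable_hitKernel hc A x x) x, pow_succ, ih]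
    · have : ∀ l : List V, (if x ∈ l then (0 : ℝ) else if l.count x = k + 1 then
          if (∀ v ∈ l ++ [x], v ∈ A) ∧ (l ++ [x]).head? = some x then W c (l ++ [x]) else 0
          else 0) = 0 := by
        intro l
        by_cases h : x ∈ l
        · simp [h]
        · simp [h, List.count_eq_zero_of_not_mem h]
      rw [tsum_congr this, tsum_zero, zero_add, firstReturn]
    · intro s t ht
      rw [← ite_and, ← ite_and]
      refine ite_eq_ite_mul_ite ?_ fun _ => ?_
      · have h1 : (s ++ x :: t).count x = s.count x + 1 := by
          simp [List.count_eq_zero_of_not_mem ht]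
        have h2 : (s ++ x :: t ++ [x]).head? = (s ++ [x]).head? := by
          rw [List.append_assoc, List.cons_append, head?_append_cons]
        rw [h1, h2, add_left_inj]
        simp only [List.mem_append, List.mem_cons, List.not_mem_nil, or_false]
        grind
      · rw [List.append_assoc, List.cons_append, W_append_cons]

lemma summable_prod_count (hc : IsWeight c) (A : Finset V) (x : V) :
    Summable fun q : ℕ × List V => if q.2.count x = q.1 then
      if (∀ v ∈ q.2 ++ [x], v ∈ A) ∧ (q.2 ++ [x]).head? = some x then W c (q.2 ++ [x]) else 0
      else 0 := by
  have hinj : Function.Injective fun s : List V => (s.count x, s) := fun s t h => by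
    simp only [Prod.mk.injEq] at h
    exact h.2
  rw [← hinj.summable_iff]
  · refine (summable_diagGreen hc A x).congr fun s => ?_
    simp
  · rintro ⟨k, s⟩ h
    exact if_neg fun hk => h ⟨s, Prod.ext hk rfl⟩

/-- The total weight of the loops at `x` with `k` returns is the `k`th power of the first-return
function, and these totals are summable; a summable geometric series has ratio smaller than 1. -/
lemma abs_firstReturn_lt_one (hc : IsWeight c) {A : Finset V} {x : V} (hx : x ∈ A) :
    |firstReturn c A x| < 1 := by
  have := (summable_prod_count hc A x).prod
  simp only [tsum_count_eq_pow hc hx] at this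
  simpa using summable_geometric_iff_norm_lt_one.1 this

lemma diagGreen_eq_inv (hc : IsWeight c) {A : Finset V} {x : V} (hx : x ∈ A) :
    diagGreen c A x = (1 - firstReturn c A x)⁻¹ := by
  rw [← tsum_geometric_of_norm_lt_one (by simpa using abs_firstReturn_lt_one hc hx)]
  simp only [← tsum_count_eq_pow hc hx]
  rw [Summable.tsum_comm (f := fun (s : List V) (k : ℕ) => if s.count x = k then
      if (∀ v ∈ s ++ [x], v ∈ A) ∧ (s ++ [x]).head? = some x then W c (s ++ [x]) else 0 else 0)
      (summable_prod_count hc A x).prod_symm, diagGreen]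
  refine tsum_congr fun s => ?_
  rw [tsum_eq_single (s.count x)]
  · simp
  · intro k hk
    simp [hk.symm]

/-- Distribute the mass of a loop evenly over its visits to `x` and reroot it there. The length in
the denominator cancels, and the loops with `k` visits contribute the `k`th power of `firstReturn`
divided by `k`: a logarithmic series. -/
lemma loopSum_mem_eq (hc : IsWeight c) {A : Finset V} {x : V} (hx : x ∈ A) :
    loopSum c A (fun u => x ∈ u) = - Real.log (1 - firstReturn c A x) := by
  classical
  -- The rooted mass divided once more by the number of visits to `x`; it is invariant under
  -- rotation.
  set g : List V → ℝ := fun u => if (∀ v ∈ u, v ∈ A) ∧ x ∈ u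
    then W c (closeUp u) / u.length / u.count x else 0 with hg
  have hbd : ∀ u, u.length * |g u| ≤ |if (∀ v ∈ u, v ∈ A) ∧ True then W c (closeUp u) / (1 : ℕ) else 0| := by
    intro u
    by_cases h : (∀ v ∈ u, v ∈ A) ∧ x ∈ u
    · have hl : (0 : ℝ) < u.length := by exact_mod_cast List.length_pos_of_mem h.2
      simp only [hg, if_pos h, if_pos (⟨h.1, trivial⟩ : (∀ v ∈ u, v ∈ A) ∧ True), Nat.cast_one,
        div_one]
      rw [div_right_comm, abs_div, Nat.abs_cast, mul_div_cancel₀ _ hl.ne']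
      exact abs_div_natCast_le _ _
    · simp only [hg, if_neg h]
      simp
  have hs : Summable fun u : List V => u.length * |g u| := by
    refine Summable.of_nonneg_of_le (fun u => by positivity) hbd ?_
    refine Summable.abs (summable_of_abs_le_W hc A closeUp_injective ?_)
    intro u hu
    rw [ite_ne_right_iff] at hu
    exact ⟨fun v hv => hu.1.1 v (mem_closeUp.1 hv), by rw [if_pos hu.1]; simp⟩
  have hrot : ∀ u i, g (u.rotate i) = g u := by
    intro u i
    simp only [hg, List.mem_rotate, W_closeUp_rotate, List.length_rotate,
      (List.rotate_perm u i).count_eq]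
  have h1 : loopSum c A (fun u => x ∈ u) = ∑' u : List V, u.count x * g u := by
    refine tsum_congr fun u => ?_
    by_cases h : (∀ v ∈ u, v ∈ A) ∧ x ∈ u
    · have : (u.count x : ℝ) ≠ 0 := by exact_mod_cast (List.count_pos_iff.2 h.2).ne'
      simp only [hg, if_pos h]
      field_simp
    · simp only [hg, if_neg h, mul_zero]
  have h2 : ∀ u : List V, (if u.head? = some x then u.length * g u else 0) =
      ∑' k : ℕ, if u.count x = k then
        if (∀ v ∈ u ++ [x], v ∈ A) ∧ (u ++ [x]).head? = some x then W c (u ++ [x]) / k else 0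
        else 0 := by
    intro u
    rw [tsum_eq_single (u.count x) fun k hk => if_neg hk.symm, if_pos rfl]
    rcases u with - | ⟨y, u⟩
    · simp
    · by_cases hy : y = x
      · subst hy
        have hlen : ((y :: u).length : ℝ) ≠ 0 := by simp; positivity
        rw [if_pos List.head?_cons]
        by_cases hA : ∀ v ∈ y :: u, v ∈ A
        · have hA' : ∀ v ∈ y :: u ++ [y], v ∈ A := by
            intro v hv
            rcases List.mem_append.1 hv with hv | hv
            · exact hA v hv
            · rw [List.mem_singleton.1 hv]; exact hx
          rw [if_pos (show _ ∧ (y :: u ++ [y]).head? = some y from ⟨hA', rfl⟩)]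
          simp only [hg]
          rw [if_pos ⟨hA, List.mem_cons_self⟩, closeUp_cons, div_right_comm, mul_div_cancel₀ _ hlen]
          rfl
        · have hA' : ¬ ∀ v ∈ y :: u ++ [y], v ∈ A := fun h => hA fun v hv =>
            h v (List.mem_append_left _ hv)
          simp only [hg]
          rw [if_neg fun h => hA h.1, if_neg fun h => hA' h.1, mul_zero]
      · simp [hy]
  have hdiv : Summable fun q : ℕ × List V => if q.2.count x = q.1 then
      if (∀ v ∈ q.2 ++ [x], v ∈ A) ∧ (q.2 ++ [x]).head? = some x then W c (q.2 ++ [x]) / q.1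
      else 0 else 0 := by
    refine Summable.of_norm_bounded (summable_prod_count hc A x).norm fun q => ?_
    simp only [Real.norm_eq_abs]
    split_ifs
    · exact abs_div_natCast_le _ _
    all_goals simp
  rw [h1, tsum_count_mul_eq hrot hs, tsum_congr h2,
    Summable.tsum_comm (f := fun (k : ℕ) (u : List V) => if u.count x = k then
        if (∀ v ∈ u ++ [x], v ∈ A) ∧ (u ++ [x]).head? = some x then W c (u ++ [x]) / k else 0
        else 0) hdiv]
  have h3 : ∀ k : ℕ, ∑' u : List V, (if u.count x = k then
        if (∀ v ∈ u ++ [x], v ∈ A) ∧ (u ++ [x]).head? = some x then W c (u ++ [x]) / k else 0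
        else 0) = firstReturn c A x ^ k / k := by
    intro k
    rw [← tsum_count_eq_pow hc hx, ← tsum_div_const]
    refine tsum_congr fun u => ?_
    split_ifs <;> simp
  rw [tsum_congr h3]
  have h4 := Real.hasSum_pow_div_log_of_abs_lt_one (abs_firstReturn_lt_one hc hx)
  have h5 : Summable fun k : ℕ => firstReturn c A x ^ k / k := by
    rw [← summable_nat_add_iff 1]
    simpa using h4.summable
  -- The term with `k = 0` is a division by zero, hence 0, as the logarithmic series requires.
  rw [h5.tsum_eq_zero_add, ← h4.tsum_eq]
  simp

lemma exp_loopSum_mem (hc : IsWeight c) {A : Finset V} {x : V} (hx : x ∈ A) :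
    Real.exp (loopSum c A fun u => x ∈ u) = diagGreen c A x := by
  have := (abs_lt.1 (abs_firstReturn_lt_one hc hx)).2
  rw [loopSum_mem_eq hc hx, Real.exp_neg, Real.exp_log (by linarith), diagGreen_eq_inv hc hx]

/-- The loop measure term of a walk in terms of Green's functions. -/
lemma exp_loopSum_meets (hc : IsWeight c) {l : List V} {A : Finset V} (hl : l.Nodup)
    (hA : ∀ v ∈ l, v ∈ A) :
    Real.exp (loopSum c A fun u => ∃ z ∈ u, z ∈ l) = greenProd c A l := by
  induction l generalizing A with
  | nil => simp [loopSum, greenProd]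
  | cons x l ih =>
    rw [List.nodup_cons] at hl
    have hx : x ∈ A := hA x List.mem_cons_self
    rw [greenProd, ← exp_loopSum_mem hc hx, ← ih hl.2 fun v hv => Finset.mem_erase.2
      ⟨fun h : v = x => hl.1 (h ▸ hv), hA v (List.mem_cons_of_mem _ hv)⟩, ← Real.exp_add]
    congr 1
    -- Loops meeting `x :: l` are those through `x` together with those that stay in `A.erase x` and
    -- meet `l`.
    unfold loopSum
    rw [← (summable_loopSum hc A _).tsum_add (summable_loopSum hc (A.erase x) _)]
    refine tsum_congr fun u => ?_
    by_cases hxu : x ∈ u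
    · have h1 : ¬ ((∀ v ∈ u, v ∈ A.erase x) ∧ ∃ z ∈ u, z ∈ l) := fun h => by
        simpa using h.1 x hxu
      rw [if_neg h1, add_zero]
      congr 1
      simp only [List.mem_cons, eq_iff_iff]
      grind
    · have h0 : ¬ ((∀ v ∈ u, v ∈ A) ∧ x ∈ u) := fun h => hxu h.2
      rw [if_neg h0, zero_add]
      congr 1
      simp only [List.mem_cons, Finset.mem_erase, eq_iff_iff]
      grind

end LERW

namespace LERW

/-! ### Unrooted loops -/

lemma map_fst_steps : ∀ l : List V, (steps l).map Prod.fst = l.dropLast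
  | [] => rfl
  | [_] => rfl
  | x :: y :: l => by
    rw [steps_cons_cons, List.map_cons, map_fst_steps (y :: l), List.dropLast_cons_cons]

lemma IsLoop.exists_eq_closeUp {ℓ : List V} (h : IsLoop ℓ) (h0 : len ℓ ≠ 0) :
    ∃ x u, ℓ = closeUp (x :: u) := by
  rcases ℓ with - | ⟨x, ℓ⟩
  · simp [len] at h0
  · have hne : ℓ ≠ [] := by
      rintro rfl
      simp [len] at h0
    refine ⟨x, ℓ.dropLast, ?_⟩
    have h1 := h.2
    rw [List.head?_cons, List.getLast?_cons, List.getLast?_eq_some_getLast hne, Option.getD_some,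
      Option.some_inj] at h1
    rw [closeUp_cons]
    conv_rhs => rw [h1, List.dropLast_append_getLast hne, ← h1]

lemma isLoop_closeUp {x : V} {u : List V} (h : (closeUp (x :: u)).IsChain Nbr) :
    IsLoop (closeUp (x :: u)) := ⟨⟨by simp, h⟩, by simp [List.getLast?_cons]⟩

lemma unroot_eq_perm {ℓ ℓ' : List V} (h : unroot ℓ = unroot ℓ') : (steps ℓ).Perm (steps ℓ') :=
  (Cycle.coe_eq_coe.1 h).perm

lemma length_steps (ℓ : List V) : (steps ℓ).length = len ℓ := by
  simp [steps, len]

/-- Closed walks with the same steps up to cyclic permutation visit the same vertices. -/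
lemma IsLoop.mem_of_unroot_eq {ℓ ℓ' : List V} (h : IsLoop ℓ) (h' : IsLoop ℓ')
    (he : unroot ℓ = unroot ℓ') (h0 : len ℓ ≠ 0) {v : V} (hv : v ∈ ℓ) : v ∈ ℓ' := by
  have hp := unroot_eq_perm he
  have h0' : len ℓ' ≠ 0 := by rwa [← length_steps, ← hp.length_eq, length_steps]
  obtain ⟨x, u, rfl⟩ := h.exists_eq_closeUp h0
  obtain ⟨y, u', rfl⟩ := h'.exists_eq_closeUp h0'
  have hm := (hp.map Prod.fst).mem_iff (a := v)
  rw [map_fst_steps, map_fst_steps, closeUp_cons, closeUp_cons, ← List.cons_append,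
    ← List.cons_append, List.dropLast_concat, List.dropLast_concat] at hm
  exact mem_closeUp.2 (hm.1 (mem_closeUp.1 hv))

variable {c : V → V → ℝ}

/-- The sum over classes of the sums over representatives is a sum over all rooted loops, coded by
their vertices without the final one. Length 0 must be excluded in `hP`: all trivial loops have the
same empty cycle of steps, whatever their vertex, so no property of the vertex descends to that
class; their mass is 0. -/
lemma loopMeasure_eq_loopSum (hc : IsWeight c) {w : List V → ℝ} {A : Finset V}
    (hw : ∀ ℓ, IsLoop ℓ → IsWalkIn A ℓ → w ℓ = W c ℓ) {P : List V → Prop}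
    (hP : ∀ ℓ ℓ', IsLoop ℓ → IsLoop ℓ' → unroot ℓ = unroot ℓ' → len ℓ ≠ 0 → P ℓ → P ℓ') :
    loopMeasure w {c | ∃ ℓ, IsLoop ℓ ∧ IsWalkIn A ℓ ∧ P ℓ ∧ unroot ℓ = c} =
      loopSum c A fun u => P (closeUp u) := by
  classical
  set S : Set (Cycle (V × V)) := {c | ∃ ℓ, IsLoop ℓ ∧ IsWalkIn A ℓ ∧ P ℓ ∧ unroot ℓ = c} with hS
  have hin : ∀ (γ : S) (ℓ : {ℓ : List V // IsLoop ℓ ∧ unroot ℓ = γ}), len ℓ.1 ≠ 0 →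
      IsWalkIn A ℓ.1 ∧ P ℓ.1 := by
    rintro ⟨_, ℓ', h1, h2, h3, rfl⟩ ⟨ℓ, h4, h5⟩ h0
    have h0' : len ℓ' ≠ 0 := by
      rwa [← length_steps, ← (unroot_eq_perm h5).length_eq, length_steps]
    exact ⟨⟨h4.1, fun v hv => h2.2 v (h4.mem_of_unroot_eq h1 h5 h0 hv)⟩,
      hP ℓ' ℓ h1 h4 h5.symm h0' h3⟩
  set F : (Σ γ : S, {ℓ : List V // IsLoop ℓ ∧ unroot ℓ = γ}) → ℝ :=
    fun q => rootedMass w q.2.1 with hF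
  have hFin : ∀ q, F q ≠ 0 → len q.2.1 ≠ 0 := fun q hq h => by
    simp [hF, rootedMass, h] at hq
  have hinj : Function.Injective fun q : (Σ γ : S, {ℓ : List V // IsLoop ℓ ∧ unroot ℓ = γ}) =>
      q.2.1 := by
    rintro ⟨⟨γ, hγ⟩, ⟨ℓ, h1, h2⟩⟩ ⟨⟨γ', hγ'⟩, ⟨ℓ', h1', h2'⟩⟩ h
    simp only at h h2 h2'
    subst h h2 h2'
    rfl
  have hsum : Summable F := by
    refine summable_of_abs_le_W hc A hinj fun q hq => ?_
    have h0 := hFin q hq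
    have h1 := hin q.1 q.2 h0
    refine ⟨fun v hv => h1.1.2 v hv, ?_⟩
    simp only [hF, rootedMass, if_neg h0]
    rw [hw _ q.2.2.1 h1.1]
    exact abs_div_natCast_le _ _
  have h1 : loopMeasure w S = ∑' q, F q := (hsum.tsum_sigma).symm
  rw [h1, loopSum]
  have hsupp : ∀ u : Function.support fun u : List V => if (∀ v ∈ u, v ∈ A) ∧ P (closeUp u)
      then W c (closeUp u) / u.length else 0, IsLoop (closeUp u.1) ∧ unroot (closeUp u.1) ∈ S := by
    rintro ⟨u, hu⟩
    rw [Function.mem_support, ite_ne_right_iff] at hu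
    rcases u with - | ⟨x, u⟩
    · simp at hu
    · have hch : (closeUp (x :: u)).IsChain Nbr := by
        by_contra h
        exact hu.2 (by rw [W_eq_zero_of_not_isChain hc _ h, zero_div])
      have hl := isLoop_closeUp hch
      exact ⟨hl, closeUp (x :: u), hl, ⟨hl.1, fun v hv => hu.1.1 v (mem_closeUp.1 hv)⟩, hu.1.2, rfl⟩
  have hval : ∀ x u, IsLoop (closeUp (x :: u)) → IsWalkIn A (closeUp (x :: u)) →
      rootedMass w (closeUp (x :: u)) = W c (closeUp (x :: u)) / ((x :: u).length : ℝ) := by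
    intro x u h h'
    rw [rootedMass, if_neg (by simp [len]), hw _ h h']
    simp [len]
  refine tsum_eq_tsum_of_ne_zero_bij (fun u => ⟨⟨unroot (closeUp u.1), (hsupp u).2⟩,
    ⟨closeUp u.1, (hsupp u).1, rfl⟩⟩) ?_ ?_ ?_
  · intro u v h
    have := congrArg (fun q : (Σ γ : S, {ℓ : List V // IsLoop ℓ ∧ unroot ℓ = γ}) => q.2.1) h
    exact Subtype.ext (closeUp_injective this)
  · rintro q hq
    have h0 := hFin q hq
    have h1 := hin q.1 q.2 h0
    obtain ⟨x, u, hu⟩ := q.2.2.1.exists_eq_closeUp h0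
    refine ⟨⟨x :: u, ?_⟩, hinj hu.symm⟩
    rw [Function.mem_support, ite_ne_right_iff]
    refine ⟨⟨fun v hv => h1.1.2 v (by rw [hu]; exact mem_closeUp.2 hv), hu ▸ h1.2⟩, ?_⟩
    rw [← hval x u (hu ▸ q.2.2.1) (hu ▸ h1.1), ← hu]
    exact hq
  · rintro ⟨u, hu⟩
    have h2 := hsupp ⟨u, hu⟩
    rw [Function.mem_support, ite_ne_right_iff] at hu
    rcases u with - | ⟨x, u⟩
    · simp at hu
    · rw [if_pos hu.1]
      exact hval x u h2.1 ⟨h2.1.1, fun v hv => hu.1.1 v (mem_closeUp.1 hv)⟩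

lemma F_eq_exp_loopSum (hc : IsWeight c) {w : List V → ℝ} {A : Finset V}
    (hw : ∀ ℓ, IsLoop ℓ → IsWalkIn A ℓ → w ℓ = W c ℓ) (l : List V) :
    F w {z | z ∈ l} A = Real.exp (loopSum c A fun u => ∃ z ∈ u, z ∈ l) := by
  have h := loopMeasure_eq_loopSum hc hw (P := fun ℓ => ∃ z ∈ ℓ, z ∈ l)
    fun ℓ ℓ' h h' he h0 ⟨z, hz, hzl⟩ => ⟨z, h.mem_of_unroot_eq h' he h0 hz, hzl⟩
  simp only [mem_closeUp] at h
  exact congrArg Real.exp h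

end LERW

namespace LERW

/-! ### Winding of lattice walks around faces

The face with index `(x, y)` is the unit square with centre `x + 1/2 + i (y - 1/2)`. -/

/-- The signed crossing of the horizontal ray that runs to the left from the face `z`. -/
def crossing (z : V) (e : V × V) : ℤ :=
  if e.1.1 = e.2.1 ∧ e.1.1 ≤ z.1 then
    if e.1.2 = z.2 ∧ e.2.2 = z.2 - 1 then 1
    else if e.1.2 = z.2 - 1 ∧ e.2.2 = z.2 then -1 else 0
  else 0

/-- The number of signed crossings of the ray that runs to the left from the face `z`. -/
def wind (l : List V) (z : V) : ℤ := ((steps l).map (crossing z)).sum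

/-- The indicator of the directed edge `[u, v]` minus that of its reversal. -/
def net (u v : V) (e : V × V) : ℤ := (if e = (u, v) then 1 else 0) - if e = (v, u) then 1 else 0

/-- The net number of transitions from `u` to `v`. -/
def netFlow (l : List V) (u v : V) : ℤ := ((steps l).map (net u v)).sum

lemma net_swap (u v : V) (e : V × V) : net v u e = - net u v e := by simp [net]

lemma crossing_swap (z u v : V) : crossing z (v, u) = - crossing z (u, v) := by
  simp only [crossing]
  grind

lemma wind_cons_cons (x y : V) (l : List V) (z : V) :
    wind (x :: y :: l) z = crossing z (x, y) + wind (y :: l) z := by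
  simp [wind, steps_cons_cons]

lemma netFlow_cons_cons (x y : V) (l : List V) (u v : V) :
    netFlow (x :: y :: l) u v = net u v (x, y) + netFlow (y :: l) u v := by
  simp [netFlow, steps_cons_cons]

@[simp] lemma wind_singleton (x z : V) : wind [x] z = 0 := by simp [wind, steps]

@[simp] lemma netFlow_singleton (x u v : V) : netFlow [x] u v = 0 := by simp [netFlow, steps]

lemma wind_append_cons (l₁ : List V) (x : V) (l₂ : List V) (z : V) :
    wind (l₁ ++ x :: l₂) z = wind (l₁ ++ [x]) z + wind (x :: l₂) z := by
  rw [wind, steps_append_cons, List.map_append, List.sum_append, wind, wind]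

lemma netFlow_append_cons (l₁ : List V) (x : V) (l₂ : List V) (u v : V) :
    netFlow (l₁ ++ x :: l₂) u v = netFlow (l₁ ++ [x]) u v + netFlow (x :: l₂) u v := by
  rw [netFlow, steps_append_cons, List.map_append, List.sum_append, netFlow, netFlow]

lemma wind_reverse (z : V) : ∀ l : List V, wind l.reverse z = - wind l z
  | [] => by simp [wind, steps]
  | [_] => by simp
  | x :: y :: l => by
    rw [List.reverse_cons, List.reverse_cons, List.append_assoc, List.singleton_append,
      wind_append_cons, ← List.reverse_cons, wind_reverse z (y :: l), wind_cons_cons,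
      wind_cons_cons, wind_singleton, crossing_swap]
    ring

lemma netFlow_swap (l : List V) (u v : V) : netFlow l v u = - netFlow l u v := by
  induction l with
  | nil => simp [netFlow, steps]
  | cons x l ih =>
    rcases l with - | ⟨y, l⟩
    · simp
    · rw [netFlow_cons_cons, netFlow_cons_cons, ih, net_swap, neg_add]

lemma netFlow_eq_zero {l : List V} {u : V} (h : u ∉ l) (v : V) : netFlow l u v = 0 := by
  induction l with
  | nil => simp [netFlow, steps]
  | cons x l ih =>
    rcases l with - | ⟨y, l⟩
    · simp
    · simp only [List.mem_cons, not_or] at h ih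
      rw [netFlow_cons_cons, ih h.2]
      simp [net, Prod.ext_iff, Ne.symm h.1, Ne.symm h.2.1]

/-- Raising the ray by one row sweeps over the half-row S of the vertices in row `y` up to column
`x`. The vertical steps into and out of S are counted by the difference of crossings; what is
missing from the change of the indicator of S is the passage through its end, the edge from (x, y)
to (x + 1, y). The indicator terms telescope along a walk. -/
lemma crossing_add_one (x y : ℤ) {u v : V} (h : Nbr u v) :
    crossing (x, y + 1) (u, v) - crossing (x, y) (u, v) =
      ((if v.2 = y ∧ v.1 ≤ x then 1 else 0) - if u.2 = y ∧ u.1 ≤ x then 1 else 0) +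
        net (x, y) (x + 1, y) (u, v) := by
  obtain ⟨a, b⟩ := u
  rcases nbr_iff.1 h with rfl | rfl | rfl | rfl <;> simp only [crossing, net, Prod.mk.injEq] <;>
    grind

lemma crossing_sub_one (x y : ℤ) {u v : V} (h : Nbr u v) :
    crossing (x, y) (u, v) - crossing (x - 1, y) (u, v) = net (x, y) (x, y - 1) (u, v) := by
  obtain ⟨a, b⟩ := u
  rcases nbr_iff.1 h with rfl | rfl | rfl | rfl <;> simp only [crossing, net, Prod.mk.injEq] <;>
    grind

lemma wind_sub_left {l : List V} (h : l.IsChain Nbr) (x y : ℤ) :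
    wind l (x, y) - wind l (x - 1, y) = netFlow l (x, y) (x, y - 1) := by
  induction l with
  | nil => simp [wind, netFlow, steps]
  | cons u l ih =>
    rcases l with - | ⟨v, l⟩
    · simp
    · rw [List.isChain_cons_cons] at h
      rw [wind_cons_cons, wind_cons_cons, netFlow_cons_cons]
      linear_combination ih h.2 + crossing_sub_one x y h.1

lemma wind_sub_below_aux (x y : ℤ) : ∀ (u : V) (l : List V), (u :: l).IsChain Nbr →
    wind (u :: l) (x, y + 1) - wind (u :: l) (x, y) =
      ((if ((u :: l).getLast (by simp)).2 = y ∧ ((u :: l).getLast (by simp)).1 ≤ x then 1 else 0)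
        - if u.2 = y ∧ u.1 ≤ x then 1 else 0) + netFlow (u :: l) (x, y) (x + 1, y) := by
  intro u l
  induction l generalizing u with
  | nil =>
    intro _
    rw [wind_singleton, wind_singleton, netFlow_singleton, List.getLast_singleton]
    ring
  | cons v l ih =>
    intro h
    rw [List.isChain_cons_cons] at h
    have := ih v h.2
    rw [wind_cons_cons, wind_cons_cons, netFlow_cons_cons, List.getLast_cons (by simp)]
    linear_combination this + crossing_add_one x y h.1

/-- Closed nearest-neighbour walks. -/
def IsClosedWalk (l : List V) : Prop := l.IsChain Nbr ∧ l.head? = l.getLast?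

lemma IsLoop.isClosedWalk {l : List V} (h : IsLoop l) : IsClosedWalk l := ⟨h.1.2, h.2⟩

/-- With `wind_sub_left` this is the jump rule: between the two faces at an edge, the winding number
changes by the net flow through that edge. -/
lemma IsClosedWalk.wind_sub_below {l : List V} (h : IsClosedWalk l) (x y : ℤ) :
    wind l (x, y + 1) - wind l (x, y) = netFlow l (x, y) (x + 1, y) := by
  rcases l with - | ⟨u, l⟩
  · simp [wind, netFlow, steps]
  · have h2 := h.2
    rw [List.head?_cons, List.getLast?_eq_some_getLast (by simp), Option.some_inj] at h2
    rw [wind_sub_below_aux x y u l h.1, ← h2]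
    ring

/-- The face to the right of a directed edge. -/
def rightFace (u v : V) : V :=
  if v = (u.1 + 1, u.2) then u
  else if v = (u.1 - 1, u.2) then (u.1 - 1, u.2 + 1)
  else if v = (u.1, u.2 + 1) then (u.1, u.2 + 1)
  else (u.1 - 1, u.2)

lemma rightFace_out (x y : ℤ) : rightFace (x, y) (x + 1, y) = (x, y) ∧
    rightFace (x, y) (x - 1, y) = (x - 1, y + 1) ∧ rightFace (x, y) (x, y + 1) = (x, y + 1) ∧
    rightFace (x, y) (x, y - 1) = (x - 1, y) := by
  simp only [rightFace, Prod.mk.injEq]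
  grind

lemma rightFace_in (x y : ℤ) : rightFace (x + 1, y) (x, y) = (x, y + 1) ∧
    rightFace (x - 1, y) (x, y) = (x - 1, y) ∧ rightFace (x, y + 1) (x, y) = (x - 1, y + 1) ∧
    rightFace (x, y - 1) (x, y) = (x, y) := by
  simp only [rightFace, Prod.mk.injEq]
  grind

/-- The winding number is constant to the right of a walk that passes a vertex exactly once. -/
lemma IsClosedWalk.wind_rightFace {l : List V} (h : IsClosedWalk l) {u v w : V} (hu : Nbr u v)
    (hw : Nbr v w) (huw : u ≠ w)
    (hfl : ∀ n, netFlow l v n = (if n = w then 1 else 0) - if n = u then 1 else 0) :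
    wind l (rightFace u v) = wind l (rightFace v w) := by
  obtain ⟨x, y⟩ := v
  -- The four jumps across the east, west, south and north edges at `v`. Only the edges to `u` and
  -- `w` carry flow, and both right faces lie in the same sector between them.
  have e := h.wind_sub_below x y
  have w' := h.wind_sub_below (x - 1) y
  have s := wind_sub_left h.1 x y
  have n := wind_sub_left h.1 x (y + 1)
  rw [hfl] at e s
  rw [netFlow_swap, show x - 1 + 1 = x by ring, hfl] at w'
  rw [netFlow_swap, show y + 1 - 1 = y by ring, hfl] at n
  rcases nbr_iff.1 hu.symm with rfl | rfl | rfl | rfl <;>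
  rcases nbr_iff.1 hw with rfl | rfl | rfl | rfl <;>
  simp [-neg_eq_zero, rightFace_out, rightFace_in, Prod.ext_iff] at huw e w' s n ⊢ <;> omega

/-- The winding number is constant around a vertex that is not visited. -/
lemma IsClosedWalk.wind_around {l : List V} (h : IsClosedWalk l) {v : V} (hv : v ∉ l) :
    wind l (v.1, v.2 + 1) = wind l v ∧ wind l (v.1 - 1, v.2) = wind l v ∧
      wind l (v.1 - 1, v.2 + 1) = wind l v := by
  obtain ⟨x, y⟩ := v
  have e := h.wind_sub_below x y
  have w' := h.wind_sub_below (x - 1) y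
  have s := wind_sub_left h.1 x y
  rw [netFlow_eq_zero hv] at e s
  rw [netFlow_swap, show x - 1 + 1 = x by ring, netFlow_eq_zero hv] at w'
  simp only
  omega

/-- A vertex is used as the index of the face at its lower right. Around an unvisited vertex all
four faces have the same winding number, and two neighbouring vertices share a face. -/
lemma IsClosedWalk.wind_eq_of_nbr {l : List V} (h : IsClosedWalk l) {u v : V} (hu : u ∉ l)
    (hv : v ∉ l) (huv : Nbr u v) : wind l u = wind l v := by
  have h1 := h.wind_around hu
  have h2 := h.wind_around hv
  obtain ⟨x, y⟩ := u
  rcases nbr_iff.1 huv with rfl | rfl | rfl | rfl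
  · simp only [add_sub_cancel_right] at h2
    exact h2.2.1
  · exact h1.2.1.symm
  · exact h1.1.symm
  · simp only [sub_add_cancel] at h2
    exact h2.1

lemma IsClosedWalk.wind_rightFace_eq {l : List V} (h : IsClosedWalk l) {u v : V} (hu : u ∉ l) :
    wind l (rightFace u v) = wind l u := by
  have h1 := h.wind_around hu
  unfold rightFace
  split_ifs
  · rfl
  · exact h1.2.2
  · exact h1.1
  · exact h1.2.1

lemma IsClosedWalk.wind_eq_of_isChain {l : List V} (h : IsClosedWalk l) {m : List V} {u : V}
    (hm : (u :: m).IsChain Nbr) (hml : ∀ v ∈ u :: m, v ∉ l) {v : V} (hv : v ∈ u :: m) :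
    wind l v = wind l u := by
  induction m generalizing u with
  | nil => rw [List.mem_singleton.1 hv]
  | cons w m ih =>
    rw [List.isChain_cons_cons] at hm
    rcases List.mem_cons.1 hv with rfl | hv
    · rfl
    · rw [ih hm.2 (fun v hv => hml v (List.mem_cons_of_mem _ hv)) hv]
      exact (h.wind_eq_of_nbr (hml u (by simp)) (hml w (by simp)) hm.1).symm

lemma exists_isChain_of_connected {S : Set V} (hS : (lattice.induce S).Connected) {u v : V}
    (hu : u ∈ S) (hv : v ∈ S) :
    ∃ m : List V, (u :: m).IsChain Nbr ∧ (∀ w ∈ u :: m, w ∈ S) ∧ (u :: m).getLast? = some v := by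
  have h := hS.preconnected ⟨u, hu⟩ ⟨v, hv⟩
  rw [SimpleGraph.reachable_iff_reflTransGen] at h
  obtain ⟨m, h1, h2⟩ := List.exists_isChain_cons_of_relationReflTransGen h
  refine ⟨m.map Subtype.val, ?_, ?_, ?_⟩
  · have := List.isChain_map_of_isChain (S := Nbr) (Subtype.val : S → V) (fun a b h => h) h1
    simpa using this
  · intro w hw
    rw [← List.map_cons (f := Subtype.val) (a := (⟨u, hu⟩ : S)), List.mem_map] at hw
    obtain ⟨w, -, rfl⟩ := hw
    exact w.2
  · rw [← List.map_cons (f := Subtype.val) (a := (⟨u, hu⟩ : S)), List.getLast?_map,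
      List.getLast?_eq_some_getLast (by simp), h2]
    rfl

/-- A closed walk in a simply connected lattice domain does not wind around outer vertices. -/
lemma IsClosedWalk.wind_eq_zero {A : Set V} (hA : IsLatticeDomain A) {l : List V}
    (h : IsClosedWalk l) (hl : ∀ v ∈ l, v ∈ A) {v : V} (hv : v ∉ A) : wind l v = 0 := by
  obtain ⟨m, hm⟩ : ∃ m : ℤ, ∀ z ∈ A, m < z.1 := by
    obtain ⟨m, hm⟩ := (hA.finite.image Prod.fst).bddBelow
    exact ⟨m - 1, fun z hz => by have := hm ⟨z, hz, rfl⟩; omega⟩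
  have h0 : ((m, 0) : V) ∉ A := fun h => by simpa using hm _ h
  -- The reference point lies in a column to the left of all of `A`, so its ray is never crossed;
  -- the connected complement carries this value to `v`.
  obtain ⟨n, h1, h2, h3⟩ := exists_isChain_of_connected hA.compl_connected h0 hv
  rw [h.wind_eq_of_isChain h1 (fun w hw hwl => h2 w hw (hl w hwl)) (List.mem_of_getLast? h3)]
  refine List.sum_eq_zero fun k hk => ?_
  obtain ⟨e, he, rfl⟩ := List.mem_map.1 hk
  have := hm e.1 (hl _ (List.of_mem_zip (a := e.1) (b := e.2) he).1)
  rw [crossing, if_neg]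
  rintro ⟨-, h'⟩
  simp only at h'
  omega

end LERW

namespace LERW

/-! ### The sign of self-avoiding walks through the edge `[0, 1]` -/

/-- `a₊ :: mid ++ [b₊]` is a walk from `a` to `b` in `A`. -/
structure IsExcursion (A : Set V) (a b : V × V) (mid : List V) : Prop where
  chain : (a.2 :: (mid ++ [b.2])).IsChain Nbr
  subset : ∀ z ∈ mid, z ∈ A
  head : mid.head? = some a.1
  last : mid.getLast? = some b.1

lemma const_on_infix {G : V → V → ℤ} {T : List V} {a b : V}
    (h : ∀ u v w, [u, v, w] <:+: a :: b :: T → G u v = G v w) {p q : V}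
    (hpq : [p, q] <:+: a :: b :: T) : G p q = G a b := by
  induction T generalizing a b with
  | nil =>
    have := hpq.sublist.eq_of_length (by simp)
    simp only [List.cons.injEq] at this
    rw [this.1, this.2.1]
  | cons c T ih =>
    rcases List.infix_cons_iff.1 hpq with h1 | h1
    · rw [List.cons_prefix_cons, List.cons_prefix_cons] at h1
      rw [h1.1, h1.2.1]
    · rw [ih (fun u v w huvw => h u v w (List.infix_cons huvw)) h1]
      exact (h a b c ⟨[], T, rfl⟩).symm

variable {A : Set V} {a b : V × V}

lemma IsExcursion.exists_cons {mid : List V} (h : IsExcursion A a b mid) :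
    ∃ t, mid = a.1 :: t := by
  rcases mid with - | ⟨x, t⟩
  · simpa using h.head
  · exact ⟨t, by simpa using h.head⟩

lemma IsExcursion.isClosedWalk {mid : List V} (h : IsExcursion A a b mid) {m : List V}
    (hm : (b.2 :: m).IsChain Nbr) (hml : (b.2 :: m).getLast? = some a.2) :
    IsClosedWalk (a.2 :: mid ++ b.2 :: m) := by
  refine ⟨?_, ?_⟩
  · rw [List.isChain_split]
    exact ⟨h.chain, hm⟩
  · rw [List.getLast?_append, hml]
    rfl

/-- The walk passes each vertex of `mid` once and the closing path stays outside `A`, so the local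
rule `wind_rightFace` applies at each turn of the walk. The closing path itself may intersect
itself. -/
lemma IsExcursion.wind_closed {mid m : List V} (h : IsExcursion A a b mid)
    (hn : mid.Nodup) (ha : a.2 ∉ A) (hm : (b.2 :: m).IsChain Nbr)
    (hmA : ∀ v ∈ b.2 :: m, v ∉ A) (hml : (b.2 :: m).getLast? = some a.2) {p q : V}
    (hpq : [p, q] <:+: mid) :
    wind (a.2 :: mid ++ b.2 :: m) (rightFace p q) =
      wind (a.2 :: mid ++ b.2 :: m) (rightFace a.2 a.1) := by
  set γ := a.2 :: mid ++ b.2 :: m with hγ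
  have hc : IsClosedWalk γ := h.isClosedWalk hm hml
  have hnd : (a.2 :: mid).Nodup := List.nodup_cons.2 ⟨fun h' => ha (h.subset _ h'), hn⟩
  obtain ⟨t, ht⟩ := h.exists_cons
  have hpq' : [p, q] <:+: a.2 :: a.1 :: t := ht ▸ List.infix_cons hpq
  refine const_on_infix (G := fun u v => wind γ (rightFace u v)) ?_ hpq'
  intro u v w huvw
  rw [← ht] at huvw
  obtain ⟨P, S, hPS⟩ := huvw
  have hch : (a.2 :: mid).IsChain Nbr := h.chain.prefix ⟨[b.2], by simp⟩
  have hch' : [u, v, w].IsChain Nbr := hch.infix ⟨P, S, hPS⟩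
  simp only [List.isChain_cons_cons, List.isChain_singleton, and_true] at hch'
  have hvA : v ∈ A := by
    apply h.subset
    rcases P with - | ⟨x, P⟩
    · simp only [List.nil_append, List.cons_append, List.cons.injEq] at hPS
      rw [← hPS.2]
      simp
    · simp only [List.cons_append, List.cons.injEq] at hPS
      rw [← hPS.2]
      simp
  have hnd' := hnd
  rw [← hPS] at hnd'
  simp only [List.append_assoc, List.cons_append, List.nil_append] at hnd'
  have hnd2 : (P ++ [u] ++ v :: (w :: S)).Nodup := by simpa using hnd'
  rw [List.nodup_middle, List.nodup_cons] at hnd2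
  have huw : u ≠ w := by
    rintro rfl
    simp [List.nodup_append] at hnd'
  -- The vertex `v` occurs only once in the closed walk, so the only flow at `v` is in from `u` and
  -- out to `w`.
  refine hc.wind_rightFace hch'.1 hch'.2 huw fun n => ?_
  have hγ' : γ = P ++ u :: v :: w :: (S ++ b.2 :: m) := by
    rw [hγ, ← hPS]
    simp
  have hv1 : v ∉ P ++ [u] := fun h' => hnd2.1 (List.mem_append_left _ h')
  have hv2 : v ∉ w :: (S ++ b.2 :: m) := by
    rw [← List.cons_append, List.mem_append, not_or]
    exact ⟨fun h' => hnd2.1 (List.mem_append_right _ h'), fun h' => hmA v h' hvA⟩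
  rw [hγ', netFlow_append_cons, netFlow_eq_zero hv1, netFlow_cons_cons, netFlow_cons_cons,
    netFlow_eq_zero hv2]
  have := hch'.1.ne
  simp only [net, Prod.mk.injEq, this, false_and, if_false, and_true, true_and]
  have := hch'.2.ne
  grind

/-- The walk contains the edge `[0, 1]`, as `[0, 1]` for `d = 0` and as `[1, 0]` for `d = 1`. -/
def UsesEdge (d : ℤ) (l : List V) : Prop :=
  d = 0 ∧ [((0, 0) : V), (1, 0)] <:+: l ∨ d = 1 ∧ [((1, 0) : V), (0, 0)] <:+: l

/-- The face (0, 0), which is that of w₀, is to the right of [0,1]. It is to the left of [1,0], and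
then crossing this edge, passed once, changes the winding number by one: this is the correction `d`.
-/
lemma IsExcursion.wind_closed_zero {mid m : List V} (h : IsExcursion A a b mid)
    (hn : mid.Nodup) (ha : a.2 ∉ A) (hm : (b.2 :: m).IsChain Nbr)
    (hmA : ∀ v ∈ b.2 :: m, v ∉ A) (hml : (b.2 :: m).getLast? = some a.2) {d : ℤ}
    (hd : UsesEdge d mid) :
    wind (a.2 :: mid ++ b.2 :: m) (0, 0) - d =
      wind (a.2 :: mid ++ b.2 :: m) (rightFace a.2 a.1) := by
  rcases hd with ⟨rfl, hd⟩ | ⟨rfl, hd⟩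
  · rw [← h.wind_closed hn ha hm hmA hml hd, sub_zero]
    rfl
  · rw [← h.wind_closed hn ha hm hmA hml hd]
    have hc : IsClosedWalk (a.2 :: mid ++ b.2 :: m) := h.isClosedWalk hm hml
    have h1 := hc.wind_sub_below 0 0
    obtain ⟨P, S, hPS⟩ := hd
    have hnd : (a.2 :: mid).Nodup := List.nodup_cons.2 ⟨fun h' => ha (h.subset _ h'), hn⟩
    have hfl : netFlow (a.2 :: mid ++ b.2 :: m) (0, 0) (1, 0) = -1 := by
      have e1 : a.2 :: mid ++ b.2 :: m =
          (a.2 :: P) ++ (1, 0) :: (0, 0) :: (S ++ b.2 :: m) := by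
        rw [← hPS]
        simp
      have e2 : a.2 :: mid = (a.2 :: P ++ [(1, 0)]) ++ (0, 0) :: S := by
        rw [← hPS]
        simp
      have e3 : a.2 :: mid = (a.2 :: P) ++ (1, 0) :: (0, 0) :: S := by
        rw [← hPS]
        simp
      have n2 := hnd
      rw [e2, List.nodup_middle, List.nodup_cons] at n2
      have n3 := hnd
      rw [e3, List.nodup_middle, List.nodup_cons] at n3
      have h10 : ((1, 0) : V) ∈ A := h.subset _ (by rw [← hPS]; simp)
      have m1 : ((0, 0) : V) ∉ a.2 :: P ++ [(1, 0)] := fun h' =>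
        n2.1 (List.mem_append_left _ h')
      have m2 : ((1, 0) : V) ∉ (0, 0) :: (S ++ b.2 :: m) := by
        rw [← List.cons_append, List.mem_append, not_or]
        exact ⟨fun h' => n3.1 (List.mem_append_right _ h'), fun h' => hmA _ h' h10⟩
      rw [e1, netFlow_append_cons, netFlow_eq_zero m1, netFlow_cons_cons, netFlow_swap,
        netFlow_eq_zero m2]
      simp [net]
    simp only [zero_add, hfl] at h1
    have h2 : rightFace ((1, 0) : V) (0, 0) = (0, 1) := by simp [rightFace]
    rw [h2]
    omega

/-- Self-avoiding walks from `a` to `b` through `[0, 1]` differ in winding only by the direction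
of this edge. -/
lemma wind_saw_sub_eq (hA : IsLatticeDomain A) (ha : a ∈ edgeBoundary A)
    (hb : b ∈ edgeBoundary A) {mid mid' : List V} (h : IsExcursion A a b mid)
    (h' : IsExcursion A a b mid') (hn : mid.Nodup) (hn' : mid'.Nodup) {d d' : ℤ}
    (hd : UsesEdge d mid) (hd' : UsesEdge d' mid') :
    wind (a.2 :: (mid ++ [b.2])) (0, 0) - d = wind (a.2 :: (mid' ++ [b.2])) (0, 0) - d' := by
  -- Both walks are closed by the same outer path, so that its contribution drops out of the
  -- comparison.
  obtain ⟨m, hm, hmA, hml⟩ := exists_isChain_of_connected hA.compl_connected hb.2.1 ha.2.1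
  have e := h.wind_closed_zero hn ha.2.1 hm hmA hml hd
  have e' := h'.wind_closed_zero hn' ha.2.1 hm hmA hml hd'
  rw [wind_append_cons _ _ _ (0, 0), wind_append_cons _ _ _ (rightFace a.2 a.1)] at e e'
  obtain ⟨s, hs⟩ := List.getLast?_eq_some_iff.1 h.last
  obtain ⟨s', hs'⟩ := List.getLast?_eq_some_iff.1 h'.last
  obtain ⟨t, ht⟩ := h.exists_cons
  obtain ⟨t', ht'⟩ := h'.exists_cons
  have hrev : mid'.reverse = b.1 :: s'.reverse := by rw [hs']; simp
  set l : List V := s ++ b.1 :: s'.reverse with hl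
  have hwind : ∀ z, wind l z = wind (a.2 :: (mid ++ [b.2])) z - wind (a.2 :: (mid' ++ [b.2])) z := by
    have key : ∀ (mid s t : List V), mid = s ++ [b.1] → mid = a.1 :: t → ∀ z,
        wind (a.2 :: (mid ++ [b.2])) z = crossing z a.swap + wind mid z + crossing z b := by
      intro mid s t hs ht z
      have : mid ++ [b.2] = s ++ b.1 :: [b.2] := by rw [hs]; simp
      have h1 : wind (mid ++ [b.2]) z = wind mid z + crossing z b := by
        rw [this, wind_append_cons, ← hs, wind_cons_cons, wind_singleton, add_zero]
      have h2 : wind (a.2 :: (mid ++ [b.2])) z = crossing z a.swap + wind (mid ++ [b.2]) z := by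
        rw [ht, List.cons_append, wind_cons_cons]
        rfl
      rw [h2, h1, add_assoc]
    intro z
    rw [hl, wind_append_cons, ← hs, ← hrev, wind_reverse, key mid s t hs ht,
      key mid' s' t' hs' ht']
    ring
  have hch : ∀ mid : List V, IsExcursion A a b mid → mid.IsChain Nbr := fun mid h =>
    h.chain.infix ⟨[a.2], [b.2], by simp⟩
  have hlc : IsClosedWalk l := by
    constructor
    · rw [hl, List.isChain_split, ← hs, ← hrev]
      refine ⟨hch _ h, ?_⟩
      rw [List.isChain_reverse]
      exact (hch _ h').imp fun u v huv => huv.symm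
    · have h1 : l.getLast? = some a.1 := by
        rw [hl, ← hrev, List.getLast?_append, List.getLast?_reverse, h'.head]
        rfl
      rw [h1, hl, head?_append_cons, ← hs, h.head]
  have hlA : ∀ v ∈ l, v ∈ A := by
    intro v hv
    rw [hl, List.mem_append, ← hrev, List.mem_reverse] at hv
    rcases hv with hv | hv
    · exact h.subset v (by rw [hs]; exact List.mem_append_left _ hv)
    · exact h'.subset v hv
  -- The reference face touches the outer vertex `a.2`, around which the difference walk does not
  -- wind; so the two walks have the same value there.
  have h0 := hlc.wind_rightFace_eq (v := a.1) (fun hal => ha.2.1 (hlA _ hal))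
  rw [hlc.wind_eq_zero hA hlA ha.2.1, hwind] at h0
  simp only [List.cons_append] at e e'
  omega

/-- A closed walk in `A` that winds around the face `w₀` meets every walk from the boundary
to `0`. -/
lemma IsClosedWalk.exists_mem_of_wind_ne_zero (hA : IsLatticeDomain A) (ha : a ∈ edgeBoundary A)
    {mid : List V} (h : IsExcursion A a b mid) (h0 : ((0, 0) : V) ∈ mid) {l : List V}
    (hl : IsClosedWalk l) (hlA : ∀ v ∈ l, v ∈ A) (hw : wind l (0, 0) ≠ 0) :
    ∃ z ∈ l, z ∈ mid := by
  by_contra! hcon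
  refine hw ?_
  have hch : (a.2 :: mid).IsChain Nbr := h.chain.prefix ⟨[b.2], by simp⟩
  have ha2 : a.2 ∉ l := fun h' => ha.2.1 (hlA _ h')
  -- If the loop avoided the walk, its winding number would be constant along the walk from `a.2`,
  -- where it vanishes, to the vertex (0, 0), which indexes the face of w₀.
  rw [hl.wind_eq_of_isChain hch ?_ (List.mem_cons_of_mem _ h0), hl.wind_eq_zero hA hlA ha.2.1]
  intro v hv hvl
  rcases List.mem_cons.1 hv with rfl | hv
  · exact ha2 hvl
  · exact hcon v hvl hv

end LERW

namespace LERW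

open Complex Filter Topology

/-! ### Geometry of the planar domain -/

@[simp] lemma toC_re (z : V) : (toC z).re = z.1 := by simp [toC]
@[simp] lemma toC_im (z : V) : (toC z).im = z.2 := by simp [toC]
@[simp] lemma w0_re : w0.re = 1 / 2 := by simp [w0]
@[simp] lemma w0_im : w0.im = -(1 / 2) := by simp [w0]

lemma toC_sub_w0_re_ne (z : V) : (toC z - w0).re ≠ 0 := by
  simp only [sub_re, toC_re, w0_re]
  intro h
  have h2 : (2 * z.1 : ℝ) = 1 := by linarith
  norm_cast at h2
  omega

lemma toC_sub_w0_im_ne (z : V) : (toC z - w0).im ≠ 0 := by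
  simp only [sub_im, toC_im, w0_im]
  intro h
  have h2 : (2 * z.2 : ℝ) = -1 := by linarith
  norm_cast at h2
  omega

lemma toC_sub_w0_ne_zero (z : V) : toC z - w0 ≠ 0 := fun h =>
  toC_sub_w0_re_ne z (by rw [h]; rfl)

lemma isOpen_box (a b c d : ℝ) : IsOpen {z : ℂ | (a < z.re ∧ z.re < b) ∧ c < z.im ∧ z.im < d} :=
  (isOpen_Ioo.preimage continuous_re).inter (isOpen_Ioo.preimage continuous_im)

lemma mem_domainD_of_box {A : Set V} {a b c d : ℝ} {w : ℂ}
    (hw : (a < w.re ∧ w.re < b) ∧ c < w.im ∧ w.im < d)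
    (h : ∀ z : ℂ, (a < z.re ∧ z.re < b) ∧ c < z.im ∧ z.im < d → ∃ v ∈ A, z ∈ square v) :
    w ∈ domainD A := by
  refine mem_interior.2 ⟨_, fun z hz => ?_, isOpen_box a b c d, hw⟩
  obtain ⟨v, hv, hz⟩ := h z hz
  exact Set.mem_biUnion hv hz

lemma mem_square {z : ℂ} {v : V} : z ∈ square v ↔
    (v.1 - 1 / 2 ≤ z.re ∧ z.re ≤ v.1 + 1 / 2) ∧ v.2 - 1 / 2 ≤ z.im ∧ z.im ≤ v.2 + 1 / 2 := by
  rw [square, Set.mem_ofPred_eq, abs_le, abs_le]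
  constructor <;> rintro ⟨⟨h1, h2⟩, h3, h4⟩ <;> refine ⟨⟨?_, ?_⟩, ?_, ?_⟩ <;> linarith

lemma segment_mem_domainD {A : Set V} {u v : V} (hu : u ∈ A) (hv : v ∈ A) (huv : Nbr u v) {t : ℝ}
    (ht : t ∈ Set.Icc (0 : ℝ) 1) : toC u + t * (toC v - toC u) ∈ domainD A := by
  have key : ∀ u v : V, u ∈ A → v ∈ A → v = (u.1 + 1, u.2) ∨ v = (u.1, u.2 + 1) →
      ∀ t ∈ Set.Icc (0 : ℝ) 1, toC u + t * (toC v - toC u) ∈ domainD A := by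
    rintro ⟨x, y⟩ v hu hv (rfl | rfl) t ⟨h0, h1⟩
    · refine mem_domainD_of_box (a := x - 1 / 2) (b := x + 3 / 2) (c := y - 1 / 2) (d := y + 1 / 2)
        ?_ ?_
      · refine ⟨⟨?_, ?_⟩, ?_, ?_⟩ <;> simp <;> linarith
      · rintro z ⟨⟨h1, h2⟩, h3, h4⟩
        by_cases h : z.re ≤ x + 1 / 2
        · exact ⟨_, hu, mem_square.2 ⟨⟨by linarith, by linarith⟩, by linarith, by linarith⟩⟩
        · refine ⟨_, hv, mem_square.2 ⟨⟨?_, ?_⟩, ?_, ?_⟩⟩ <;> push_cast <;> linarith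
    · refine mem_domainD_of_box (a := x - 1 / 2) (b := x + 1 / 2) (c := y - 1 / 2) (d := y + 3 / 2)
        ?_ ?_
      · refine ⟨⟨?_, ?_⟩, ?_, ?_⟩ <;> simp <;> linarith
      · rintro z ⟨⟨h1, h2⟩, h3, h4⟩
        by_cases h : z.im ≤ y + 1 / 2
        · exact ⟨_, hu, mem_square.2 ⟨⟨by linarith, by linarith⟩, by linarith, by linarith⟩⟩
        · refine ⟨_, hv, mem_square.2 ⟨⟨?_, ?_⟩, ?_, ?_⟩⟩ <;> push_cast <;> linarith
  have key' : u = (v.1 + 1, v.2) ∨ u = (v.1, v.2 + 1) →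
      toC u + t * (toC v - toC u) ∈ domainD A := by
    intro h
    have := key v u hv hu h (1 - t) ⟨by linarith [ht.2], by linarith [ht.1]⟩
    convert this using 1
    push_cast
    ring
  obtain ⟨x, y⟩ := u
  rcases nbr_iff.1 huv with h | h | h | h
  · exact key _ _ hu hv (Or.inl h) t ht
  · exact key' (Or.inl (by simp [h]))
  · exact key _ _ hu hv (Or.inr h) t ht
  · exact key' (Or.inr (by simp [h]))

/-- The point w₀ is a common corner of four squares. Points slightly to the upper right of it belong
only to the square centred at 1, so this square must be present. -/
lemma one_mem_of_w0_mem {A : Set V} (h : w0 ∈ domainD A) : ((1, 0) : V) ∈ A := by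
  obtain ⟨ε, hε, hball⟩ := Metric.mem_nhds_iff.1 (mem_interior_iff_mem_nhds.1 h)
  set δ : ℝ := min (ε / 4) (1 / 2) with hδ
  have hδ0 : 0 < δ := lt_min (by linarith) (by norm_num)
  have hδ1 : δ ≤ 1 / 2 := min_le_right _ _
  have hδ2 : δ ≤ ε / 4 := min_le_left _ _
  have hmem : w0 + (δ + δ * I) ∈ Metric.ball w0 ε := by
    rw [Metric.mem_ball, dist_eq_norm, add_sub_cancel_left]
    calc ‖(δ + δ * I : ℂ)‖ ≤ ‖(δ : ℂ)‖ + ‖(δ * I : ℂ)‖ := norm_add_le _ _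
      _ = δ + δ := by simp [abs_of_pos hδ0]
      _ < ε := by linarith
  obtain ⟨z, hz, hzs⟩ := Set.mem_iUnion₂.1 (hball hmem)
  rw [mem_square] at hzs
  simp at hzs
  obtain ⟨⟨h1, h2⟩, h3, h4⟩ := hzs
  have e1 : z.1 = 1 := by
    have a1 : (z.1 : ℝ) < 2 := by linarith
    have a2 : (0 : ℝ) < z.1 := by linarith
    norm_cast at a1 a2
    omega
  have e2 : z.2 = 0 := by
    have a1 : (z.2 : ℝ) < 1 := by linarith
    have a2 : (-1 : ℝ) < z.2 := by linarith
    norm_cast at a1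
    have : -1 < z.2 := by exact_mod_cast a2
    omega
  rwa [← e1, ← e2]

/-! ### Turning around `w₀` -/

lemma int_eq_of_abs_lt {j c : ℤ} (h : |2 * Real.pi * j - 2 * Real.pi * c| < 2 * Real.pi) :
    j = c := by
  have hpi := Real.pi_pos
  rw [← mul_sub, abs_mul, abs_of_pos (by positivity)] at h
  have h1 : |(j : ℝ) - c| < 1 := by
    by_contra h'
    nlinarith
  have h2 : |j - c| < 1 := by exact_mod_cast h1
  rw [Int.abs_lt_one_iff] at h2
  omega

/-- The branch cut of arg (z − w₀) is the ray that `crossing (0, 0)` counts. The two sides can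
differ only by a multiple of 2π, which is found by locating both endpoints in the quadrants around
w₀. -/
lemma arg_div_eq_add_crossing {u v : V} (huv : Nbr u v) :
    arg ((toC v - w0) / (toC u - w0)) = arg (toC v - w0) - arg (toC u - w0) +
      2 * Real.pi * crossing (0, 0) (u, v) := by
  have hpi := Real.pi_pos
  obtain ⟨j, hj⟩ : ∃ j : ℤ, arg ((toC v - w0) / (toC u - w0)) =
      arg (toC v - w0) - arg (toC u - w0) + 2 * Real.pi * j := by
    have := arg_div_coe_angle (toC_sub_w0_ne_zero v) (toC_sub_w0_ne_zero u)
    rw [← Real.Angle.coe_sub, Real.Angle.angle_eq_iff_two_pi_dvd_sub] at this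
    obtain ⟨k, hk⟩ := this
    exact ⟨k, by linarith⟩
  rw [hj]
  suffices h : j = crossing (0, 0) (u, v) by rw [h]
  have hr1 := neg_pi_lt_arg ((toC v - w0) / (toC u - w0))
  have hr2 := arg_le_pi ((toC v - w0) / (toC u - w0))
  rw [hj] at hr1 hr2
  have up : ∀ z : V, 0 ≤ z.2 → 0 ≤ arg (toC z - w0) ∧ arg (toC z - w0) < Real.pi := by
    intro z hz
    refine ⟨arg_nonneg_iff.2 ?_, arg_lt_pi_iff.2 (Or.inr (toC_sub_w0_im_ne z))⟩
    have : (0 : ℝ) ≤ z.2 := by exact_mod_cast hz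
    simp only [sub_im, toC_im, w0_im]
    linarith
  have down : ∀ z : V, z.2 < 0 → -Real.pi < arg (toC z - w0) ∧ arg (toC z - w0) < 0 := by
    intro z hz
    refine ⟨neg_pi_lt_arg _, arg_neg_iff.2 ?_⟩
    have : (z.2 : ℝ) ≤ -1 := by exact_mod_cast Int.le_sub_one_of_lt hz
    simp only [sub_im, toC_im, w0_im]
    linarith
  have right : ∀ z : V, 0 < z.1 → |arg (toC z - w0)| < Real.pi / 2 := by
    intro z hz
    refine abs_arg_lt_pi_div_two_iff.2 (Or.inl ?_)
    have : (1 : ℝ) ≤ z.1 := by exact_mod_cast hz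
    simp only [sub_re, toC_re, w0_re]
    linarith
  have upleft : ∀ z : V, z.1 ≤ 0 → 0 ≤ z.2 → Real.pi / 2 < arg (toC z - w0) := by
    intro z hz hz'
    by_contra! h
    rw [arg_le_pi_div_two_iff] at h
    have : (z.1 : ℝ) ≤ 0 := by exact_mod_cast hz
    have : (0 : ℝ) ≤ z.2 := by exact_mod_cast hz'
    simp only [sub_re, toC_re, w0_re, sub_im, toC_im, w0_im] at h
    rcases h with h | h <;> linarith
  have downleft : ∀ z : V, z.1 ≤ 0 → z.2 < 0 → arg (toC z - w0) < -(Real.pi / 2) := by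
    intro z hz hz'
    by_contra! h
    rw [neg_pi_div_two_le_arg_iff] at h
    have : (z.1 : ℝ) ≤ 0 := by exact_mod_cast hz
    have : (z.2 : ℝ) ≤ -1 := by exact_mod_cast Int.le_sub_one_of_lt hz'
    simp only [sub_re, toC_re, w0_re, sub_im, toC_im, w0_im] at h
    rcases h with h | h <;> linarith
  have nocross : |arg (toC v - w0) - arg (toC u - w0)| < Real.pi → crossing (0, 0) (u, v) = 0 →
      j = crossing (0, 0) (u, v) := by
    intro h h0
    rw [h0]
    rw [abs_lt] at h
    refine int_eq_of_abs_lt ?_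
    rw [abs_lt]
    push_cast
    constructor <;> linarith [h.1, h.2]
  by_cases hu : 0 ≤ u.2 <;> by_cases hv : 0 ≤ v.2
  · refine nocross ?_ ?_
    · have := up u hu
      have := up v hv
      rw [abs_lt]
      constructor <;> linarith
    · simp only [crossing]; grind
  · rw [not_le] at hv
    have hvu : v.1 = u.1 ∧ u.2 = 0 ∧ v.2 = -1 := by
      rcases nbr_iff.1 huv with rfl | rfl | rfl | rfl <;> simp at * <;> omega
    by_cases hx : 0 < u.1
    · refine nocross ?_ ?_
      · have h1 := abs_lt.1 (right u hx)
        have h2 := abs_lt.1 (right v (by omega))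
        rw [abs_lt]
        constructor <;> linarith [h1.1, h1.2, h2.1, h2.2]
      · simp only [crossing]; grind
    · rw [not_lt] at hx
      have hc : crossing (0, 0) (u, v) = 1 := by simp only [crossing]; grind
      have h1 := upleft u hx hu
      have h2 := up u hu
      have h3 := downleft v (by omega) hv
      have h4 := down v hv
      rw [hc]
      refine int_eq_of_abs_lt ?_
      rw [abs_lt]
      push_cast
      constructor <;> linarith
  · rw [not_le] at hu
    have hvu : v.1 = u.1 ∧ v.2 = 0 ∧ u.2 = -1 := by
      rcases nbr_iff.1 huv with rfl | rfl | rfl | rfl <;> simp at * <;> omega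
    by_cases hx : 0 < u.1
    · refine nocross ?_ ?_
      · have h1 := abs_lt.1 (right u hx)
        have h2 := abs_lt.1 (right v (by omega))
        rw [abs_lt]
        constructor <;> linarith [h1.1, h1.2, h2.1, h2.2]
      · simp only [crossing]; grind
    · rw [not_lt] at hx
      have hc : crossing (0, 0) (u, v) = -1 := by simp only [crossing]; grind
      have h1 := upleft v (by omega) hv
      have h2 := up v hv
      have h3 := downleft u hx hu
      have h4 := down u hu
      rw [hc]
      refine int_eq_of_abs_lt ?_
      rw [abs_lt]
      push_cast
      constructor <;> linarith
  · rw [not_le] at hu hv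
    refine nocross ?_ ?_
    · have := down u hu
      have := down v hv
      rw [abs_lt]
      constructor <;> linarith
    · simp only [crossing]; grind

lemma totalTurn_aux : ∀ (u : V) (l : List V), (u :: l).IsChain Nbr →
    totalTurn (u :: l) = arg (toC ((u :: l).getLast (by simp)) - w0) - arg (toC u - w0) +
      2 * Real.pi * wind (u :: l) (0, 0) := by
  intro u l
  induction l generalizing u with
  | nil => intro _; simp [totalTurn, steps]
  | cons v l ih =>
    intro h
    rw [List.isChain_cons_cons] at h
    have h1 : totalTurn (u :: v :: l) = arg ((toC v - w0) / (toC u - w0)) + totalTurn (v :: l) := by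
      simp [totalTurn, steps_cons_cons]
    rw [h1, ih v h.2, arg_div_eq_add_crossing h.1, wind_cons_cons, List.getLast_cons_cons]
    push_cast
    ring

lemma IsClosedWalk.totalTurn_eq {l : List V} (h : IsClosedWalk l) :
    totalTurn l = 2 * Real.pi * wind l (0, 0) := by
  rcases l with - | ⟨u, l⟩
  · simp [totalTurn, wind, steps]
  · have h2 := h.2
    rw [List.head?_cons, List.getLast?_eq_some_getLast (by simp), Option.some_inj] at h2
    rw [totalTurn_aux u l h.1, ← h2]
    ring

lemma IsClosedWalk.oddWinding_iff {l : List V} (h : IsClosedWalk l) :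
    OddWinding l ↔ Odd (wind l (0, 0)) := by
  have hpi := Real.pi_pos
  rw [OddWinding, h.totalTurn_eq]
  refine exists_congr fun k => ?_
  rw [mul_right_inj' (by positivity)]
  exact_mod_cast Iff.rfl

end LERW

namespace LERW

open Complex Filter Topology

/-! ### The sign `Q` is gauge equivalent to the crossing sign -/

/-- The definition takes an arbitrary continuous argument. Two of them differ along a nonvanishing
curve by a continuous function with values in 2πℤ, hence by a constant, and both floors move by the
same integer. -/
lemma argFloorChange_eq {g : ℝ → ℂ} {Θ : ℝ → ℝ} (hΘ : ContinuousOn Θ (Set.Icc 0 1))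
    (hg : ∀ t ∈ Set.Icc (0 : ℝ) 1, g t = (‖g t‖ : ℂ) * exp ((Θ t : ℂ) * I))
    (h0 : ∀ t ∈ Set.Icc (0 : ℝ) 1, g t ≠ 0) :
    argFloorChange g = ⌊Θ 1 / (2 * Real.pi)⌋ - ⌊Θ 0 / (2 * Real.pi)⌋ := by
  have hpi := Real.pi_pos
  have hex : ∃ Θ : ℝ → ℝ, ContinuousOn Θ (Set.Icc 0 1) ∧
      ∀ t ∈ Set.Icc (0 : ℝ) 1, g t = (‖g t‖ : ℂ) * exp ((Θ t : ℂ) * I) := ⟨Θ, hΘ, hg⟩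
  rw [argFloorChange, dif_pos hex]
  obtain ⟨hc, hΨ⟩ := hex.choose_spec
  set Ψ := hex.choose
  have hint : ∀ t ∈ Set.Icc (0 : ℝ) 1, ∃ n : ℤ, (Ψ t - Θ t) / (2 * Real.pi) = n := by
    intro t ht
    have hn : (‖g t‖ : ℂ) ≠ 0 := by simpa using h0 t ht
    have h1 := mul_left_cancel₀ hn ((hΨ t ht).symm.trans (hg t ht))
    obtain ⟨n, hn⟩ := exp_eq_exp_iff_exists_int.1 h1
    refine ⟨n, ?_⟩
    have h2 := congrArg Complex.im hn
    simp at h2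
    field_simp
    linarith
  have hdisc : IsDiscrete (Set.range ((↑) : ℤ → ℝ)) := by
    rw [isDiscrete_iff_discreteTopology]
    exact Int.isClosedEmbedding_coe_real.isEmbedding.toHomeomorph.symm.isEmbedding.discreteTopology
  have hconst := isPreconnected_Icc.constant_of_mapsTo hdisc
    (f := fun t => (Ψ t - Θ t) / (2 * Real.pi)) ((hc.sub hΘ).div_const _)
    (fun t ht => let ⟨n, hn⟩ := hint t ht; ⟨n, hn.symm⟩)
    (Set.right_mem_Icc.2 zero_le_one) (Set.left_mem_Icc.2 zero_le_one)
  obtain ⟨n, hn⟩ := hint 0 (Set.left_mem_Icc.2 zero_le_one)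
  simp only [hn] at hconst
  have e : ∀ t, (Ψ t - Θ t) / (2 * Real.pi) = n →
      ⌊Ψ t / (2 * Real.pi)⌋ = ⌊Θ t / (2 * Real.pi)⌋ + n := by
    intro t ht
    rw [← Int.floor_add_intCast, ← ht]
    ring_nf
  rw [e 0 hn, e 1 hconst]
  ring

variable {A : Set V} {f : ℂ → ℂ}

lemma isOpen_domainD (A : Set V) : IsOpen (domainD A) := isOpen_interior

/-- An injective holomorphic map is open, so `f` is a homeomorphism onto the disc and simple
connectedness is carried back from there; no topology of lattice domains enters. -/
lemma IsNormalizedConformalMap.isSimplyConnected (hf : IsNormalizedConformalMap A f) :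
    IsSimplyConnected (domainD A) := by
  have := (Metric.contractibleSpace_ball (x := (0 : ℂ)) one_pos)
  set e : domainD A ≃ Metric.ball (0 : ℂ) 1 := hf.bijOn.equiv with he
  have hval : ∀ z : domainD A, ((e z : Metric.ball (0 : ℂ) 1) : ℂ) = f z := fun z => rfl
  have hcont : Continuous e := by
    refine Continuous.subtype_mk ?_ _
    exact hf.differentiableOn.continuousOn.domRestrict
  have hopen : IsOpenMap e := by
    rw [isOpenMap_iff_nhds_le]
    intro z
    rw [← Filter.map_le_map_iff (m := Subtype.val) Subtype.val_injective, Filter.map_map,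
      Metric.isOpen_ball.isOpenEmbedding_subtypeVal.map_nhds_eq]
    have h1 : Subtype.val ∘ e = f ∘ Subtype.val := rfl
    rw [h1, ← Filter.map_map,
      (isOpen_domainD A).isOpenEmbedding_subtypeVal.map_nhds_eq, hval]
    have han := hf.differentiableOn.analyticAt ((isOpen_domainD A).mem_nhds z.2)
    refine han.eventually_constant_or_nhds_le_map_nhds.resolve_left fun hconst => ?_
    have h2 : ∀ᶠ w : ℂ in 𝓝 z.1, w = z.1 := by
      filter_upwards [hconst, (isOpen_domainD A).mem_nhds z.2] with w hw hwD
      exact hf.bijOn.injOn hwD z.2 hw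
    have h3 : ∀ᶠ w : ℂ in 𝓝[≠] z.1, w = z.1 := h2.filter_mono nhdsWithin_le_nhds
    obtain ⟨w, hw, hw'⟩ := (h3.and self_mem_nhdsWithin).exists
    exact hw' hw
  exact (e.toHomeomorphOfContinuousOpen hcont hopen).toHomotopyEquiv.simplyConnectedSpace

/-- On `D_A` the conformal map is `(z - w₀) exp k(z)` with a continuous function `k`. -/
lemma IsNormalizedConformalMap.exists_log (hf : IsNormalizedConformalMap A f)
    (hw0 : w0 ∈ domainD A) : ∃ k : ℂ → ℂ, ContinuousOn k (domainD A) ∧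
      ∀ z ∈ domainD A, f z = (z - w0) * exp (k z) := by
  have hfac : ∀ z, f z = (z - w0) * dslope f w0 z := by
    intro z
    have := sub_smul_dslope f w0 z
    rw [hf.map_w0, sub_zero, smul_eq_mul] at this
    exact this.symm
  have hnhds := (isOpen_domainD A).mem_nhds hw0
  have hcont : ContinuousOn (dslope f w0) (domainD A) :=
    (continuousOn_dslope hnhds).2 ⟨hf.differentiableOn.continuousOn,
      hf.differentiableOn.differentiableAt hnhds⟩
  -- The quotient f(z)/(z − w₀) has no zero: at w₀ it is f′(w₀), elsewhere a zero would contradict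
  -- injectivity.
  have hne : (0 : ℂ) ∉ dslope f w0 '' domainD A := by
    rintro ⟨z, hz, h0⟩
    rcases eq_or_ne z w0 with rfl | hzw
    · rw [dslope_same] at h0
      have := hf.deriv_re_pos
      rw [h0] at this
      simp at this
    · have h1 := hfac z
      rw [h0, mul_zero, ← hf.map_w0] at h1
      exact hzw (hf.bijOn.injOn hz hw0 h1)
  obtain ⟨k, hk, hk'⟩ := exists_continuousOn_eqOn_exp_comp hf.isSimplyConnected
    (isOpen_domainD A) hcont hne
  exact ⟨k, hk, fun z hz => by rw [hfac z, ← hk' hz]; rfl⟩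

/-- The line through an edge misses w₀, so the quotient is 1 + tr with r not real. The principal
argument is therefore continuous along the whole edge. -/
lemma sub_w0_ne_zero_of_segment {u v : V} (huv : Nbr u v) (t : ℝ) :
    (toC u + t * (toC v - toC u) - w0) / (toC u - w0) ∈ slitPlane := by
  have hu := toC_sub_w0_ne_zero u
  rw [show (toC u + t * (toC v - toC u) - w0) / (toC u - w0) =
    1 + t * ((toC v - toC u) / (toC u - w0)) by field_simp; ring, mem_slitPlane_iff]
  rcases eq_or_ne t 0 with rfl | ht
  · left; simp
  · right
    have hns : normSq (toC u - w0) ≠ 0 := by simpa using hu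
    have hre := toC_sub_w0_re_ne u
    have him := toC_sub_w0_im_ne u
    have h : ((toC v - toC u) / (toC u - w0)).im ≠ 0 := by
      rw [Complex.div_im, ← sub_div]
      refine div_ne_zero ?_ hns
      obtain ⟨x, y⟩ := u
      rcases nbr_iff.1 huv with rfl | rfl | rfl | rfl <;> simp at hre him ⊢ <;> intro h <;>
        first | exact hre (by linarith) | exact him (by linarith)
    rw [add_im, one_im, zero_add, im_ofReal_mul]
    exact mul_ne_zero ht h

/-- The sign of an inner edge is the crossing sign, up to a gauge transformation. -/
lemma IsNormalizedConformalMap.exists_gauge (hf : IsNormalizedConformalMap A f)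
    (hw0 : w0 ∈ domainD A) : ∃ n : V → ℤ, ∀ u v, u ∈ A → v ∈ A → Nbr u v →
      edgeSign A f (u, v) = (-1 : ℝ) ^ (n v - n u + crossing (0, 0) (u, v)) := by
  obtain ⟨k, hk, hfk⟩ := hf.exists_log hw0
  have hpi := Real.pi_pos
  -- The floor of a determination of arg f / 2π that uses the principal argument of z − w₀. Along an
  -- edge it fails to continue only when the cut is crossed, which accounts for `crossing`.
  refine ⟨fun z => ⌊(arg (toC z - w0) + (k (toC z)).im) / (2 * Real.pi)⌋, fun u v hu hv huv => ?_⟩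
  rw [edgeSign]
  congr 1
  set z : ℝ → ℂ := fun t => toC u + t * (toC v - toC u) with hz
  have hzD : ∀ t ∈ Set.Icc (0 : ℝ) 1, z t ∈ domainD A := fun t ht =>
    segment_mem_domainD hu hv huv ht
  have hzc : Continuous z := by fun_prop
  have hslit : ∀ t, (z t - w0) / (toC u - w0) ∈ slitPlane := sub_w0_ne_zero_of_segment huv
  have hu0 := toC_sub_w0_ne_zero u
  have hz0 : ∀ t, z t - w0 ≠ 0 := fun t h => by
    have := hslit t
    rw [h, zero_div] at this
    exact zero_notMem_slitPlane this
  have hedge : ∀ t ∈ Set.Icc (0 : ℝ) 1,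
      extendFrom (domainD A) f (edgeCurve A (u, v) t) = (z t - w0) * exp (k (z t)) := by
    intro t ht
    have : edgeCurve A (u, v) t = z t := by simp [edgeCurve, hu, hv, hz]
    rw [this, extendFrom_extends hf.differentiableOn.continuousOn _ (hzD t ht), hfk _ (hzD t ht)]
  -- A continuous argument of `f` along the edge: that of the starting point, the rotation since
  -- then, and the contribution of exp k.
  set Θ : ℝ → ℝ := fun t => arg (toC u - w0) + arg ((z t - w0) / (toC u - w0)) + (k (z t)).im
    with hΘ
  have hΘc : ContinuousOn Θ (Set.Icc 0 1) := by
    refine ContinuousOn.add (ContinuousOn.add continuousOn_const ?_) ?_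
    · intro t _
      refine ContinuousAt.continuousWithinAt ?_
      exact (continuousAt_arg (hslit t)).comp
        (f := fun t => (z t - w0) / (toC u - w0)) (by fun_prop)
    · exact Complex.continuous_im.comp_continuousOn (hk.comp hzc.continuousOn hzD)
  rw [argFloorChange_eq hΘc]
  · have e0 : Θ 0 = arg (toC u - w0) + (k (toC u)).im := by
      simp [hΘ, hz, div_self hu0]
    have e1 : Θ 1 = arg (toC v - w0) + (k (toC v)).im +
        2 * Real.pi * crossing (0, 0) (u, v) := by
      have : z 1 = toC v := by simp [hz]
      simp only [hΘ, this, arg_div_eq_add_crossing huv]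
      ring
    rw [e0, e1, add_div _ (2 * Real.pi * _), mul_div_cancel_left₀ _ (by positivity),
      Int.floor_add_intCast]
    ring
  · intro t ht
    rw [hedge t ht, norm_mul]
    have h1 := norm_mul_exp_arg_mul_I (toC u - w0)
    have h2 := norm_mul_exp_arg_mul_I ((z t - w0) / (toC u - w0))
    have h3 : z t - w0 = (toC u - w0) * ((z t - w0) / (toC u - w0)) := by field_simp
    have h4 : exp (k (z t)) = (‖exp (k (z t))‖ : ℂ) * exp ((k (z t)).im * I) := by
      rw [norm_exp, ofReal_exp, ← exp_add, re_add_im]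
    have h5 : (Θ t : ℂ) * I = arg (toC u - w0) * I + arg ((z t - w0) / (toC u - w0)) * I +
        (k (z t)).im * I := by
      simp only [hΘ]
      push_cast
      ring
    rw [h5, exp_add, exp_add]
    calc (z t - w0) * exp (k (z t))
        = ((toC u - w0) * ((z t - w0) / (toC u - w0))) * exp (k (z t)) := by rw [← h3]
      _ = (‖toC u - w0‖ * exp (arg (toC u - w0) * I) * (‖(z t - w0) / (toC u - w0)‖ *
          exp (arg ((z t - w0) / (toC u - w0)) * I))) *
          ((‖exp (k (z t))‖ : ℂ) * exp ((k (z t)).im * I)) := by rw [h1, h2, ← h4]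
      _ = _ := by
        have h6 : ‖z t - w0‖ = ‖toC u - w0‖ * ‖(z t - w0) / (toC u - w0)‖ := by
          rw [← norm_mul, ← h3]
        rw [h6]
        push_cast
        ring
  · intro t ht
    rw [hedge t ht]
    exact mul_ne_zero (hz0 t) (exp_ne_zero _)

end LERW

namespace LERW

/-! ### The weights `p` and `q` as multiplicative weights -/

open Classical in
/-- The transition probabilities of simple random walk. -/
noncomputable def srwWeight (u v : V) : ℝ := if Nbr u v then 1 / 4 else 0

/-- The transition probabilities with the crossing sign. -/
noncomputable def signWeight (u v : V) : ℝ := srwWeight u v * (-1) ^ crossing (0, 0) (u, v)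

lemma isWeight_srwWeight : IsWeight srwWeight where
  eq_zero u v h := if_neg h
  abs_le u v := by unfold srwWeight; split_ifs <;> norm_num
  symm u v := by
    unfold srwWeight
    by_cases h : Nbr u v
    · rw [if_pos h, if_pos h.symm]
    · rw [if_neg h, if_neg fun h' => h h'.symm]

lemma isWeight_signWeight : IsWeight signWeight where
  eq_zero u v h := by rw [signWeight, isWeight_srwWeight.eq_zero u v h, zero_mul]
  abs_le u v := by
    rw [signWeight, abs_mul, abs_zpow, abs_neg, abs_one, one_zpow, mul_one]
    exact isWeight_srwWeight.abs_le u v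
  symm u v := by
    rw [signWeight, signWeight, isWeight_srwWeight.symm, crossing_swap, zpow_neg, ← inv_zpow,
      inv_neg, inv_one]

lemma W_srwWeight_nonneg (l : List V) : 0 ≤ W srwWeight l := by
  induction l with
  | nil => simp
  | cons x l ih =>
    rcases l with - | ⟨y, l⟩
    · simp
    · rw [W_cons_cons]
      refine mul_nonneg ?_ ih
      unfold srwWeight
      split_ifs <;> norm_num

lemma p_eq_W {l : List V} (h : l.IsChain Nbr) : p l = W srwWeight l := by
  induction l with
  | nil => simp [p, len]
  | cons x l ih =>
    rcases l with - | ⟨y, l⟩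
    · simp [p, len]
    · rw [List.isChain_cons_cons] at h
      rw [W_cons_cons, ← ih h.2, srwWeight, if_pos h.1]
      simp only [p, len, List.length_cons, add_tsub_cancel_right]
      rw [pow_succ']

lemma W_signWeight (l : List V) :
    W signWeight l = (-1) ^ wind l (0, 0) * W srwWeight l := by
  induction l with
  | nil => simp [wind, steps]
  | cons x l ih =>
    rcases l with - | ⟨y, l⟩
    · simp
    · rw [W_cons_cons, W_cons_cons, ih, wind_cons_cons, zpow_add₀ (by norm_num), signWeight]
      ring

variable {A : Set V} {f : ℂ → ℂ}

/-- The vertex signs telescope, leaving those of the two endpoints and the parity of the crossings;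
for closed walks the endpoints cancel. -/
lemma Q_eq_zpow {n : V → ℤ} (hn : ∀ u v, u ∈ A → v ∈ A → Nbr u v →
      edgeSign A f (u, v) = (-1 : ℝ) ^ (n v - n u + crossing (0, 0) (u, v))) :
    ∀ (x : V) (l : List V), (x :: l).IsChain Nbr → (∀ v ∈ x :: l, v ∈ A) →
      Q A f (x :: l) = (-1) ^ (n ((x :: l).getLast (by simp)) - n x + wind (x :: l) (0, 0)) := by
  intro x l
  induction l generalizing x with
  | nil => intro _ _; simp [Q, steps]
  | cons y l ih =>
    intro h hA
    rw [List.isChain_cons_cons] at h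
    have h1 : Q A f (x :: y :: l) = edgeSign A f (x, y) * Q A f (y :: l) := by
      simp [Q, steps_cons_cons]
    rw [h1, ih y h.2 fun v hv => hA v (List.mem_cons_of_mem _ hv),
      hn x y (hA x (by simp)) (hA y (by simp)) h.1, ← zpow_add₀ (by norm_num), wind_cons_cons,
      List.getLast_cons_cons]
    congr 1
    ring

/-- The sign of a closed walk in `A` is the parity of its winding number. -/
lemma Q_loop (hf : IsNormalizedConformalMap A f) (hw0 : w0 ∈ domainD A) {l : List V}
    (hl : IsLoop l) (hA : IsWalkIn A l) : Q A f l = (-1) ^ wind l (0, 0) := by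
  obtain ⟨n, hn⟩ := hf.exists_gauge hw0
  rcases l with - | ⟨x, l⟩
  · simp [Q, wind, steps]
  · have h2 := hl.2
    rw [List.head?_cons, List.getLast?_eq_some_getLast (by simp), Option.some_inj] at h2
    rw [Q_eq_zpow hn x l hl.1.2 hA.2, ← h2, sub_self, zero_add]

lemma q_loop (hf : IsNormalizedConformalMap A f) (hw0 : w0 ∈ domainD A) {l : List V}
    (hl : IsLoop l) (hA : IsWalkIn A l) : q A f l = W signWeight l := by
  rw [q, Q_loop hf hw0 hl hA, W_signWeight, p_eq_W hl.1.2, mul_comm]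

lemma neg_one_zpow_sq (n : ℤ) : ((-1 : ℝ) ^ n) * (-1) ^ n = 1 := by
  rw [← mul_zpow]
  simp

lemma Q_loop_eq_neg_one_iff (hf : IsNormalizedConformalMap A f) (hw0 : w0 ∈ domainD A)
    {l : List V} (hl : IsLoop l) (hA : IsWalkIn A l) : Q A f l = -1 ↔ OddWinding l := by
  rw [Q_loop hf hw0 hl hA, hl.isClosedWalk.oddWinding_iff]
  constructor
  · intro h
    by_contra h'
    rw [Int.not_odd_iff_even] at h'
    rw [h'.neg_one_zpow] at h
    norm_num at h
  · exact fun h => h.neg_one_zpow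

/-- On walks that leave `A` through a boundary edge, `q` is the sign weight up to a sign that
depends only on the starting point and on the edge. -/
lemma exists_sign_exitWalk (hf : IsNormalizedConformalMap A f) (hw0 : w0 ∈ domainD A) :
    ∃ (σ : V → ℝ) (κ : V × V → ℝ), (∀ x, |σ x| = 1) ∧ (∀ a, |κ a| = 1) ∧
      ∀ (x : V) (a : V × V) (s : List V), (x :: (s ++ [a.2])).IsChain Nbr →
        (∀ v ∈ x :: s, v ∈ A) → (x :: s).getLast? = some a.1 →
        q A f (x :: (s ++ [a.2])) = σ x * κ a * W signWeight (x :: (s ++ [a.2])) := by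
  obtain ⟨n, hn⟩ := hf.exists_gauge hw0
  have h1 : ∀ m : ℤ, |(-1 : ℝ) ^ m| = 1 := fun m => by
    rw [abs_zpow, abs_neg, abs_one, one_zpow]
  -- The sign of the boundary half-edge is put into `κ`; nothing about `f` on ∂D_A is needed except
  -- that this sign is ±1. The crossing of `a` is included because `signWeight` counts the full last
  -- edge.
  refine ⟨fun x => (-1) ^ n x, fun a => (-1) ^ (n a.1 + crossing (0, 0) a) * edgeSign A f a,
    fun x => h1 _, fun a => ?_, fun x a s hs hA hlast => ?_⟩
  · rw [abs_mul, h1, one_mul, edgeSign, h1]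
  · obtain ⟨t, ht⟩ := List.getLast?_eq_some_iff.1 hlast
    have hlast' : (x :: s).getLast (by simp) = a.1 := by
      rwa [List.getLast?_eq_some_getLast (by simp), Option.some_inj] at hlast
    have e : x :: (s ++ [a.2]) = t ++ a.1 :: [a.2] := by
      rw [← List.cons_append, ht]
      simp
    have hch : (x :: s).IsChain Nbr := hs.prefix ⟨[a.2], by simp⟩
    have eQ : Q A f (x :: (s ++ [a.2])) = Q A f (x :: s) * edgeSign A f a := by
      rw [e, Q, steps_append_cons, ← ht, List.map_append, List.prod_append, Q]
      simp [steps]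
    have ew : wind (x :: (s ++ [a.2])) (0, 0) = wind (x :: s) (0, 0) + crossing (0, 0) a := by
      rw [e, wind_append_cons, ← ht]
      simp [wind, steps]
    beta_reduce
    rw [q, eQ, Q_eq_zpow hn x s hch hA, hlast', W_signWeight, ew, p_eq_W hs,
      zpow_add₀ (by norm_num), zpow_sub₀ (by norm_num), zpow_add₀ (by norm_num),
      zpow_add₀ (by norm_num)]
    have h2 := neg_one_zpow_sq (n x)
    have h3 := neg_one_zpow_sq (crossing (0, 0) a)
    have h4 : ((-1 : ℝ) ^ n x)⁻¹ = (-1) ^ n x := inv_eq_of_mul_eq_one_left h2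
    rw [div_eq_mul_inv, h4]
    linear_combination (-(W srwWeight (x :: (s ++ [a.2])) * (-1) ^ n a.1 * (-1) ^ n x *
      (-1) ^ wind (x :: s) (0, 0) * edgeSign A f a)) * h3

/-! ### The kernels of the statement -/

variable {c : V → V → ℝ}

/-- `exitKernel` allows an exit in the first step, `vertexKernel` requires a visit to `K`. The
hypothesis `hxa` makes the two agree. -/
lemma vertexKernel_eq (hc : IsWeight c) {w : List V → ℝ} {K : Finset V} {x : V} {a : V × V}
    {k : ℝ} (hxa : x ≠ a.1)
    (hw : ∀ s : List V, (x :: (s ++ [a.2])).IsChain Nbr → (∀ v ∈ s, v ∈ K) →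
      (x :: s).getLast? = some a.1 → w (x :: (s ++ [a.2])) = k * W c (x :: (s ++ [a.2]))) :
    vertexKernel w K x a = k * exitKernel c K x a := by
  have hlast : ∀ s : List V, (x :: s).getLast? = some a.1 ↔ s.getLast? = some a.1 := by
    intro s
    rcases s with - | ⟨y, s⟩
    · simp [hxa]
    · rw [List.getLast?_cons_cons]
  rw [exitKernel, ← tsum_mul_left, vertexKernel]
  have hsupp : ∀ s : Function.support fun s : List V => k * (if (∀ v ∈ s, v ∈ K) ∧
      (x :: s).getLast? = some a.1 then W c (x :: (s ++ [a.2])) else 0),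
      (x :: (s.1 ++ [a.2])).IsChain Nbr ∧ (∀ v ∈ s.1, v ∈ K) ∧
        (x :: s.1).getLast? = some a.1 := by
    rintro ⟨s, hs⟩
    rw [Function.mem_support, mul_ne_zero_iff, ite_ne_right_iff] at hs
    refine ⟨?_, hs.2.1⟩
    by_contra h
    exact hs.2.2 (W_eq_zero_of_not_isChain hc _ h)
  refine tsum_eq_tsum_of_ne_zero_bij (fun s => ⟨x :: (s.1 ++ [a.2]), ⟨by simp, (hsupp s).1⟩, s.1,
    rfl, (hsupp s).2.1, (hlast _).1 (hsupp s).2.2⟩) ?_ ?_ ?_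
  · intro s t h
    simpa [Subtype.ext_iff] using h
  · intro ω hω
    obtain ⟨_, ⟨_, hch⟩, s, rfl, hK, hl⟩ := ω
    refine ⟨⟨s, ?_⟩, rfl⟩
    rw [Function.mem_support] at hω ⊢
    rw [if_pos ⟨hK, (hlast s).2 hl⟩, ← hw s hch hK ((hlast s).2 hl)]
    exact hω
  · rintro s
    have h := hsupp s
    simp only [if_pos h.2]
    exact hw _ h.1 h.2.1 h.2.2

lemma green_eq_diagGreen (hc : IsWeight c) {w : List V → ℝ} {B : Finset V} {x : V}
    (hw : ∀ l, IsLoop l → IsWalkIn B l → w l = W c l) : green w B x x = diagGreen c B x := by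
  rw [green, diagGreen]
  have hsupp : ∀ s : Function.support fun s : List V => if (∀ v ∈ s ++ [x], v ∈ B) ∧
      (s ++ [x]).head? = some x then W c (s ++ [x]) else 0,
      IsWalkIn B (s.1 ++ [x]) ∧ (s.1 ++ [x]).head? = some x ∧
        (s.1 ++ [x]).getLast? = some x := by
    rintro ⟨s, hs⟩
    rw [Function.mem_support, ite_ne_right_iff] at hs
    refine ⟨⟨⟨by simp, ?_⟩, hs.1.1⟩, hs.1.2, by simp⟩
    by_contra h
    exact hs.2 (W_eq_zero_of_not_isChain hc _ h)
  have hloop : ∀ l, IsWalkIn B l → l.head? = some x → l.getLast? = some x → IsLoop l :=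
    fun l h h1 h2 => ⟨h.1, h1.trans h2.symm⟩
  refine tsum_eq_tsum_of_ne_zero_bij (fun s => ⟨s.1 ++ [x], hsupp s⟩) ?_ ?_ ?_
  · intro s t h
    simpa [Subtype.ext_iff] using h
  · rintro ⟨ω, h1, h2, h3⟩ hω
    obtain ⟨s, rfl⟩ := List.getLast?_eq_some_iff.1 h3
    refine ⟨⟨s, ?_⟩, rfl⟩
    rw [Function.mem_support] at hω ⊢
    rw [if_pos ⟨h1.2, h2⟩, ← hw _ (hloop _ h1 h2 h3) h1]
    exact hω
  · rintro s
    have h := hsupp s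
    rw [if_pos ⟨h.1.2, h.2.1⟩]
    exact hw _ (hloop _ h.1 h.2.1 h.2.2) h.1

end LERW

namespace LERW

/-! ### Sums over self-avoiding walks -/

variable {c : V → V → ℝ}

lemma greenProd_append (c : V → V → ℝ) (B : Finset V) (l l' : List V) :
    greenProd c B (l ++ l') = greenProd c B l * greenProd c (B \ l.toFinset) l' := by
  induction l generalizing B with
  | nil => simp [greenProd]
  | cons x l ih =>
    have : B \ (x :: l).toFinset = B.erase x \ l.toFinset := by
      ext v; simp; tauto
    rw [List.cons_append, greenProd, greenProd, ih, this, mul_assoc]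

/-- The product is the exponential of the measure of the loops meeting the set of vertices, so the
order of the factors is irrelevant. -/
lemma greenProd_perm (hc : IsWeight c) {B : Finset V} {l l' : List V} (h : l.Perm l')
    (hl : l.Nodup) (hB : ∀ v ∈ l, v ∈ B) : greenProd c B l = greenProd c B l' := by
  rw [← exp_loopSum_meets hc hl hB, ← exp_loopSum_meets hc (h.nodup_iff.1 hl)
    fun v hv => hB v (h.mem_iff.2 hv)]
  simp only [h.mem_iff]

@[elab_as_elim]
-- Induction along the recursion of loop erasure: only the part after the last visit to the first
-- vertex matters. The attribute line belongs to this principle.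
lemma loopErase_induction {M : List V → Prop} (nil : M [])
    (append : ∀ x s t, x ∉ t → (s ++ [x]).head? = some x → M t → M (s ++ x :: t)) (l : List V) :
    M l := by
  induction hn : l.length using Nat.strong_induction_on generalizing l with
  | _ n ih =>
    rcases l with - | ⟨x, l⟩
    · exact nil
    · obtain ⟨s, t, hst, ht⟩ := exists_eq_append_cons_of_mem (z := x) (l := x :: l) (by simp)
      have hs : (s ++ [x]).head? = some x := by
        rw [← head?_append_cons s x t, ← hst]
        rfl
      have hlen : t.length < n := by
        have := congrArg List.length hst
        simp only [List.length_append, List.length_cons] at this hn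
        omega
      rw [hst]
      exact append x s t ht hs (ih _ hlen t rfl)

lemma getLast?_loopErase (l : List V) : (loopErase l).getLast? = l.getLast? := by
  induction l using loopErase_induction with
  | nil => simp [loopErase]
  | append x s t ht hs ih =>
    rw [loopErase_append_cons ht hs, List.getLast?_append_cons]
    simp only [List.getLast?_cons, ih]

lemma mem_excursions {A : Set V} {a b : V × V} {ω : List V} :
    ω ∈ excursions A a b ↔ ∃ mid, ω = a.2 :: (mid ++ [b.2]) ∧ IsExcursion A a b mid := by
  constructor
  · rintro ⟨⟨h1, h2⟩, mid, rfl, h3, h4, h5⟩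
    exact ⟨mid, rfl, h2, h3, h4, h5⟩
  · rintro ⟨mid, rfl, h⟩
    exact ⟨⟨by simp, h.chain⟩, mid, rfl, h.subset, h.head, h.last⟩

lemma excursionErase_cons (x y : V) (mid : List V) :
    excursionErase (x :: (mid ++ [y])) = x :: (loopErase mid ++ [y]) := by
  simp [excursionErase]

lemma W_excursion (c : V → V → ℝ) {a b : V × V} {mid : List V} (h1 : mid.head? = some a.1)
    (h2 : mid.getLast? = some b.1) :
    W c (a.2 :: (mid ++ [b.2])) = c a.2 a.1 * c b.1 b.2 * W c mid := by
  obtain ⟨s, hs⟩ := List.getLast?_eq_some_iff.1 h2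
  obtain ⟨t, ht⟩ : ∃ t, mid = a.1 :: t := by
    rcases mid with - | ⟨x, t⟩
    · simp at h1
    · exact ⟨t, by simpa using h1⟩
  have e1 : W c (mid ++ [b.2]) = W c mid * c b.1 b.2 := by
    have : mid ++ [b.2] = s ++ b.1 :: [b.2] := by rw [hs]; simp
    rw [this, W_append_cons, ← hs, W_cons_cons, W_singleton, mul_one]
  have e2 : W c (a.2 :: (mid ++ [b.2])) = c a.2 a.1 * W c (mid ++ [b.2]) := by
    rw [ht, List.cons_append, W_cons_cons]
  rw [e2, e1]
  ring

lemma injective_excursion (a b : V × V) :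
    Function.Injective fun mid : List V => a.2 :: (mid ++ [b.2]) := injective_cons_append _ _

/-- Loop erasure keeps the first and last vertices of `mid`, so the two boundary steps factor out of
all walks with this erasure; the rest is `tsum_loopErase_eq`. -/
lemma pHat_eq {A : Finset V} {a b : V × V} {mid : List V} (h : IsExcursion A a b mid)
    (hn : mid.Nodup) : pHat A a b (a.2 :: (mid ++ [b.2])) =
      W srwWeight (a.2 :: (mid ++ [b.2])) * greenProd srwWeight A mid := by
  rw [W_excursion _ h.head h.last, mul_assoc,
    ← tsum_loopErase_eq isWeight_srwWeight hn h.subset, ← tsum_mul_left, pHat]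
  set k := srwWeight a.2 a.1 * srwWeight b.1 b.2
  have hends : ∀ ω : List V, loopErase ω = mid → ω.head? = some a.1 ∧ ω.getLast? = some b.1 := by
    rintro ω rfl
    exact ⟨by rw [← head?_loopErase, h.head], by rw [← getLast?_loopErase, h.last]⟩
  have hsupp : ∀ ω : Function.support fun ω : List V => k * (if (∀ v ∈ ω, v ∈ A) ∧
      loopErase ω = mid then W srwWeight ω else 0),
      IsExcursion A a b ω.1 ∧ loopErase ω.1 = mid := by
    rintro ⟨ω, hω⟩
    rw [Function.mem_support, mul_ite_zero, ite_ne_right_iff] at hω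
    obtain ⟨⟨h1, h2⟩, h3⟩ := hω
    obtain ⟨h4, h5⟩ := hends ω h2
    refine ⟨⟨?_, h1, h4, h5⟩, h2⟩
    by_contra hch
    rw [← W_excursion _ h4 h5] at h3
    exact h3 (W_eq_zero_of_not_isChain isWeight_srwWeight _ hch)
  refine tsum_eq_tsum_of_ne_zero_bij (fun ω => ⟨a.2 :: (ω.1 ++ [b.2]),
    mem_excursions.2 ⟨ω.1, rfl, (hsupp ω).1⟩, ?_⟩) ?_ ?_ ?_
  · rw [excursionErase_cons, (hsupp ω).2]
  · intro ω ω' h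
    simpa [Subtype.ext_iff] using h
  · intro ω hω
    obtain ⟨_, h1, h2⟩ := ω
    obtain ⟨ω, rfl, hexc⟩ := mem_excursions.1 h1
    rw [excursionErase_cons, List.cons.injEq, List.append_left_inj] at h2
    refine ⟨⟨ω, ?_⟩, rfl⟩
    rw [Function.mem_support] at hω ⊢
    rw [if_pos ⟨hexc.subset, h2.2⟩, ← W_excursion _ hexc.head hexc.last, ← p_eq_W hexc.chain]
    exact hω
  · intro ω
    obtain ⟨h1, h2⟩ := hsupp ω
    rw [if_pos ⟨h1.subset, h2⟩, ← W_excursion _ h1.head h1.last, ← p_eq_W h1.chain]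

/-- The sum over pairs of disjoint self-avoiding walks in `K`, from `x` to `a` and from `y`
to `b`. -/
noncomputable def pairSum (c : V → V → ℝ) (K : Finset V) (x : V) (a : V × V) (y : V)
    (b : V × V) : ℝ :=
  ∑' q : List V × List V, if (q.1 ++ q.2).Nodup ∧ (∀ v ∈ q.1 ++ q.2, v ∈ K) ∧
      (x :: q.1).getLast? = some a.1 ∧ (y :: q.2).getLast? = some b.1
    then W c (x :: (q.1 ++ [a.2])) * W c (y :: (q.2 ++ [b.2])) * greenProd c K (q.1 ++ q.2)
    else 0

lemma pairSum_comm (hc : IsWeight c) (K : Finset V) (x : V) (a : V × V) (y : V) (b : V × V) :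
    pairSum c K x a y b = pairSum c K y b x a := by
  rw [pairSum, ← (Equiv.prodComm (List V) (List V)).tsum_eq, pairSum]
  refine tsum_congr fun q => ?_
  have hp : (q.2 ++ q.1).Perm (q.1 ++ q.2) := List.perm_append_comm
  have h : ((q.2 ++ q.1).Nodup ∧ (∀ v ∈ q.2 ++ q.1, v ∈ K) ∧
      (x :: q.2).getLast? = some a.1 ∧ (y :: q.1).getLast? = some b.1) ↔
      ((q.1 ++ q.2).Nodup ∧ (∀ v ∈ q.1 ++ q.2, v ∈ K) ∧
      (y :: q.1).getLast? = some b.1 ∧ (x :: q.2).getLast? = some a.1) := by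
    rw [hp.nodup_iff]
    simp only [hp.mem_iff]
    tauto
  by_cases h' : (q.1 ++ q.2).Nodup ∧ (∀ v ∈ q.1 ++ q.2, v ∈ K) ∧
      (y :: q.1).getLast? = some b.1 ∧ (x :: q.2).getLast? = some a.1
  · refine (if_pos (h.2 h')).trans (Eq.trans ?_ (if_pos h').symm)
    rw [Equiv.prodComm_apply, Prod.fst_swap, Prod.snd_swap,
      greenProd_perm hc hp (h.2 h').1 (h.2 h').2.1]
    ring
  · exact (if_neg fun h'' => h' (h.1 h'')).trans (if_neg h').symm

/-- The walk from `y` lives in what the first path leaves of `K`. Sorting it by its loop erasure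
with `pathSum_one`, the Green's functions of the two paths combine into one product over `K`. -/
lemma pathSum_exitKernel (hc : IsWeight c) (K : Finset V) (x : V) (a : V × V) (y : V)
    (b : V × V) :
    pathSum c K x a (fun K' => exitKernel c K' y b) = pairSum c K x a y b := by
  have hs : Summable fun q : List V × List V => if (q.1 ++ q.2).Nodup ∧
      (∀ v ∈ q.1 ++ q.2, v ∈ K) ∧ (x :: q.1).getLast? = some a.1 ∧
      (y :: q.2).getLast? = some b.1 then W c (x :: (q.1 ++ [a.2])) *
      W c (y :: (q.2 ++ [b.2])) * greenProd c K (q.1 ++ q.2) else 0 := by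
    refine summable_of_hasFiniteSupport (((finite_nodup_lists K).prod
      (finite_nodup_lists K)).subset ?_)
    intro q hq
    rw [Function.mem_support, ite_ne_right_iff] at hq
    obtain ⟨⟨h1, h2, -⟩, -⟩ := hq
    rw [List.nodup_append] at h1
    exact ⟨⟨h1.1, fun v hv => h2 v (List.mem_append_left _ hv)⟩, h1.2.1,
      fun v hv => h2 v (List.mem_append_right _ hv)⟩
  rw [pairSum, hs.tsum_prod, pathSum]
  refine tsum_congr fun l => ?_
  by_cases hl : l.Nodup ∧ (∀ v ∈ l, v ∈ K) ∧ (x :: l).getLast? = some a.1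
  · rw [if_pos hl, ← pathSum_one hc, pathSum, ← tsum_mul_left]
    refine tsum_congr fun l' => ?_
    rw [mul_ite_zero]
    have : (l'.Nodup ∧ (∀ v ∈ l', v ∈ K \ l.toFinset) ∧ (y :: l').getLast? = some b.1) ↔
        (l ++ l').Nodup ∧ (∀ v ∈ l ++ l', v ∈ K) ∧ (x :: l).getLast? = some a.1 ∧
        (y :: l').getLast? = some b.1 := by
      simp only [List.nodup_append, List.mem_append, Finset.mem_sdiff, List.mem_toFinset]
      grind
    rw [if_congr this rfl rfl]
    split_ifs
    · rw [greenProd_append]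
      ring
    · rfl
  · refine (if_neg hl).trans (((tsum_congr fun l' => if_neg ?_).trans tsum_zero).symm)
    rintro ⟨h1, h2, h3, -⟩
    exact hl ⟨(List.nodup_append.1 h1).1, fun v hv => h2 v (List.mem_append_left _ hv), h3⟩

lemma pairSum_sub_pairSum (hc : IsWeight c) (K : Finset V) (x : V) (a : V × V) (y : V)
    (b : V × V) : pairSum c K x a y b - pairSum c K y a x b =
      exitKernel c K x a * exitKernel c K y b - exitKernel c K x b * exitKernel c K y a := by
  rw [← fomin_identity hc, pathSum_exitKernel hc, pathSum_exitKernel hc, pairSum_comm hc K y a]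

lemma infix_of_infix_excursion {l mid : List V} {x y : V} (h : l <:+: x :: (mid ++ [y]))
    (hl : l ≠ []) (hx : x ∉ l) (hy : y ∉ l) : l <:+: mid := by
  rcases List.infix_cons_iff.1 h with h | h
  · rcases l with - | ⟨z, l⟩
    · exact absurd rfl hl
    · rw [List.cons_prefix_cons] at h
      simp [h.1] at hx
  · rw [List.infix_concat_iff] at h
    rcases h with h | h
    · obtain ⟨t, ht⟩ := h
      rcases List.eq_nil_or_concat l with rfl | ⟨l', z, rfl⟩
      · exact absurd rfl hl
      · rw [List.concat_eq_append, ← List.append_assoc] at ht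
        have := (List.append_inj' ht rfl).2
        simp only [List.cons.injEq, and_true] at this
        simp [this] at hy
    · exact h

variable {A : Finset V} {a b : V × V}

lemma mem_sawsThrough (ha : a ∈ edgeBoundary A) (hb : b ∈ edgeBoundary A) {lam η : List V}
    (hlam : lam ≠ []) (hA : ∀ v ∈ lam, v ∈ A) : η ∈ sawsThrough A a b lam ↔
      ∃ mid, η = a.2 :: (mid ++ [b.2]) ∧ IsExcursion A a b mid ∧ mid.Nodup ∧ lam <:+: mid := by
  constructor
  · rintro ⟨⟨h1, h2⟩, h3⟩
    obtain ⟨mid, rfl, hexc⟩ := mem_excursions.1 h1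
    refine ⟨mid, rfl, hexc, by simpa using h2, infix_of_infix_excursion h3 hlam
      (fun h => ha.2.1 (hA _ h)) (fun h => hb.2.1 (hA _ h))⟩
  · rintro ⟨mid, rfl, h1, h2, h3⟩
    exact ⟨⟨mem_excursions.2 ⟨mid, rfl, h1⟩, by simpa using h2⟩,
      h3.trans ⟨[a.2], [b.2], by simp⟩⟩

lemma finite_sawsThrough (ha : a ∈ edgeBoundary A) (hb : b ∈ edgeBoundary A) {lam : List V}
    (hlam : lam ≠ []) (hA : ∀ v ∈ lam, v ∈ A) : (sawsThrough A a b lam).Finite := by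
  refine ((finite_nodup_lists A).image fun mid => a.2 :: (mid ++ [b.2])).subset fun η hη => ?_
  obtain ⟨mid, rfl, h1, h2, -⟩ := (mem_sawsThrough ha hb hlam hA).1 hη
  exact ⟨mid, ⟨h2, h1.subset⟩, rfl⟩

/-- Decomposition of the self-avoiding walks through `lam` into two walks started at its ends. -/
lemma tsum_sawsThrough (hc : IsWeight c) (ha : a ∈ edgeBoundary A) (hb : b ∈ edgeBoundary A)
    {lam : List V} {x₀ xk : V} (hA : ∀ v ∈ lam, v ∈ A) (hn : lam.Nodup)
    (h0 : lam.head? = some x₀) (hk : lam.getLast? = some xk) :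
    ∑' η : sawsThrough A a b lam, W c η * greenProd c A η.1.tail.dropLast =
      W c lam * greenProd c A lam * pairSum c (A \ lam.toFinset) x₀ a xk b := by
  have hne : lam ≠ [] := by rintro rfl; simp at h0
  obtain ⟨s, hs⟩ := List.getLast?_eq_some_iff.1 hk
  obtain ⟨t, ht⟩ : ∃ t, lam = x₀ :: t := by
    rcases lam with - | ⟨x, t⟩
    · simp at h0
    · exact ⟨t, by simpa using h0⟩
  set K := A \ lam.toFinset with hK
  rw [pairSum, ← tsum_mul_left]
  -- The arm to `a` is traversed backwards in the whole walk; this is where the symmetry of the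
  -- weight is needed.
  have hW : ∀ q : List V × List V, W c (a.2 :: (q.1.reverse ++ lam ++ q.2 ++ [b.2])) =
      W c lam * W c (x₀ :: (q.1 ++ [a.2])) * W c (xk :: (q.2 ++ [b.2])) := by
    intro q
    have e1 : a.2 :: (q.1.reverse ++ lam ++ q.2 ++ [b.2]) =
        (a.2 :: q.1.reverse) ++ x₀ :: (t ++ (q.2 ++ [b.2])) := by
      rw [ht]
      simp
    have e2 : x₀ :: (t ++ (q.2 ++ [b.2])) = s ++ xk :: (q.2 ++ [b.2]) := by
      rw [← List.cons_append, ← ht, hs]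
      simp
    have e3 : a.2 :: q.1.reverse ++ [x₀] = (x₀ :: (q.1 ++ [a.2])).reverse := by simp
    rw [e1, W_append_cons c (a.2 :: q.1.reverse) x₀, e2, W_append_cons c s xk, ← hs, e3,
      W_reverse hc.symm]
    ring
  have hcond : ∀ q : List V × List V, ((q.1 ++ q.2).Nodup ∧ (∀ v ∈ q.1 ++ q.2, v ∈ K) ∧
      (x₀ :: q.1).getLast? = some a.1 ∧ (xk :: q.2).getLast? = some b.1) ↔
      (q.1.reverse ++ lam ++ q.2).Nodup ∧ (∀ v ∈ q.1.reverse ++ lam ++ q.2, v ∈ A) ∧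
      (q.1.reverse ++ lam ++ q.2).head? = some a.1 ∧
      (q.1.reverse ++ lam ++ q.2).getLast? = some b.1 := by
    intro q
    have e1 : (q.1.reverse ++ lam ++ q.2).head? = (x₀ :: q.1).getLast? := by
      rw [ht, List.append_assoc, List.cons_append, head?_append_cons,
        show q.1.reverse ++ [x₀] = (x₀ :: q.1).reverse by simp, List.head?_reverse]
    have e2 : (q.1.reverse ++ lam ++ q.2).getLast? = (xk :: q.2).getLast? := by
      rw [hs, List.append_assoc, List.append_assoc, List.singleton_append, ← List.append_assoc,
        List.getLast?_append_cons]
    rw [e1, e2]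
    simp only [List.nodup_append, List.mem_append, List.mem_reverse, List.nodup_reverse, hK,
      Finset.mem_sdiff, List.mem_toFinset, hn, true_and]
    constructor
    · rintro ⟨⟨n1, n2, d⟩, m, h1, h2⟩
      refine ⟨⟨⟨n1, fun u hu v hv e => (m u (.inl hu)).2 (e ▸ hv)⟩, n2, ?_⟩, ?_, h1, h2⟩
      · rintro u (hu | hu) v hv e
        · exact d u hu v hv e
        · exact (m v (.inr hv)).2 (e ▸ hu)
      · rintro v ((hv | hv) | hv)
        exacts [(m v (.inl hv)).1, hA v hv, (m v (.inr hv)).1]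
    · rintro ⟨⟨⟨n1, d1⟩, n2, d2⟩, m, h1, h2⟩
      refine ⟨⟨n1, n2, fun u hu v hv => d2 u (.inl hu) v hv⟩, ?_, h1, h2⟩
      rintro v (hv | hv)
      · exact ⟨m v (.inl (.inl hv)), fun h => d1 v hv v h rfl⟩
      · exact ⟨m v (.inr hv), fun h => d2 v (.inr h) v hv rfl⟩
  -- Reordering so that `lam` comes first: its factors are taken in `A`, those of the arms in `K`.
  have hgreen : ∀ q : List V × List V, (q.1.reverse ++ lam ++ q.2).Nodup →
      (∀ v ∈ q.1.reverse ++ lam ++ q.2, v ∈ A) →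
      greenProd c A (q.1.reverse ++ lam ++ q.2) =
        greenProd c A lam * greenProd c K (q.1 ++ q.2) := by
    intro q h1 h2
    rw [hK, ← greenProd_append]
    refine greenProd_perm hc ?_ h1 h2
    rw [← List.append_assoc]
    refine List.Perm.append_right _ (List.perm_append_comm.trans ?_)
    exact List.Perm.append_left _ (List.reverse_perm _)
  have hterm : ∀ q : List V × List V, (q.1.reverse ++ lam ++ q.2).Nodup →
      (∀ v ∈ q.1.reverse ++ lam ++ q.2, v ∈ A) →
      W c (a.2 :: (q.1.reverse ++ lam ++ q.2 ++ [b.2])) *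
        greenProd c A (a.2 :: (q.1.reverse ++ lam ++ q.2 ++ [b.2])).tail.dropLast =
      W c lam * greenProd c A lam * (W c (x₀ :: (q.1 ++ [a.2])) *
        W c (xk :: (q.2 ++ [b.2])) * greenProd c K (q.1 ++ q.2)) := by
    intro q h1 h2
    rw [List.tail_cons, List.dropLast_concat, hW, hgreen q h1 h2]
    ring
  have hsupp : ∀ q : Function.support fun q : List V × List V => W c lam * greenProd c A lam *
      (if (q.1 ++ q.2).Nodup ∧ (∀ v ∈ q.1 ++ q.2, v ∈ K) ∧
        (x₀ :: q.1).getLast? = some a.1 ∧ (xk :: q.2).getLast? = some b.1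
      then W c (x₀ :: (q.1 ++ [a.2])) * W c (xk :: (q.2 ++ [b.2])) * greenProd c K (q.1 ++ q.2)
      else 0), (q.1.1.reverse ++ lam ++ q.1.2).Nodup ∧
        IsExcursion A a b (q.1.1.reverse ++ lam ++ q.1.2) := by
    rintro ⟨q, hq⟩
    rw [Function.mem_support, mul_ite_zero, ite_ne_right_iff, hcond] at hq
    obtain ⟨⟨h1, h2, h3, h4⟩, h5⟩ := hq
    refine ⟨h1, ?_, h2, h3, h4⟩
    by_contra hch
    rw [← hterm q h1 h2, W_eq_zero_of_not_isChain hc _ hch, zero_mul] at h5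
    exact h5 rfl
  refine tsum_eq_tsum_of_ne_zero_bij (fun q => ⟨a.2 :: (q.1.1.reverse ++ lam ++ q.1.2 ++ [b.2]),
    (mem_sawsThrough ha hb hne hA).2 ⟨_, rfl, (hsupp q).2, (hsupp q).1, ⟨_, _, rfl⟩⟩⟩) ?_ ?_ ?_
  · intro q q' h
    have h1 := injective_excursion a b (congrArg Subtype.val h)
    -- `x₀` occurs only once, so the place of `lam` in the walk, and with it the pair of arms, can
    -- be recovered.
    have hx : ∀ q : List V × List V, (q.1.reverse ++ lam ++ q.2).Nodup → x₀ ∉ t ++ q.2 := by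
      intro q hq
      rw [ht, List.append_assoc, List.cons_append, List.nodup_middle, List.nodup_cons] at hq
      exact fun h => hq.1 (List.mem_append_right _ h)
    have h2 := hx _ (hsupp q).1
    have h3 := hx _ (hsupp q').1
    simp only [ht, List.append_assoc, List.cons_append] at h1
    obtain ⟨h4, h5⟩ := append_cons_inj_of_not_mem h1 h2 h3
    exact Subtype.ext (Prod.ext (List.reverse_injective h4) (List.append_cancel_left h5))
  · intro η hη
    obtain ⟨η, hη'⟩ := η
    obtain ⟨mid, rfl, h1, h2, P, S, rfl⟩ := (mem_sawsThrough ha hb hne hA).1 hη'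
    have hq : P = P.reverse.reverse := (List.reverse_reverse P).symm
    rw [hq] at h1 h2
    refine ⟨⟨(P.reverse, S), ?_⟩, ?_⟩
    · rw [Function.mem_support] at hη ⊢
      rw [if_pos ((hcond (P.reverse, S)).2 ⟨h2, h1.subset, h1.head, h1.last⟩),
        ← hterm (P.reverse, S) h2 h1.subset]
      simpa using hη
    · simp
  · intro q
    obtain ⟨h1, h2⟩ := hsupp q
    rw [if_pos ((hcond q.1).2 ⟨h1, h2.subset, h2.head, h2.last⟩), ← hterm q.1 h1 h2.subset]

end LERW

namespace LERW

/-! ### Signs of self-avoiding walks -/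

variable {A : Finset V} {a b : V × V}

lemma loopMeasure_oddLoops (A : Finset V) :
    loopMeasure p (oddLoops A) = loopSum srwWeight A fun u => OddWinding (closeUp u) := by
  refine loopMeasure_eq_loopSum isWeight_srwWeight (P := OddWinding)
    (fun ℓ h _ => p_eq_W h.1.2) fun ℓ ℓ' _ _ he _ h => ?_
  obtain ⟨k, hk⟩ := h
  refine ⟨k, ?_⟩
  rw [← hk, totalTurn, totalTurn]
  exact (((unroot_eq_perm he).map _).sum_eq).symm

/-- Passing from the random walk weight to the sign weight in the loop term. -/
lemma IsExcursion.greenProd_eq (hA : IsLatticeDomain (A : Set V)) (ha : a ∈ edgeBoundary A)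
    {mid : List V} (h : IsExcursion A a b mid) (hn : mid.Nodup) (h0 : ((0, 0) : V) ∈ mid) :
    greenProd srwWeight A mid =
      Real.exp (2 * loopMeasure p (oddLoops A)) * greenProd signWeight A mid := by
  classical
  rw [← exp_loopSum_meets isWeight_srwWeight hn h.subset,
    ← exp_loopSum_meets isWeight_signWeight hn h.subset, ← Real.exp_add, loopMeasure_oddLoops]
  congr 1
  unfold loopSum
  rw [← tsum_mul_left, ← ((summable_loopSum isWeight_srwWeight A _).mul_left 2).tsum_add
    (summable_loopSum isWeight_signWeight A _)]
  refine tsum_congr fun u => ?_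
  by_cases hu : ∀ v ∈ u, v ∈ A
  swap
  · rw [if_neg fun h => hu h.1, if_neg fun h => hu h.1, if_neg fun h => hu h.1, mul_zero, add_zero]
  by_cases hch : (closeUp u).IsChain Nbr
  swap
  · simp [W_eq_zero_of_not_isChain isWeight_srwWeight _ hch,
      W_eq_zero_of_not_isChain isWeight_signWeight _ hch]
  rcases u with - | ⟨x, u⟩
  -- The empty list has weight 1 divided by length 0, which is 0.
  · simp
  have hcl := (isLoop_closeUp hch).isClosedWalk
  have hodd := hcl.oddWinding_iff
  rcases Int.even_or_odd (wind (closeUp (x :: u)) (0, 0)) with hw | hw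
  · have : ¬ OddWinding (closeUp (x :: u)) := by
      rw [hodd, Int.not_odd_iff_even]
      exact hw
    rw [if_neg (c := _ ∧ OddWinding _) fun h => this h.2, W_signWeight, hw.neg_one_zpow, one_mul,
      mul_zero, zero_add]
  -- An odd loop necessarily meets the walk, so it is counted in all three sums, where its mass t
  -- satisfies t = 2t + (−t). Even loops have the same mass under both weights.
  · have hm : ∃ z ∈ x :: u, z ∈ mid := by
      obtain ⟨z, hz, hz'⟩ := hcl.exists_mem_of_wind_ne_zero hA ha h h0
        (fun v hv => hu v (mem_closeUp.1 hv)) (fun e => by rw [e] at hw; exact Int.not_odd_zero hw)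
      exact ⟨z, mem_closeUp.1 hz, hz'⟩
    rw [if_pos ⟨hu, hm⟩, if_pos ⟨hu, hodd.2 hw⟩, if_pos ⟨hu, hm⟩, W_signWeight, hw.neg_one_zpow]
    ring

/-- One integer `s`, depending only on `a` and `b`, serves both directions of the edge; the value 0
is taken when there is no such walk. -/
lemma exists_wind_eq (hA : IsLatticeDomain (A : Set V)) (ha : a ∈ edgeBoundary A)
    (hb : b ∈ edgeBoundary A) : ∃ s : ℤ, ∀ (d : ℤ) (mid : List V), IsExcursion A a b mid →
      mid.Nodup → UsesEdge d mid → wind (a.2 :: (mid ++ [b.2])) (0, 0) = s + d := by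
  by_cases h : ∃ (d : ℤ) (mid : List V), IsExcursion A a b mid ∧ mid.Nodup ∧ UsesEdge d mid
  · obtain ⟨d, mid, h1, h2, h3⟩ := h
    refine ⟨wind (a.2 :: (mid ++ [b.2])) (0, 0) - d, fun d' mid' h1' h2' h3' => ?_⟩
    have := wind_saw_sub_eq hA ha hb h1 h1' h2 h2' h3 h3'
    omega
  · push Not at h
    exact ⟨0, fun d mid h1 h2 h3 => absurd h3 (h d mid h1 h2)⟩

lemma UsesEdge.zero_mem {d : ℤ} {l : List V} (h : UsesEdge d l) : ((0, 0) : V) ∈ l := by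
  rcases h with ⟨-, h⟩ | ⟨-, h⟩ <;> exact h.subset (by simp)

/-- The total mass of the self-avoiding walks through `lam`. -/
lemma tsum_pHat (ha : a ∈ edgeBoundary A) (hb : b ∈ edgeBoundary A)
    {lam : List V} {x₀ xk : V} (hlA : ∀ v ∈ lam, v ∈ A) (hn : lam.Nodup)
    (h0 : lam.head? = some x₀) (hk : lam.getLast? = some xk) :
    ∑' η : sawsThrough A a b lam, pHat A a b η = W srwWeight lam * greenProd srwWeight A lam *
      pairSum srwWeight (A \ lam.toFinset) x₀ a xk b := by
  rw [← tsum_sawsThrough isWeight_srwWeight ha hb hlA hn h0 hk]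
  refine tsum_congr fun η => ?_
  obtain ⟨η, hη⟩ := η
  obtain ⟨mid, rfl, h1, h2, -⟩ := (mem_sawsThrough ha hb (by rintro rfl; simp at h0) hlA).1 hη
  rw [pHat_eq h1 h2]
  simp

/-- The same mass in terms of the sign weight. -/
lemma tsum_pHat_eq_sign (hA : IsLatticeDomain (A : Set V)) (ha : a ∈ edgeBoundary A)
    (hb : b ∈ edgeBoundary A) {lam : List V} {x₀ xk : V} (hlA : ∀ v ∈ lam, v ∈ A)
    (hn : lam.Nodup) (h0 : lam.head? = some x₀) (hk : lam.getLast? = some xk) {s d : ℤ}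
    (hs : ∀ mid : List V, IsExcursion A a b mid → mid.Nodup → UsesEdge d mid →
      wind (a.2 :: (mid ++ [b.2])) (0, 0) = s + d) (hd : UsesEdge d lam) :
    (-1) ^ (s + d) * ∑' η : sawsThrough A a b lam, pHat A a b η =
      Real.exp (2 * loopMeasure p (oddLoops A)) * (W signWeight lam *
        greenProd signWeight A lam * pairSum signWeight (A \ lam.toFinset) x₀ a xk b) := by
  rw [← tsum_sawsThrough isWeight_signWeight ha hb hlA hn h0 hk, ← tsum_mul_left, ← tsum_mul_left]
  refine tsum_congr fun η => ?_
  obtain ⟨η, hη⟩ := η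
  obtain ⟨mid, rfl, h1, h2, h3⟩ := (mem_sawsThrough ha hb (by rintro rfl; simp at h0) hlA).1 hη
  have hmid : UsesEdge d mid := hd.imp (.imp id (·.trans h3)) (.imp id (·.trans h3))
  rw [pHat_eq h1 h2, List.tail_cons, List.dropLast_concat, W_signWeight, hs mid h1 h2 hmid,
    h1.greenProd_eq hA ha h2 hmid.zero_mem]
  ring

lemma pHat_nonneg (A : Set V) (a b : V × V) (η : List V) : 0 ≤ pHat A a b η :=
  tsum_nonneg fun _ => by unfold p; positivity

lemma head?_reverse_of {l : List V} {x : V} (h : l.getLast? = some x) :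
    l.reverse.head? = some x := by rw [List.head?_reverse, h]

lemma abs_W_signWeight (l : List V) : |W signWeight l| = W srwWeight l := by
  rw [W_signWeight, abs_mul, abs_zpow, abs_neg, abs_one, one_zpow, one_mul,
    abs_of_nonneg (W_srwWeight_nonneg l)]

lemma usesEdge_reverse {l : List V} (h : [((0, 0) : V), (1, 0)] <:+: l) :
    UsesEdge 1 l.reverse := .inr ⟨rfl, List.reverse_infix.2 h⟩

/-- The Fomin determinant for the extended kernels. -/
noncomputable def exitDet (c : V → V → ℝ) (K : Finset V) (x y : V) (a b : V × V) : ℝ :=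
  exitKernel c K x a * exitKernel c K y b - exitKernel c K x b * exitKernel c K y a

variable {lam : List V} {x₀ xk : V}

/-- Reversing `lam` exchanges its endpoints and changes neither its weight nor its loop term, so the
difference is that of the two pairings in Fomin's identity. -/
lemma tsum_pHat_sub (ha : a ∈ edgeBoundary A) (hb : b ∈ edgeBoundary A)
    (hlA : ∀ v ∈ lam, v ∈ A)
    (hn : lam.Nodup) (h0 : lam.head? = some x₀) (hk : lam.getLast? = some xk) :
    ∑' η : sawsThrough A a b lam, pHat A a b η -
      ∑' η : sawsThrough A a b lam.reverse, pHat A a b η =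
    W srwWeight lam * greenProd srwWeight A lam *
      exitDet srwWeight (A \ lam.toFinset) x₀ xk a b := by
  rw [tsum_pHat ha hb hlA hn h0 hk, tsum_pHat ha hb (lam := lam.reverse)
    (by simpa using hlA) (List.nodup_reverse.2 hn) (head?_reverse_of hk)
    (by rw [List.getLast?_reverse, h0]), W_reverse isWeight_srwWeight.symm,
    ← greenProd_perm isWeight_srwWeight (List.reverse_perm lam).symm hn hlA,
    List.toFinset_reverse, exitDet, ← pairSum_sub_pairSum isWeight_srwWeight]
  ring

/-- For the sign weight the walks through the reversed edge carry an additional −1, which turns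
Fomin's difference into a sum. The global sign from `s` is unknown, but the sum is nonnegative, so
absolute values remove it. -/
lemma tsum_pHat_add (hA : IsLatticeDomain (A : Set V)) (ha : a ∈ edgeBoundary A)
    (hb : b ∈ edgeBoundary A) (hlA : ∀ v ∈ lam, v ∈ A) (hn : lam.Nodup)
    (h0 : lam.head? = some x₀) (hk : lam.getLast? = some xk)
    (hedge : [((0, 0) : V), (1, 0)] <:+: lam) :
    ∑' η : sawsThrough A a b lam, pHat A a b η +
      ∑' η : sawsThrough A a b lam.reverse, pHat A a b η =
    W srwWeight lam * Real.exp (2 * loopMeasure p (oddLoops A)) * greenProd signWeight A lam *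
      |exitDet signWeight (A \ lam.toFinset) x₀ xk a b| := by
  obtain ⟨s, hs⟩ := exists_wind_eq hA ha hb
  have e1 := tsum_pHat_eq_sign hA ha hb hlA hn h0 hk (hs 0) (.inl ⟨rfl, hedge⟩)
  have e2 := tsum_pHat_eq_sign hA ha hb (lam := lam.reverse)
    (by simpa using hlA) (List.nodup_reverse.2 hn) (head?_reverse_of hk)
    (by rw [List.getLast?_reverse, h0]) (hs 1) (usesEdge_reverse hedge)
  rw [W_reverse isWeight_signWeight.symm,
    ← greenProd_perm isWeight_signWeight (List.reverse_perm lam).symm hn hlA,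
    List.toFinset_reverse] at e2
  rw [add_zero] at e1
  rw [zpow_add₀ (by norm_num), zpow_one] at e2
  set Sp := ∑' η : sawsThrough A a b lam, pHat A a b η
  set Sm := ∑' η : sawsThrough A a b lam.reverse, pHat A a b η
  have hpos : 0 ≤ Sp + Sm :=
    add_nonneg (tsum_nonneg fun _ => pHat_nonneg _ _ _ _) (tsum_nonneg fun _ => pHat_nonneg _ _ _ _)
  have hg : 0 < greenProd signWeight A lam := by
    rw [← exp_loopSum_meets isWeight_signWeight hn hlA]
    exact Real.exp_pos _
  have e3 : (-1) ^ s * (Sp + Sm) = Real.exp (2 * loopMeasure p (oddLoops A)) * (W signWeight lam *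
      greenProd signWeight A lam * exitDet signWeight (A \ lam.toFinset) x₀ xk a b) := by
    rw [exitDet, ← pairSum_sub_pairSum isWeight_signWeight]
    linear_combination e1 - e2
  have e4 := congrArg abs e3
  rw [abs_mul, abs_zpow, abs_neg, abs_one, one_zpow, one_mul, abs_of_nonneg hpos, abs_mul,
    abs_mul, abs_mul, Real.abs_exp, abs_W_signWeight, abs_of_pos hg] at e4
  rw [e4]
  ring

/-- The two sets are disjoint: a self-avoiding walk using both directions of [0,1] would, compared
with itself, have its winding equal to its winding minus 1. -/
lemma tsum_pHat_union (hA : IsLatticeDomain (A : Set V)) (ha : a ∈ edgeBoundary A)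
    (hb : b ∈ edgeBoundary A) (hlA : ∀ v ∈ lam, v ∈ A)
    (hedge : [((0, 0) : V), (1, 0)] <:+: lam) :
    ∑' η : ↥(sawsThrough A a b lam ∪ sawsThrough A a b lam.reverse), pHat A a b η =
      ∑' η : sawsThrough A a b lam, pHat A a b η +
      ∑' η : sawsThrough A a b lam.reverse, pHat A a b η := by
  have hne : lam ≠ [] := by rintro rfl; simp at hedge
  have hne' : lam.reverse ≠ [] := by simpa using hne
  have hlA' : ∀ v ∈ lam.reverse, v ∈ A := by simpa using hlA
  have := (finite_sawsThrough ha hb hne hlA).to_subtype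
  have := (finite_sawsThrough ha hb hne' hlA').to_subtype
  refine Summable.tsum_union_disjoint (f := pHat A a b) ?_ .of_finite .of_finite
  rw [Set.disjoint_left]
  intro η h h'
  obtain ⟨mid, rfl, h1, h2, h3⟩ := (mem_sawsThrough ha hb hne hlA).1 h
  obtain ⟨mid', he, -, -, h3'⟩ := (mem_sawsThrough ha hb hne' hlA').1 h'
  obtain rfl := injective_excursion a b he
  have := wind_saw_sub_eq hA ha hb h1 h1 h2 h2 (.inl ⟨rfl, hedge.trans h3⟩)
    (.inr ⟨rfl, (List.reverse_infix.2 hedge).trans h3'⟩)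
  omega

end LERW

namespace LERW

/-! ### Loop-erased random walk through the edge `[0, 1]` -/

variable {A : Finset V} {a b : V × V}

lemma loopErase_subset (l : List V) : ∀ v ∈ loopErase l, v ∈ l := by
  induction l using loopErase_induction with
  | nil => simp [loopErase]
  | append x s t ht hs ih =>
    rw [loopErase_append_cons ht hs]
    intro v hv
    rcases List.mem_cons.1 hv with rfl | hv
    · simp
    · simp [ih v hv]

lemma nodup_loopErase (l : List V) : (loopErase l).Nodup := by
  induction l using loopErase_induction with
  | nil => simp [loopErase]
  | append x s t ht hs ih =>
    rw [loopErase_append_cons ht hs, List.nodup_cons]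
    exact ⟨fun h => ht (loopErase_subset t _ h), ih⟩

/-- The preceding vertex `y` and the end `e` are carried along so that the induction sees the steps
joining the pieces that survive. -/
lemma isChain_loopErase {R : V → V → Prop} (e : V) (l : List V) :
    ∀ y, (y :: (l ++ [e])).IsChain R → (y :: (loopErase l ++ [e])).IsChain R := by
  induction l using loopErase_induction with
  | nil => simp [loopErase]
  | append x s t ht hs ih =>
    intro y h
    rw [loopErase_append_cons ht hs, List.cons_append, List.isChain_cons_cons]
    refine ⟨?_, ih x (h.suffix ⟨y :: s, by simp⟩)⟩
    rcases s with - | ⟨z, s⟩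
    · exact (List.isChain_cons_cons.1 h).1
    · obtain rfl : z = x := by simpa using hs
      exact (List.isChain_cons_cons.1 h).1

lemma IsExcursion.loopErase {A : Set V} {mid : List V} (h : IsExcursion A a b mid) :
    IsExcursion A a b (loopErase mid) :=
  ⟨isChain_loopErase _ _ _ h.chain, fun v hv => h.subset v (loopErase_subset _ v hv),
    by rw [head?_loopErase, h.head], by rw [getLast?_loopErase, h.last]⟩

lemma excursionErase_mem_saws {A : Set V} {ω : List V} (h : ω ∈ excursions A a b) :
    excursionErase ω ∈ saws A a b := by
  obtain ⟨mid, rfl, hexc⟩ := mem_excursions.1 h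
  rw [excursionErase_cons]
  refine ⟨mem_excursions.2 ⟨_, rfl, hexc.loopErase⟩, ?_⟩
  rw [List.tail_cons, List.dropLast_concat]
  exact nodup_loopErase mid

lemma summable_p_of_subset {B : Finset V} {S : Set (List V)}
    (h : ∀ ω ∈ S, ω.IsChain Nbr ∧ ∀ v ∈ ω, v ∈ B) : Summable fun ω : S => p ω :=
  summable_of_abs_le_W isWeight_srwWeight B Subtype.val_injective fun ω _ =>
    ⟨(h ω ω.2).2, by rw [p_eq_W (h ω ω.2).1]⟩

lemma summable_p_excursions (A : Finset V) (a b : V × V) :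
    Summable fun ω : excursions A a b => p ω := by
  refine summable_p_of_subset (B := insert a.2 (insert b.2 A)) fun ω hω => ?_
  obtain ⟨mid, rfl, h⟩ := mem_excursions.1 hω
  refine ⟨h.chain, fun v hv => ?_⟩
  have := h.subset v
  simp only [List.mem_cons, List.mem_append, List.not_mem_nil, or_false] at hv
  simp only [Finset.mem_insert]
  tauto

lemma edgeKernel_pos (hA : IsLatticeDomain (A : Set V)) (ha : a ∈ edgeBoundary A)
    (hb : b ∈ edgeBoundary A) : 0 < edgeKernel A a b := by
  obtain ⟨m, h1, h2, h3⟩ := exists_isChain_of_connected hA.connected ha.1 hb.1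
  have hexc : IsExcursion (A : Set V) a b (a.1 :: m) := by
    refine ⟨?_, h2, rfl, h3⟩
    obtain ⟨s, hs⟩ := List.getLast?_eq_some_iff.1 h3
    rw [List.cons_append, List.isChain_cons_cons]
    refine ⟨ha.2.2.symm, ?_⟩
    rw [← List.cons_append]
    refine List.isChain_append.2 ⟨h1, by simp, ?_⟩
    intro x hx y hy
    rw [h3, Option.mem_some] at hx
    obtain rfl : b.2 = y := by simpa using hy
    subst hx
    exact hb.2.2
  refine (summable_p_excursions A a b).tsum_pos (fun _ => by unfold p; positivity)
    ⟨_, mem_excursions.2 ⟨_, rfl, hexc⟩⟩ ?_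
  unfold p
  positivity

/-- Whether the edge is used depends only on the loop erasure, so the walks are grouped by it. -/
lemma edgeKernelStar_eq (A : Finset V) (a b : V × V) : edgeKernelStar A a b =
    ∑' η : ↥(sawsThrough A a b [(0, 0), (1, 0)] ∪ sawsThrough A a b [(0, 0), (1, 0)].reverse),
      pHat A a b η := by
  set S := sawsThrough A a b [(0, 0), (1, 0)] ∪ sawsThrough A a b [(0, 0), (1, 0)].reverse with hS
  let T : Set (List V) := {ω | ω ∈ excursions A a b ∧ ([(0, 0), (1, 0)] <:+: excursionErase ω ∨
    [(1, 0), (0, 0)] <:+: excursionErase ω)}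
  have hT : ∀ ω : T, excursionErase ω ∈ S := fun ω => by
    have := excursionErase_mem_saws ω.2.1
    exact ω.2.2.imp (fun h => ⟨this, h⟩) (fun h => ⟨this, h⟩)
  let e : (Σ η : S, {ω : List V // ω ∈ excursions A a b ∧ excursionErase ω = η}) ≃ T :=
    { toFun := fun q => ⟨q.2.1, q.2.2.1, by
        rw [q.2.2.2]
        exact q.1.2.imp (fun h => h.2) (fun h => h.2)⟩
      invFun := fun ω => ⟨⟨excursionErase ω, hT ω⟩, ⟨ω.1, ω.2.1, rfl⟩⟩
      left_inv := by
        rintro ⟨⟨η, hη⟩, ⟨ω, h1, h2⟩⟩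
        change excursionErase ω = η at h2
        subst h2
        rfl
      right_inv := fun _ => rfl }
  have hs : Summable fun ω : T => p ω :=
    (summable_p_excursions A a b).comp_injective
      (i := fun ω : T => (⟨ω.1, ω.2.1⟩ : excursions A a b)) fun ω ω' h => by
        simpa [Subtype.ext_iff] using h
  change ∑' ω : T, p ω = _
  rw [← e.tsum_eq]
  exact (e.summable_iff.2 hs).tsum_sigma

/-! ### The distance to the boundary -/

lemma toC_mem_domainD {A : Set V} {v : V} (hv : v ∈ A) : toC v ∈ domainD A := by
  refine mem_domainD_of_box (a := v.1 - 1 / 2) (b := v.1 + 1 / 2) (c := v.2 - 1 / 2)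
    (d := v.2 + 1 / 2) ?_ fun z hz => ⟨v, hv, mem_square.2 ?_⟩
  · simp [toC]
  · exact ⟨⟨hz.1.1.le, hz.1.2.le⟩, hz.2.1.le, hz.2.2.le⟩

/-- As `lam` contains 0 and 1, its diameter is at least 1. If it touched a boundary edge, ∂D_A would
be within diam + 3/5 of 0, which is less than 2 diam. Thus `lam` has no exit in one step, which
makes the kernels of the statement equal to `exitKernel`. -/
lemma not_mem_of_two_mul_diam_le {A : Set V} {lam : List V} (h0 : ((0, 0) : V) ∈ lam)
    (h1 : ((1, 0) : V) ∈ lam)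
    (hd : 2 * Metric.diam (toC '' {z | z ∈ lam}) ≤ Metric.infDist 0 (frontier (domainD A)))
    {c : V × V} (hc : c ∈ edgeBoundary A) : c.1 ∉ lam := by
  intro hlam
  have hbdd : Bornology.IsBounded (toC '' {z | z ∈ lam}) :=
    ((List.finite_toSet lam).image toC).isBounded
  have e0 : toC (0, 0) = 0 := by simp [toC]
  have e1 : (1 : ℝ) ≤ Metric.diam (toC '' {z | z ∈ lam}) := by
    have := Metric.dist_le_diam_of_mem hbdd ⟨_, h0, rfl⟩ ⟨_, h1, rfl⟩
    simpa [toC] using this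
  have e2 : dist 0 (toC c.1) ≤ Metric.diam (toC '' {z | z ∈ lam}) := by
    have := Metric.dist_le_diam_of_mem hbdd ⟨_, h0, rfl⟩ ⟨_, hlam, rfl⟩
    rwa [e0] at this
  -- Any number strictly between 1/2 and 1 would do: the point is past the midpoint, hence only in
  -- the square of `c.2`, yet closer than 1 to `c.1`.
  set w : ℂ := toC c.1 + (3 / 5 : ℝ) * (toC c.2 - toC c.1) with hw
  have hnorm : ‖toC c.2 - toC c.1‖ = 1 := by
    rcases nbr_iff.1 hc.2.2 with h | h | h | h <;> rw [h] <;> simp [toC, add_mul, sub_mul]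
  have hwD : w ∉ domainD A := by
    intro h
    obtain ⟨v, hv, hwv⟩ := Set.mem_iUnion₂.1 (interior_subset h)
    rw [mem_square] at hwv
    refine hc.2.1 ?_
    suffices v = c.2 from this ▸ hv
    have key : ∀ i j : ℤ, (i : ℝ) < j + 1 → (j : ℝ) < i + 1 → i = j := by
      intro i j h1 h2
      have h1' : i < j + 1 := by exact_mod_cast h1
      have h2' : j < i + 1 := by exact_mod_cast h2
      omega
    obtain ⟨⟨h1, h2⟩, h3, h4⟩ := hwv
    rcases nbr_iff.1 hc.2.2 with h | h | h | h <;>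
    · rw [hw, h] at h1 h2 h3 h4
      simp [toC] at h1 h2 h3 h4
      rw [h]
      refine Prod.ext (key _ _ ?_ ?_) (key _ _ ?_ ?_) <;> push_cast <;> linarith
  obtain ⟨u, hu, huf⟩ : (segment ℝ (toC c.1) w ∩ frontier (domainD A)).Nonempty := by
    by_contra hne
    have hfr : ∀ u ∈ segment ℝ (toC c.1) w, u ∈ closure (domainD A) → u ∈ domainD A :=
      fun u hu h => by_contra fun h' =>
        hne ⟨u, hu, h, fun h'' => h' (interior_subset h'')⟩
    obtain ⟨u, -, h1, h2⟩ := (convex_segment (𝕜 := ℝ) (toC c.1) w).isPreconnected (domainD A)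
      (closure (domainD A))ᶜ isOpen_interior isClosed_closure.isOpen_compl
      (fun u hu => or_iff_not_imp_left.2 fun h h' => h (hfr u hu h'))
      ⟨_, left_mem_segment _ _ _, toC_mem_domainD hc.1⟩
      ⟨_, right_mem_segment _ _ _, fun h => hwD (hfr _ (right_mem_segment _ _ _) h)⟩
    exact h2 (subset_closure h1)
  have e3 : dist (toC c.1) u ≤ 3 / 5 := by
    have h1 := dist_add_dist_of_mem_segment hu
    have h2 : dist (toC c.1) w = 3 / 5 := by
      rw [dist_comm, dist_eq_norm, hw, add_sub_cancel_left, norm_mul, hnorm]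
      norm_num
    have := dist_nonneg (x := u) (y := w)
    linarith
  have e4 := Metric.infDist_le_dist_of_mem (x := (0 : ℂ)) huf
  have e5 := dist_triangle 0 (toC c.1) u
  linarith

end LERW

namespace LERW

/-! ### Simple random walk -/

open MeasureTheory

lemma unitStep_injective : Function.Injective unitStep := by decide

lemma exists_unitStep {z y : V} (h : Nbr z y) : ∃ k, y = z + unitStep k := by
  rcases nbr_iff.1 h with h | h | h | h
  · exact ⟨0, by rw [h]; ext <;> simp [unitStep]⟩
  · exact ⟨1, by rw [h]; ext <;> simp [unitStep, sub_eq_add_neg]⟩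
  · exact ⟨2, by rw [h]; ext <;> simp [unitStep]⟩
  · exact ⟨3, by rw [h]; ext <;> simp [unitStep, sub_eq_add_neg]⟩

lemma nbr_add_unitStep (z : V) (k : Fin 4) : Nbr z (z + unitStep k) := by
  rw [nbr_iff]
  fin_cases k <;> simp [unitStep, Prod.ext_iff, sub_eq_add_neg]

lemma srw_add_one (z : V) (ξ : ℕ → Fin 4) (n : ℕ) : srw z ξ (n + 1) = srw z ξ n + unitStep (ξ n) := by
  rw [srw, srw, Finset.sum_range_succ, add_assoc]

lemma srw_zero (z : V) (ξ : ℕ → Fin 4) : srw z ξ 0 = z := by simp [srw]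

lemma srw_add_one' (z : V) (ξ : ℕ → Fin 4) (n : ℕ) :
    srw z ξ (n + 1) = srw (z + unitStep (ξ 0)) (fun j => ξ (j + 1)) n := by
  rw [srw, srw, Finset.sum_range_succ', add_assoc, add_comm (unitStep (ξ 0))]

/-- The path `[S_0, …, S_n]`. -/
def srwPath (z : V) (ξ : ℕ → Fin 4) (n : ℕ) : List V := (List.range (n + 1)).map (srw z ξ)

lemma length_srwPath (z : V) (ξ : ℕ → Fin 4) (n : ℕ) : (srwPath z ξ n).length = n + 1 := by
  simp [srwPath]

lemma mem_srwPath {z : V} {ξ : ℕ → Fin 4} {n : ℕ} {v : V} :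
    v ∈ srwPath z ξ n ↔ ∃ j ≤ n, srw z ξ j = v := by
  simp [srwPath]

lemma srwPath_succ (z : V) (ξ : ℕ → Fin 4) (n : ℕ) :
    srwPath z ξ (n + 1) = srwPath z ξ n ++ [srw z ξ (n + 1)] := by
  rw [srwPath, List.range_succ, List.map_append]
  rfl

lemma getLast?_srwPath (z : V) (ξ : ℕ → Fin 4) (n : ℕ) :
    (srwPath z ξ n).getLast? = some (srw z ξ n) := by
  cases n with
  | zero => simp [srwPath]
  | succ n => rw [srwPath_succ, List.getLast?_concat]

lemma srwPath_eq_cons (z : V) (ξ : ℕ → Fin 4) (n : ℕ) :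
    srwPath z ξ n = z :: (List.range n).map fun j => srw z ξ (j + 1) := by
  rw [srwPath, List.range_succ_eq_map, List.map_cons, List.map_map, srw_zero]
  rfl

lemma isChain_srwPath (z : V) (ξ : ℕ → Fin 4) (n : ℕ) : (srwPath z ξ n).IsChain Nbr := by
  induction n with
  | zero => simp [srwPath]
  | succ n ih =>
    rw [srwPath_succ, List.isChain_append]
    refine ⟨ih, by simp, fun x hx y hy => ?_⟩
    rw [getLast?_srwPath, Option.mem_some] at hx
    obtain rfl : srw z ξ (n + 1) = y := by simpa using hy
    rw [← hx, srw_add_one]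
    exact nbr_add_unitStep _ _

lemma srwPath_eq_iff (z : V) (ξ u : ℕ → Fin 4) (n : ℕ) :
    srwPath z ξ n = srwPath z u n ↔ ∀ j < n, ξ j = u j := by
  rw [srwPath, srwPath, List.map_inj_left]
  simp only [List.mem_range, Nat.lt_succ_iff]
  constructor
  · intro h j hj
    have h1 := h (j + 1) hj
    rw [srw_add_one, srw_add_one, h j hj.le, add_right_inj] at h1
    exact unitStep_injective h1
  · intro h j hj
    rw [srw, srw]
    congr 1
    exact Finset.sum_congr rfl fun i hi => by rw [h i ((Finset.mem_range.1 hi).trans_le hj)]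

lemma exists_srwPath_eq (l : List V) : ∀ z, (z :: l).IsChain Nbr →
    ∃ u, srwPath z u l.length = z :: l := by
  induction l with
  | nil => exact fun z _ => ⟨0, by simp [srwPath, srw]⟩
  | cons y l ih =>
    intro z h
    rw [List.isChain_cons_cons] at h
    obtain ⟨k, rfl⟩ := exists_unitStep h.1
    obtain ⟨u, hu⟩ := ih _ h.2
    refine ⟨fun j => Nat.casesOn j k u, ?_⟩
    rw [srwPath_eq_cons, ← hu, srwPath]
    simp only [srw_add_one', List.length_map, List.length_range]
    rfl

instance : IsProbabilityMeasure stepsLaw := by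
  unfold stepsLaw
  infer_instance

lemma cylinder_eq_pi (u : ℕ → Fin 4) (n : ℕ) :
    {ξ : ℕ → Fin 4 | ∀ j < n, ξ j = u j} =
      Set.pi (Finset.range n : Set ℕ) fun j => {u j} := by
  ext ξ
  simp [Set.mem_pi]

lemma measurableSet_cylinder (u : ℕ → Fin 4) (n : ℕ) :
    MeasurableSet {ξ : ℕ → Fin 4 | ∀ j < n, ξ j = u j} := by
  rw [cylinder_eq_pi]
  exact MeasurableSet.pi (Finset.range n).countable_toSet fun _ _ => measurableSet_singleton _

lemma stepsLaw_cylinder (u : ℕ → Fin 4) (n : ℕ) :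
    stepsLaw.real {ξ | ∀ j < n, ξ j = u j} = (1 / 4) ^ n := by
  rw [cylinder_eq_pi, stepsLaw, measureReal_def,
    Measure.infinitePi_pi _ fun _ _ => measurableSet_singleton _]
  simp

lemma setOf_srwPath_eq {z : V} {l : List V} (h : (z :: l).IsChain Nbr) :
    ∃ u : ℕ → Fin 4, {ξ | srwPath z ξ l.length = z :: l} = {ξ | ∀ j < l.length, ξ j = u j} := by
  obtain ⟨u, hu⟩ := exists_srwPath_eq l z h
  refine ⟨u, ?_⟩
  ext ξ
  rw [Set.mem_ofPred_eq, ← hu, srwPath_eq_iff]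
  rfl

lemma srwPath_eq_append {z : V} {s : List V} {e : V} {ξ : ℕ → Fin 4} :
    srwPath z ξ (s.length + 1) = z :: (s ++ [e]) ↔
      srwPath z ξ s.length = z :: s ∧ srw z ξ (s.length + 1) = e := by
  rw [srwPath_succ, ← List.cons_append]
  constructor
  · intro h
    obtain ⟨h1, h2⟩ := List.append_inj' h rfl
    exact ⟨h1, by simpa using h2⟩
  · rintro ⟨h1, h2⟩
    rw [h1, h2]

lemma stoppedPath_eq_srwPath (A : Set V) (z : V) (ξ : ℕ → Fin 4) :
    stoppedPath A z ξ = srwPath z ξ (exitTime A z ξ) := rfl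

lemma exitTime_of_stoppedPath_eq {A : Set V} {z : V} {s : List V} {e : V} {ξ : ℕ → Fin 4}
    (h : stoppedPath A z ξ = z :: (s ++ [e])) : exitTime A z ξ = s.length + 1 := by
  have := congrArg List.length h
  simpa [stoppedPath_eq_srwPath, length_srwPath] using this

/-- The list leaves `A` exactly at its end, so the exit time can be read off from its length and the
event depends on finitely many steps only: it is a cylinder. -/
lemma stoppedPath_eq_iff {A : Set V} {z : V} {s : List V} {e : V} (hs : ∀ v ∈ z :: s, v ∈ A)
    (he : e ∉ A) (ξ : ℕ → Fin 4) : stoppedPath A z ξ = z :: (s ++ [e]) ↔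
      srwPath z ξ (s.length + 1) = z :: (s ++ [e]) := by
  constructor
  · intro h
    rw [← exitTime_of_stoppedPath_eq h, ← stoppedPath_eq_srwPath, h]
  · intro h
    suffices exitTime A z ξ = s.length + 1 by rw [stoppedPath_eq_srwPath, this, h]
    obtain ⟨h1, h2⟩ := srwPath_eq_append.1 h
    have hmem : s.length + 1 ∈ {k | srw z ξ k ∉ A} := by rwa [Set.mem_ofPred_eq, h2]
    refine le_antisymm (Nat.sInf_le hmem) (le_csInf ⟨_, hmem⟩ fun k hk => ?_)
    by_contra hlt
    exact hk (hs _ (h1 ▸ mem_srwPath.2 ⟨k, by omega, rfl⟩))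

lemma mem_exitEvent_iff {A : Set V} {z : V} {a : V × V} (hz : z ∈ A) (ha : a.2 ∉ A)
    (h0 : ((0, 0) : V) ∈ A) (h1 : ((1, 0) : V) ∈ A) {ξ : ℕ → Fin 4} :
    ξ ∈ exitEvent A z a ↔ ∃ s : List V, ((∀ v ∈ s, v ∈ A ∧ v ≠ (0, 0) ∧ v ≠ (1, 0)) ∧
      (z :: s).getLast? = some a.1) ∧ stoppedPath A z ξ = z :: (s ++ [a.2]) := by
  constructor
  · rintro ⟨hav, hl, he⟩
    -- A walk that never leaves `A` has exit time `sInf ∅ = 0`; it would end at `z ∈ A`, not at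
    -- `a.2`. So such walks are not in the event, and almost sure finiteness is not needed.
    rcases hτ : exitTime A z ξ with - | n
    · rw [hτ, srw_zero] at he
      exact absurd (he ▸ hz) ha
    · rw [hτ] at hav hl he
      have hs := srwPath_eq_cons z ξ n
      refine ⟨_, ⟨?_, by rw [← hs, getLast?_srwPath]; exact congrArg some hl⟩, ?_⟩
      · intro v hv
        obtain ⟨j, hj, rfl⟩ := List.mem_map.1 hv
        rw [List.mem_range] at hj
        refine ⟨?_, hav _ ⟨by omega, by omega⟩⟩
        by_contra hA
        exact Nat.notMem_of_lt_sInf (s := {k | srw z ξ k ∉ A}) (m := j + 1)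
          (by change j + 1 < exitTime A z ξ; omega) hA
      · rw [stoppedPath_eq_srwPath, hτ, srwPath_succ, he, hs, List.cons_append]
  · rintro ⟨s, ⟨hs, hl⟩, hp⟩
    have hτ := exitTime_of_stoppedPath_eq hp
    rw [stoppedPath_eq_srwPath, hτ, srwPath_eq_append] at hp
    obtain ⟨hp, he⟩ := hp
    refine ⟨fun j hj => ?_, ?_, by rw [hτ, he]⟩
    · obtain ⟨hj1, hj2⟩ := hj
      rw [hτ] at hj2
      rcases hj2.eq_or_lt with rfl | hj2
      · rw [he]
        exact ⟨fun h => ha (h ▸ h0), fun h => ha (h ▸ h1)⟩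
      · refine (hs _ ?_).2
        rw [srwPath_eq_cons, List.cons.injEq] at hp
        rw [← hp.2]
        exact List.mem_map.2 ⟨j - 1, List.mem_range.2 (by omega), by congr 1; omega⟩
    · rw [hτ, Nat.add_sub_cancel]
      rw [← hp, getLast?_srwPath] at hl
      simpa using hl

/-- The integrand is a sum over the possible stopped paths, at most one of which occurs. Each has
probability `p`, and absolute summability lets the integral pass inside. An immediate exit is
permitted here, as it is in `exitKernel`. -/
lemma R_eq {A : Finset V} {f : ℂ → ℂ} {z : V} {a : V × V} {k : ℝ} (hz : z ∈ A) (ha : a.2 ∉ A)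
    (h0 : ((0, 0) : V) ∈ A) (h1 : ((1, 0) : V) ∈ A)
    (hq : ∀ s : List V, (z :: (s ++ [a.2])).IsChain Nbr → (∀ v ∈ z :: s, v ∈ A) →
      (z :: s).getLast? = some a.1 →
      q A f (z :: (s ++ [a.2])) = k * W signWeight (z :: (s ++ [a.2]))) :
    R A f z a = k * exitKernel signWeight (A \ {(0, 0), (1, 0)}) z a := by
  classical
  have hmem : ∀ s : List V, (∀ v ∈ s, v ∈ A \ {(0, 0), (1, 0)}) ↔
      ∀ v ∈ s, v ∈ (A : Set V) ∧ v ≠ (0, 0) ∧ v ≠ (1, 0) := by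
    intro s
    simp only [Finset.mem_sdiff, Finset.mem_insert, Finset.mem_singleton, not_or, Finset.mem_coe,
      ne_eq]
  set T : List V → ℝ := fun s => if (∀ v ∈ s, v ∈ A \ {(0, 0), (1, 0)}) ∧
    (z :: s).getLast? = some a.1 then W signWeight (z :: (s ++ [a.2])) else 0 with hT
  let F : List V → (ℕ → Fin 4) → ℝ := fun s => if ((∀ v ∈ s, v ∈ A \ {(0, 0), (1, 0)}) ∧
      (z :: s).getLast? = some a.1) ∧ (z :: (s ++ [a.2])).IsChain Nbr
    then {ξ | stoppedPath A z ξ = z :: (s ++ [a.2])}.indicator fun _ => Q A f (z :: (s ++ [a.2]))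
    else 0
  have hF : ∀ s, Integrable (F s) stepsLaw ∧ ∫ ξ, F s ξ ∂stepsLaw = k * T s ∧
      ∫ ξ, ‖F s ξ‖ ∂stepsLaw = |k * T s| := by
    intro s
    by_cases hs : ((∀ v ∈ s, v ∈ A \ {(0, 0), (1, 0)}) ∧
      (z :: s).getLast? = some a.1) ∧ (z :: (s ++ [a.2])).IsChain Nbr
    · have hsA : ∀ v ∈ z :: s, v ∈ (A : Set V) := by
        intro v hv
        rcases List.mem_cons.1 hv with rfl | hv
        · exact hz
        · exact ((hmem s).1 hs.1.1 v hv).1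
      have hE : {ξ | stoppedPath A z ξ = z :: (s ++ [a.2])} =
          {ξ | srwPath z ξ (s ++ [a.2]).length = z :: (s ++ [a.2])} := by
        ext ξ
        rw [Set.mem_ofPred_eq, stoppedPath_eq_iff hsA (by simpa using ha)]
        simp
      obtain ⟨u, hu⟩ := setOf_srwPath_eq hs.2
      have hp : (1 / 4 : ℝ) ^ (s ++ [a.2]).length = p (z :: (s ++ [a.2])) := by simp [p, len]
      have hTs : k * T s = p (z :: (s ++ [a.2])) * Q A f (z :: (s ++ [a.2])) := by
        rw [hT]
        simp only [if_pos hs.1]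
        rw [← hq s hs.2 hsA hs.1.2, q]
      simp only [F, if_pos hs, hE, hu]
      have hm := measurableSet_cylinder u (s ++ [a.2]).length
      refine ⟨(integrable_const _).indicator hm, ?_, ?_⟩
      · rw [integral_indicator_const _ hm, stepsLaw_cylinder, hp, smul_eq_mul, hTs]
      · simp only [norm_indicator_eq_indicator_norm]
        rw [integral_indicator_const _ hm, stepsLaw_cylinder, hp, smul_eq_mul, hTs, abs_mul,
          Real.norm_eq_abs, abs_of_nonneg (a := p _) (by unfold p; positivity)]
    · have hTs : T s = 0 := by
        by_contra hne
        rw [hT] at hne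
        simp only [ite_eq_right_iff, Classical.not_imp] at hne
        refine hs ⟨hne.1, ?_⟩
        by_contra hch
        exact hne.2 (W_eq_zero_of_not_isChain isWeight_signWeight _ hch)
      simp only [F, if_neg hs, hTs]
      exact ⟨integrable_zero _ _ _, by simp, by simp⟩
  have hsum : Summable fun s => ∫ ξ, ‖F s ξ‖ ∂stepsLaw := by
    simp only [(hF _).2.2]
    exact ((summable_exitKernel isWeight_signWeight _ z a).mul_left k).abs
  have key := hasSum_integral_of_summable_integral_norm (fun s => (hF s).1) hsum
  have hpt : ∀ ξ, (exitEvent A z a).indicator (fun ξ => Q A f (stoppedPath A z ξ)) ξ =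
      ∑' s, F s ξ := by
    intro ξ
    have hFξ : ∀ s, F s ξ ≠ 0 → ((∀ v ∈ s, v ∈ (A : Set V) ∧ v ≠ (0, 0) ∧ v ≠ (1, 0)) ∧
        (z :: s).getLast? = some a.1) ∧ stoppedPath A z ξ = z :: (s ++ [a.2]) := by
      intro s hs
      by_cases h : ((∀ v ∈ s, v ∈ A \ {(0, 0), (1, 0)}) ∧
        (z :: s).getLast? = some a.1) ∧ (z :: (s ++ [a.2])).IsChain Nbr
      · simp only [F, if_pos h] at hs
        exact ⟨⟨(hmem s).1 h.1.1, h.1.2⟩, Set.mem_of_indicator_ne_zero hs⟩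
      · simp only [F, if_neg h] at hs
        exact absurd rfl hs
    have hev := mem_exitEvent_iff (ξ := ξ) (A := (A : Set V)) (a := a) hz (by simpa using ha)
      h0 h1
    by_cases hξ : ξ ∈ exitEvent A z a
    · obtain ⟨s, h2, h3⟩ := hev.1 hξ
      rw [Set.indicator_of_mem hξ, tsum_eq_single s, h3]
      · have h4 : (z :: (s ++ [a.2])).IsChain Nbr := by
          rw [← h3, stoppedPath_eq_srwPath]
          exact isChain_srwPath _ _ _
        simp only [F, if_pos (And.intro (And.intro ((hmem s).2 h2.1) h2.2) h4)]
        rw [Set.indicator_of_mem]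
        exact h3
      · intro t ht
        by_contra hne
        have := (hFξ t hne).2
        rw [h3] at this
        exact ht (by simpa using this.symm)
    · rw [Set.indicator_of_notMem hξ]
      symm
      refine (tsum_congr fun s => ?_).trans tsum_zero
      by_contra hne
      exact hξ (hev.2 ⟨s, hFξ s hne⟩)
  rw [R, exitKernel, ← tsum_mul_left, integral_congr_ae (ae_of_all _ hpt), ← key.tsum_eq]
  exact tsum_congr fun s => (hF s).2.1

end LERW

namespace LERW

/-! ### Proof of the theorem -/

variable {A : Finset V} {f : ℂ → ℂ}

lemma p_eq_W_of_isLoop (ℓ : List V) (h : IsLoop ℓ) (_ : IsWalkIn A ℓ) : p ℓ = W srwWeight ℓ :=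
  p_eq_W h.1.2

lemma summable_p_isWalkIn (A : Finset V) : Summable fun ω : {ω : List V // IsWalkIn A ω} => p ω :=
  summable_p_of_subset (S := {ω | IsWalkIn A ω}) fun _ h => ⟨h.1.2, h.2⟩

/-- Both products of the determinant carry the same four signs, two from the starting points and two
from the exit edges, so they disappear in the absolute value. -/
lemma abs_detKernel_q (hf : IsNormalizedConformalMap A f) (hw0 : w0 ∈ domainD A) {lam : List V}
    (hlA : ∀ v ∈ lam, v ∈ A) {x y : V} (hx : x ∈ lam) (hy : y ∈ lam) {a b : V × V}
    (ha : a.1 ∉ lam) (hb : b.1 ∉ lam) :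
    |detKernel (q A f) (↑(A \ lam.toFinset)) x y a b| =
      |exitDet signWeight (A \ lam.toFinset) x y a b| := by
  obtain ⟨σ, κ, hσ, hκ, hq⟩ := exists_sign_exitWalk hf hw0
  have key : ∀ z ∈ lam, ∀ c : V × V, c.1 ∉ lam → vertexKernel (q A f) (↑(A \ lam.toFinset)) z c =
      σ z * κ c * exitKernel signWeight (A \ lam.toFinset) z c := by
    intro z hz c hc
    refine vertexKernel_eq isWeight_signWeight (fun h => hc (h ▸ hz)) fun s h1 h2 h3 =>
      hq z c s h1 (fun v hv => ?_) h3
    rcases List.mem_cons.1 hv with rfl | hv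
    · exact hlA _ hz
    · exact (Finset.mem_sdiff.1 (h2 v hv)).1
  rw [detKernel, key x hx a ha, key x hx b hb, key y hy a ha, key y hy b hb, exitDet,
    show ∀ s t u v e1 e2 e3 e4 : ℝ, s * u * e1 * (t * v * e2) - s * v * e3 * (t * u * e4) =
      s * t * (u * v) * (e1 * e2 - e3 * e4) by intros; ring]
  rw [abs_mul, abs_mul, abs_mul, abs_mul, hσ, hσ, hκ, hκ]
  ring

lemma detKernel_p {lam : List V} {x y : V} (hx : x ∈ lam) (hy : y ∈ lam) {a b : V × V}
    (ha : a.1 ∉ lam) (hb : b.1 ∉ lam) :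
    detKernel p (↑(A \ lam.toFinset)) x y a b = exitDet srwWeight (A \ lam.toFinset) x y a b := by
  have key : ∀ z ∈ lam, ∀ c : V × V, c.1 ∉ lam → vertexKernel p (↑(A \ lam.toFinset)) z c =
      1 * exitKernel srwWeight (A \ lam.toFinset) z c :=
    fun z hz c hc => vertexKernel_eq isWeight_srwWeight (fun h => hc (h ▸ hz)) fun s h1 _ _ => by
      rw [p_eq_W h1, one_mul]
  rw [detKernel, key x hx a ha, key x hx b hb, key y hy a ha, key y hy b hb, exitDet]
  ring

lemma abs_R_det (hf : IsNormalizedConformalMap A f) (hw0 : w0 ∈ domainD A)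
    (h0 : ((0, 0) : V) ∈ A) (h1 : ((1, 0) : V) ∈ A) {a b : V × V} (ha : a ∈ edgeBoundary A)
    (hb : b ∈ edgeBoundary A) :
    |R A f (0, 0) a * R A f (1, 0) b - R A f (0, 0) b * R A f (1, 0) a| =
      |exitDet signWeight (A \ {(0, 0), (1, 0)}) (0, 0) (1, 0) a b| := by
  obtain ⟨σ, κ, hσ, hκ, hq⟩ := exists_sign_exitWalk hf hw0
  have key : ∀ z ∈ A, ∀ c ∈ edgeBoundary (A : Set V), R A f z c =
      σ z * κ c * exitKernel signWeight (A \ {(0, 0), (1, 0)}) z c := fun z hz c hc =>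
    R_eq hz hc.2.1 h0 h1 fun s => hq z c s
  rw [key _ h0 a ha, key _ h0 b hb, key _ h1 a ha, key _ h1 b hb, exitDet,
    show ∀ s t u v e1 e2 e3 e4 : ℝ, s * u * e1 * (t * v * e2) - s * v * e3 * (t * u * e4) =
      s * t * (u * v) * (e1 * e2 - e3 * e4) by intros; ring]
  rw [abs_mul, abs_mul, abs_mul, abs_mul, hσ, hσ, hκ, hκ]
  ring

/-- The factor 1/4 is the weight of the step [0,1], and the two Green's functions are the loop term
of this one-edge walk. -/
lemma qBar_eq (hf : IsNormalizedConformalMap A f) (hw0 : w0 ∈ domainD A) :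
    qBar A f = W srwWeight [(0, 0), (1, 0)] * greenProd signWeight A [(0, 0), (1, 0)] := by
  have hW : W srwWeight [(0, 0), (1, 0)] = 1 / 4 := by
    rw [← p_eq_W (by simp [Nbr])]
    simp [p, len]
  have e : (A : Set V) \ {(0, 0)} = ((A.erase (0, 0) : Finset V) : Set V) := by simp
  rw [qBar, e, green_eq_diagGreen isWeight_signWeight fun l => q_loop hf hw0,
    green_eq_diagGreen isWeight_signWeight fun l h h' => q_loop hf hw0 h
      ⟨h'.1, fun v hv => Finset.mem_of_mem_erase (h'.2 v hv)⟩, hW, greenProd, greenProd, greenProd]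
  ring

end LERW

theorem theorem3p1 (A : Set LERW.V) (hA : LERW.IsLatticeDomain A)
    (hw0 : LERW.w0 ∈ LERW.domainD A)
    (f : ℂ → ℂ) (hf : LERW.IsNormalizedConformalMap A f)
    (a b : LERW.V × LERW.V) (ha : a ∈ LERW.edgeBoundary A) (hb : b ∈ LERW.edgeBoundary A)
    (hab : a ≠ b) :
    -- the series that occur below converge absolutely, and no division by zero occurs
    (Summable fun ω : {ω : List LERW.V // LERW.IsWalkIn A ω} => LERW.p ω) ∧
    0 < LERW.edgeKernel A a b ∧
    -- the two descriptions of the odd loops agree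
    (∀ ℓ : List LERW.V, LERW.IsLoop ℓ → LERW.IsWalkIn A ℓ →
      (LERW.Q A f ℓ = -1 ↔ LERW.OddWinding ℓ)) ∧
    -- walks through a given self-avoiding walk
    (∀ (lam : List LERW.V) (x₀ xk : LERW.V),
      LERW.IsWalkIn A lam → lam.Nodup → [((0, 0) : LERW.V), (1, 0)] <:+: lam →
      lam.head? = some x₀ → lam.getLast? = some xk →
      2 * Metric.diam (LERW.toC '' {z | z ∈ lam}) ≤
        Metric.infDist 0 (frontier (LERW.domainD A)) →
      (∑' η : ↥(LERW.sawsThrough A a b lam ∪ LERW.sawsThrough A a b lam.reverse),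
          LERW.pHat A a b η =
        LERW.p lam * Real.exp (2 * LERW.loopMeasure LERW.p (LERW.oddLoops A)) *
          LERW.F (LERW.q A f) {z | z ∈ lam} A *
          |LERW.detKernel (LERW.q A f) (A \ {z | z ∈ lam}) x₀ xk a b|) ∧
      (∑' η : LERW.sawsThrough A a b lam, LERW.pHat A a b η =
        LERW.p lam / 2 *
          (Real.exp (2 * LERW.loopMeasure LERW.p (LERW.oddLoops A)) *
              LERW.F (LERW.q A f) {z | z ∈ lam} A *
              |LERW.detKernel (LERW.q A f) (A \ {z | z ∈ lam}) x₀ xk a b| +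
            LERW.F LERW.p {z | z ∈ lam} A *
              LERW.detKernel LERW.p (A \ {z | z ∈ lam}) x₀ xk a b)) ∧
      (∑' η : LERW.sawsThrough A a b lam.reverse, LERW.pHat A a b η =
        LERW.p lam / 2 *
          (Real.exp (2 * LERW.loopMeasure LERW.p (LERW.oddLoops A)) *
              LERW.F (LERW.q A f) {z | z ∈ lam} A *
              |LERW.detKernel (LERW.q A f) (A \ {z | z ∈ lam}) x₀ xk a b| -
            LERW.F LERW.p {z | z ∈ lam} A *
              LERW.detKernel LERW.p (A \ {z | z ∈ lam}) x₀ xk a b))) ∧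
    -- the probability that loop-erased walk uses the edge `[0,1]`
    LERW.edgeProb A a b =
      LERW.qBar A f * Real.exp (2 * LERW.loopMeasure LERW.p (LERW.oddLoops A)) *
        LERW.Phi A f a b := by
  obtain ⟨A, rfl⟩ := hA.finite.exists_finset_coe
  refine ⟨LERW.summable_p_isWalkIn A, LERW.edgeKernel_pos hA ha hb,
    fun ℓ => LERW.Q_loop_eq_neg_one_iff hf hw0, ?_, ?_⟩
  · intro lam x₀ xk hlam hn hedge h0 hk hdist
    have hlA : ∀ v ∈ lam, v ∈ A := hlam.2
    have hmem := fun c (hc : c ∈ LERW.edgeBoundary (A : Set LERW.V)) =>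
      LERW.not_mem_of_two_mul_diam_le (hedge.subset (by simp)) (hedge.subset (by simp)) hdist hc
    have hx₀ : x₀ ∈ lam := List.mem_of_head? h0
    have hxk : xk ∈ lam := List.mem_of_getLast? hk
    have e : (A : Set LERW.V) \ {z | z ∈ lam} = ((A \ lam.toFinset : Finset LERW.V) : Set LERW.V) := by
      ext v
      simp
    rw [e, LERW.abs_detKernel_q hf hw0 hlA hx₀ hxk (hmem a ha) (hmem b hb),
      LERW.detKernel_p hx₀ hxk (hmem a ha) (hmem b hb),
      LERW.F_eq_exp_loopSum LERW.isWeight_signWeight (fun ℓ => LERW.q_loop hf hw0),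
      LERW.F_eq_exp_loopSum LERW.isWeight_srwWeight LERW.p_eq_W_of_isLoop,
      LERW.exp_loopSum_meets LERW.isWeight_signWeight hn hlA,
      LERW.exp_loopSum_meets LERW.isWeight_srwWeight hn hlA,
      LERW.tsum_pHat_union hA ha hb hlA hedge, LERW.p_eq_W hlam.1.2]
    have e1 := LERW.tsum_pHat_add hA ha hb hlA hn h0 hk hedge
    have e2 := LERW.tsum_pHat_sub ha hb hlA hn h0 hk
    refine ⟨e1, ?_, ?_⟩
    · linear_combination (e1 + e2) / 2
    · linear_combination (e1 - e2) / 2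
  -- The case of the one-edge walk [0,1]. No distance to the boundary is required, because R allows
  -- an exit in the first step.
  · have h0 : ((0, 0) : LERW.V) ∈ A := hA.zero_mem
    have h1 : ((1, 0) : LERW.V) ∈ A := LERW.one_mem_of_w0_mem hw0
    have hlA : ∀ v ∈ [((0, 0) : LERW.V), (1, 0)], v ∈ A := by simp [h0, h1]
    have e : [((0, 0) : LERW.V), (1, 0)].toFinset = {(0, 0), (1, 0)} := by simp
    rw [LERW.edgeProb, LERW.edgeKernelStar_eq, LERW.tsum_pHat_union hA ha hb hlA (List.infix_refl _),
      LERW.tsum_pHat_add (xk := (1, 0)) hA ha hb hlA (by simp) rfl rfl (List.infix_refl _),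
      LERW.Phi,
      LERW.abs_R_det hf hw0 h0 h1 ha hb, LERW.qBar_eq hf hw0, e]
    ring
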